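/- Let $M$ be a smooth manifold (Hausdorff, second countable) and let $\mathcal T M$ be an exact Courant algebroid (extended tangent bundle) on $M$: a smooth vector bundle with a non-degenerate symmetric pairing $\langle\,,\rangle$, an anchor $a:\mathcal TM\to TM$ and an $\mathbb R$-bilinear bracket $*$ on sections, such that for all sections $$\mathfrak X*(\mathfrak Y*\mathfrak Z)=(\mathfrak X*\mathfrak Y)*\mathfrak Z+\mathfrak Y*(\mathfrak X*\mathfrak Z),\qquad a(\mathfrak X)\langle\mathfrak Y,\mathfrak Z\rangle=\langle\mathfrak X,\mathfrak Y*\mathfrak Z+\mathfrak Z*\mathfrak Y\rangle=\langle\mathfrak X*\mathfrak Y,\mathfrak Z\rangle+\langle\mathfrak Y,\mathfrak X*\mathfrak Z\rangle ,$$ and $0\to T^*M\xrightarrow{a^*}\mathcal TM\xrightarrow{a}TM\to0$ is exact, where $2\langle a^*\xi,e\rangle=\xi(a(e))$. For an isotropic splitting $s:TM\to\mathcal TM$ of $a$, let $H_s(X,Y,Z)=2\langle s(X),s(Y)*s(Z)\rangle$ be its twisting $3$-form, and write each section as $\mathfrak X=s(X)+\xi$ with $X=a(\mathfrak X)$ and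 $\xi$ a $1$-form. The splitting $s'=s+\iota_\bullet B$, $B\in\Omega^2(M)$, is denoted $B\circ s$. A spinor $\rho\in\mathcal S(M)$ is a family of inhomogeneous forms $\rho_s\in\Omega^\bullet(M)$, one for each isotropic splitting $s$, with $\rho_{B\circ s}=e^{B}\wedge\rho_s$; spinors are $\mathbb Z/2$-graded by the parity of forms. The operators $$d_{\mathcal T}\rho=d\rho-H_s\wedge\rho,\qquad \iota_{\mathfrak X}\rho=\iota_X\rho+\xi\wedge\rho,\qquad \mathcal L_{\mathfrak X}\rho=\mathcal L_X\rho+(d\xi-\iota_XH_s)\wedge\rho$$ (in each splitting $s$) act on spinors. Let $\mathfrak g$ be a real Lie algebra with basis $\tau_1,\dots,\tau_r$ and dual basis $u_1,\dots,u_r$, and let $\delta:\mathfrak g\to\Gamma(\mathcal TM)$ be a linear map that defines an extended action: $\tau\mapsto\kappa(\delta(\tau))$ is a homomorphism of Lie algebras, where $\kappa(\mathfrak X)=(X,d\xi-\iota_XH_s)\in\Gamma(TM)\oplus\Omega^2(M)$ and $[(X,A),(Y,B)]=([X,Y],\mathcal L_XB-\mathcal L_YA)$. Write $\delta(\tau)=s(X_\tau)+\xi_\tau$,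 $X_j=X_{\tau_j}$, $\xi_j=\xi_{\tau_j}$. The extended equivariant cohomology $H_G^\bullet(\mathcal TM)$ is the $\mathbb Z/2$-graded cohomology of the complex of formal power series $\rho$ on $\mathfrak g$ with values in spinors $$C_{\mathfrak g}(\mathcal TM)=\{\rho\in\mathcal S(M)[[u_1,\dots,u_r]] : \mathcal L_{\delta(\tau)}(\rho(\tau))=0\ \text{for all }\tau\in\mathfrak g\},\qquad d_{\mathcal T,\delta}=d_{\mathcal T}-\sum_ju_j\iota_{\delta(\tau_j)} .$$ Let $C_{\mathfrak g}(M)=\{\rho\in\Omega^\bullet(M)[[u_1,\dots,u_r]]:\mathcal L_{X_\tau}(\rho(\tau))=0\ \text{for all }\tau\in\mathfrak g\}$ and $d_G=d-\sum_ju_j\iota_{X_j}$. Suppose that the action is isotropic, i.e. $\langle\delta(\tau),\delta(\sigma)\rangle=0$ for all $\tau,\sigma\in\mathfrak g$, and preserves the isotropic splitting $s$, i.e. $d\xi_\tau-\iota_{X_\tau}H_s=0$ for all $\tau\in\mathfrak g$. Put $H=H_s$ and $H_G=H+\sum_ju_j\xi_j$. Then: 1. $H_G$ is an equivariantly closed $3$-form: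 it is homogeneous of degree $3$ (the $u_j$ having degree $2$), lies in $C_{\mathfrak g}(M)$, and $d_GH_G=0$. 2. $(C_{\mathfrak g}(\mathcal TM),d_{\mathcal T,\delta})$ and $(C_{\mathfrak g}(M),d_G-H_G\wedge)$ are $\mathbb Z/2$-graded complexes with odd differentials, and taking the representative of a spinor in the splitting $s$ is an isomorphism of complexes from the first to the second. Consequently it induces an isomorphism $H_G^\bullet(\mathcal TM)\cong H_G^\bullet(M;H_G)$, where the right-hand side is the cohomology of $C_{\mathfrak g}(M)$ with differential $d_G-H_G\wedge$ (the $H_G$-twisted equivariant cohomology of $M$). 3. If moreover $\delta([\tau,\sigma])=\delta(\tau)*\delta(\sigma)$ for all $\tau,\sigma\in\mathfrak g$, then $H_G$ is invariant under the diagonal action of $\mathfrak g$ (by Lie derivatives on coefficients and by the coadjoint action on the $u_j$), and 2. also holds with both complexes replaced by the complexes of diagonally $\mathfrak g$-invariant formal power series, where $\mathfrak g$ acts on spinors by $\mathcal L_{\delta(\tau)}$ and on forms by $\mathcal L_{X_\tau}$. -/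

import Mathlib

open Function

/-- Differential forms of degree `k`, for functions `A` and vector fields `L`. -/
abbrev AltForm (A L : Type*) [CommRing A] [LieRing L] [Module A L] (k : ℕ) : Type _ :=
  L [⋀^Fin k]→ₗ[A] A

namespace AltForm

section Calculus

set_option linter.unusedSectionVars false

variable {A L : Type*} [CommRing A] [Algebra ℝ A] [LieRing L] [LieAlgebra ℝ L] [Module A L]
  [LieRingModule L A] [LieRinehartRing A L] [LieRinehartAlgebra ℝ A L]

theorem lieDeriv_aux {A L : Type*} [CommRing A] [LieRing L] [Module A L] {k : ℕ} (X : L)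
    (α : AltForm A L k) (v : Fin k → L) (i : Fin k) (z : L) :
    ∑ j, α (update (update v i z) j ⁅X, update v i z j⁆) = α (update v i ⁅X, z⁆) +
      ∑ j ∈ Finset.univ.erase i, α (update (update v j ⁅X, v j⁆) i z) := by
  rw [← Finset.add_sum_erase _ _ (Finset.mem_univ i)]
  congr 1
  · simp
  · refine Finset.sum_congr rfl fun j hj => ?_
    have hj' : j ≠ i := Finset.ne_of_mem_erase hj
    rw [update_of_ne hj', update_comm hj']

/-- The Lie derivative `(L_X α)(v) = X(α(v)) - ∑ i, α(v₁, …, [X, v_i], …, v_k)`. -/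
def lieDeriv {k : ℕ} (X : L) : AltForm A L k →ₗ[ℝ] AltForm A L k where
  toFun α :=
    { toFun := fun v => ⁅X, α v⁆ - ∑ i, α (update v i ⁅X, v i⁆)
      map_update_add' := by
        intro inst v i x y
        obtain rfl : inst = instDecidableEqFin k := Subsingleton.elim _ _
        simp only [lieDeriv_aux, α.map_update_add, lie_add, Finset.sum_add_distrib]
        abel
      map_update_smul' := by
        intro inst v i c x
        obtain rfl : inst = instDecidableEqFin k := Subsingleton.elim _ _
        simp only [lieDeriv_aux, α.map_update_smul, α.map_update_add,
          LieRinehartRing.leibniz_smul_right, LieRinehartRing.leibniz_mul_right, smul_eq_mul,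
          ← Finset.mul_sum]
        ring
      map_eq_zero_of_eq' := by
        intro v i j hv hij
        show ⁅X, α v⁆ - ∑ i, α (update v i ⁅X, v i⁆) = 0
        rw [α.map_eq_zero_of_eq v hv hij, lie_zero, zero_sub, neg_eq_zero,
          Fintype.sum_eq_add i j hij]
        · have : update v j ⁅X, v j⁆ = (update v i ⁅X, v i⁆) ∘ Equiv.swap i j := by
            ext l
            by_cases hl : l = i
            · subst hl; simp [update_of_ne hij, update_of_ne hij.symm, hv]
            by_cases hl' : l = j
            · subst hl'; simp [hv]
            · simp [update_of_ne hl', Equiv.swap_apply_of_ne_of_ne hl hl', update_of_ne hl]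
          rw [this, α.map_swap _ hij, add_neg_cancel]
        · rintro l ⟨hli, hlj⟩
          exact α.map_eq_zero_of_eq _
            (by rw [update_of_ne hli.symm, update_of_ne hlj.symm, hv]) hij }
  map_add' α β := by
    ext v
    show ⁅X, α v + β v⁆ - ∑ i, (α (update v i ⁅X, v i⁆) + β (update v i ⁅X, v i⁆)) =
      (⁅X, α v⁆ - ∑ i, α (update v i ⁅X, v i⁆)) + (⁅X, β v⁆ - ∑ i, β (update v i ⁅X, v i⁆))
    rw [lie_add, Finset.sum_add_distrib]
    abel
  map_smul' c α := by
    ext v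
    show ⁅X, c • α v⁆ - ∑ i, c • α (update v i ⁅X, v i⁆) =
      c • (⁅X, α v⁆ - ∑ i, α (update v i ⁅X, v i⁆))
    rw [lie_smul, smul_sub, Finset.smul_sum]

theorem lieDeriv_apply {k : ℕ} (X : L) (α : AltForm A L k) (v : Fin k → L) :
    lieDeriv X α v = ⁅X, α v⁆ - ∑ i, α (update v i ⁅X, v i⁆) := rfl

/-- Koszul's formula for the exterior derivative, written for all degrees at once:
`∑ i, (-1)^i v_i(α(v₀, …, v̂_i, …, v_k))
  + ∑ i < j, (-1)^j α(v₀, …, [v_i, v_j], …, v̂_j, …, v_k)`, where the bracket stands in the `i`-th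
place (moving it to the front gives the more usual sign `(-1)^(i+j)`). -/
def koszul {k : ℕ} (α : AltForm A L k) (v : Fin (k + 1) → L) : A :=
  ∑ i : Fin (k + 1), (-1) ^ (i : ℕ) * ⁅v i, α (i.removeNth v)⁆ +
    ∑ i : Fin (k + 1), ∑ j ∈ Finset.Ioi i, (-1) ^ (j : ℕ) * α (j.removeNth (update v i ⁅v i, v j⁆))

theorem koszul_zero (α : AltForm A L 0) (v : Fin 1 → L) : koszul α v = ⁅v 0, α ![]⁆ := by
  have : (0 : Fin 1).removeNth v = ![] := Subsingleton.elim _ _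
  simp [koszul, this]

theorem removeNth_succ_cons {k : ℕ} (j : Fin (k + 1)) (X : L) (v : Fin (k + 1) → L) :
    j.succ.removeNth (Fin.cons X v : Fin (k + 2) → L) =
      (Fin.cons X (j.removeNth v) : Fin (k + 1) → L) := by
  ext i
  refine Fin.cases ?_ (fun i => ?_) i <;> simp [Fin.removeNth]

theorem koszul_cons {k : ℕ} (α : AltForm A L (k + 1)) (X : L) (v : Fin (k + 1) → L) :
    koszul α (Fin.cons X v : Fin (k + 2) → L) =
      lieDeriv X α v - koszul (α.curryLeft X) v := by
  have hc : ∀ w : Fin k → L, α.curryLeft X w = α (Fin.cons X w : Fin (k + 1) → L) :=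
    fun w => rfl
  have h0 : (0 : Fin (k + 2)).removeNth (Fin.cons X v : Fin (k + 2) → L) = v := by
    ext i; simp [Fin.removeNth]
  have hs : ∀ j : Fin (k + 1), (-1 : A) ^ (j : ℕ) *
      α (Fin.cons ⁅X, v j⁆ (j.removeNth v) : Fin (k + 1) → L) = α (update v j ⁅X, v j⁆) := by
    intro j
    rw [← Fin.insertNth_removeNth, AlternatingMap.map_insertNth]
    rcases Nat.even_or_odd (j : ℕ) with h' | h' <;> simp [h'.neg_one_pow] <;> rfl
  rw [lieDeriv_apply, koszul, koszul, Fin.sum_univ_succ, Fin.sum_univ_succ (n := k + 1)]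
  simp only [Fin.sum_Ioi_zero, Fin.sum_Ioi_succ, Fin.cons_zero, Fin.cons_succ, Fin.val_succ,
    Fin.val_zero, pow_zero, one_mul, removeNth_succ_cons, h0, Fin.update_cons_zero,
    ← Fin.cons_update, hs, hc, Finset.sum_neg_distrib, pow_succ, mul_neg, mul_one, neg_mul]
  abel

theorem koszul_add {k : ℕ} (α β : AltForm A L k) (v : Fin (k + 1) → L) :
    koszul (α + β) v = koszul α v + koszul β v := by
  simp only [koszul, AlternatingMap.add_apply, lie_add, mul_add, Finset.sum_add_distrib]
  abel

theorem koszul_smul {k : ℕ} (c : ℝ) (α : AltForm A L k) (v : Fin (k + 1) → L) :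
    koszul (c • α) v = c • koszul α v := by
  simp only [koszul, AlternatingMap.smul_apply, lie_smul, mul_smul_comm, smul_add,
    Finset.smul_sum]

theorem koszul_mul {k : ℕ} (f : A) (α : AltForm A L k) (v : Fin (k + 1) → L) :
    koszul (f • α) v =
      f * koszul α v + ∑ i : Fin (k + 1), (-1) ^ (i : ℕ) * (⁅v i, f⁆ * α (i.removeNth v)) := by
  simp only [koszul, AlternatingMap.smul_apply, smul_eq_mul, LieRinehartRing.leibniz_mul_right,
    mul_add, Finset.mul_sum, Finset.sum_add_distrib]
  have h1 : ∀ (x y : A), x * (f * y) = f * (x * y) := fun x y => by ring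
  simp only [h1]
  abel

theorem lieDeriv_smul_left {k : ℕ} (f : A) (X : L) (α : AltForm A L k) (v : Fin k → L) :
    lieDeriv (f • X) α v =
      f * lieDeriv X α v + ∑ i, ⁅v i, f⁆ * α (update v i X) := by
  have h : ∀ i, ⁅f • X, v i⁆ = f • ⁅X, v i⁆ + (-⁅v i, f⁆) • X := by
    intro i
    rw [← lie_skew, LieRinehartRing.leibniz_smul_right, neg_add, neg_smul, ← smul_neg, lie_skew]
  simp only [lieDeriv_apply, h, AlternatingMap.map_update_add, AlternatingMap.map_update_smul,
    LieRinehartRing.lie_smul_eq_mul, smul_eq_mul, Finset.sum_add_distrib, mul_sub,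
    Finset.mul_sum, neg_mul, Finset.sum_neg_distrib]
  abel

theorem lieDeriv_add_left {k : ℕ} (X Y : L) (α : AltForm A L k) (v : Fin k → L) :
    lieDeriv (X + Y) α v = lieDeriv X α v + lieDeriv Y α v := by
  simp only [lieDeriv_apply, add_lie, AlternatingMap.map_update_add, Finset.sum_add_distrib]
  abel

theorem lieDeriv_self {k : ℕ} (X : L) (α : AltForm A L (k + 1)) (v : Fin k → L) :
    lieDeriv X α (Fin.cons X v : Fin (k + 1) → L) = lieDeriv X (α.curryLeft X) v := by
  have hc : ∀ w : Fin k → L, α.curryLeft X w = α (Fin.cons X w : Fin (k + 1) → L) :=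
    fun w => rfl
  have : α (Fin.cons (0 : L) v : Fin (k + 1) → L) = 0 := α.map_coord_zero 0 (by simp)
  simp [lieDeriv_apply, Fin.sum_univ_succ, this, hc, ← Fin.cons_update]

theorem koszul_update {k : ℕ} : ∀ (α : AltForm A L k) (v : Fin (k + 1) → L)
    (i : Fin (k + 1)) (x y : L) (c : A),
    koszul α (update v i (x + y)) = koszul α (update v i x) + koszul α (update v i y) ∧
      koszul α (update v i (c • x)) = c * koszul α (update v i x) := by
  induction k with
  | zero =>
    intro α v i x y c
    obtain rfl : i = 0 := Fin.fin_one_eq_zero i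
    simp [koszul_zero]
  | succ k ih =>
    intro α v i x y c
    obtain ⟨X, v, rfl⟩ : ∃ X w, v = (Fin.cons X w : Fin (k + 2) → L) :=
      ⟨v 0, Fin.tail v, (Fin.cons_self_tail v).symm⟩
    refine Fin.cases ?_ (fun i => ?_) i
    · simp only [Fin.update_cons_zero, koszul_cons, lieDeriv_add_left, lieDeriv_smul_left,
        map_add, map_smul, koszul_add, koszul_mul]
      refine ⟨by abel, ?_⟩
      have h : ∀ i : Fin (k + 1), (-1 : A) ^ (i : ℕ) * (⁅v i, c⁆ * α.curryLeft x (i.removeNth v))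
          = ⁅v i, c⁆ * α (update v i x) := by
        intro i
        rw [← Fin.insertNth_removeNth, AlternatingMap.map_insertNth,
          AlternatingMap.curryLeft_apply_apply]
        rcases Nat.even_or_odd (i : ℕ) with h' | h' <;> simp [h'.neg_one_pow]
      simp only [h]
      ring
    · have h1 := (ih (α.curryLeft X) v i x y c)
      simp only [← Fin.cons_update, koszul_cons, h1.1, h1.2, AlternatingMap.map_update_add,
        AlternatingMap.map_update_smul, smul_eq_mul]
      exact ⟨by abel, by ring⟩

theorem koszul_cons_cons_self {k : ℕ} (α : AltForm A L (k + 1)) (X : L)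
    (v : Fin k → L) :
    koszul α (Fin.cons X (Fin.cons X v : Fin (k + 1) → L) : Fin (k + 2) → L) = 0 := by
  rw [koszul_cons]
  cases k with
  | zero =>
    have hv : v = ![] := Subsingleton.elim _ _
    rw [koszul_zero, lieDeriv_self, lieDeriv_apply]
    simp [hv]
  | succ k => rw [koszul_cons, lieDeriv_self, AlternatingMap.curryLeft_same]; simp [koszul]

theorem koszul_alt {k : ℕ} : ∀ (α : AltForm A L k) (v : Fin (k + 1) → L)
    (i j : Fin (k + 1)), v i = v j → i ≠ j → koszul α v = 0 := by
  induction k with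
  | zero => exact fun α v i j _ hij => absurd (Subsingleton.elim (α := Fin 1) i j) hij
  | succ k ih =>
    have key : ∀ (α : AltForm A L (k + 1)) (X : L) (w : Fin (k + 1) → L) (j : Fin (k + 1)),
        w j = X → koszul α (Fin.cons X w : Fin (k + 2) → L) = 0 := by
      intro α X w j hj
      let K : AltForm A L (k + 1) :=
        { toFun := koszul (α.curryLeft X)
          map_update_add' := by
            intro inst v i x y
            obtain rfl : inst = instDecidableEqFin (k + 1) := Subsingleton.elim _ _
            exact (koszul_update _ v i x y 0).1
          map_update_smul' := by
            intro inst v i c x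
            obtain rfl : inst = instDecidableEqFin (k + 1) := Subsingleton.elim _ _
            exact (koszul_update _ v i x 0 c).2
          map_eq_zero_of_eq' := ih (α.curryLeft X) }
      have h1 := koszul_cons_cons_self α X (j.removeNth w)
      rw [koszul_cons] at h1
      have hw : w = j.insertNth X (j.removeNth w) := by
        rw [← hj, Fin.insertNth_self_removeNth]
      have h2 : (lieDeriv X α - K) w = 0 := by
        rw [hw, AlternatingMap.map_insertNth]
        have h3 : (lieDeriv X α - K) (Matrix.vecCons X (j.removeNth w)) = 0 := h1
        rw [h3, smul_zero]
      rw [koszul_cons]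
      exact h2
    intro α v i j hv hij
    obtain ⟨X, v, rfl⟩ : ∃ X w, v = (Fin.cons X w : Fin (k + 2) → L) :=
      ⟨v 0, Fin.tail v, (Fin.cons_self_tail v).symm⟩
    induction i using Fin.cases with
    | zero =>
      induction j using Fin.cases with
      | zero => exact absurd rfl hij
      | succ j => exact key α X v j (by simpa using hv.symm)
    | succ i =>
      induction j using Fin.cases with
      | zero => exact key α X v i (by simpa using hv)
      | succ j =>
        have hv' : v i = v j := by simpa using hv
        have hij' : i ≠ j := fun h => hij (by rw [h])
        rw [koszul_cons, ih _ v i j hv' hij', AlternatingMap.map_eq_zero_of_eq _ v hv' hij',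
          sub_zero]

/-- The exterior derivative, given by Koszul's formula. -/
def extDer {k : ℕ} : AltForm A L k →ₗ[ℝ] AltForm A L (k + 1) where
  toFun α :=
    { toFun := koszul α
      map_update_add' := by
        intro inst v i x y
        obtain rfl : inst = instDecidableEqFin (k + 1) := Subsingleton.elim _ _
        exact (koszul_update α v i x y 0).1
      map_update_smul' := by
        intro inst v i c x
        obtain rfl : inst = instDecidableEqFin (k + 1) := Subsingleton.elim _ _
        exact (koszul_update α v i x 0 c).2
      map_eq_zero_of_eq' := koszul_alt α }
  map_add' α β := AlternatingMap.ext fun v => koszul_add α β v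
  map_smul' c α := AlternatingMap.ext fun v => koszul_smul c α v

theorem extDer_apply {k : ℕ} (α : AltForm A L k) (v : Fin (k + 1) → L) :
    extDer α v = koszul α v := rfl

theorem real_smul {k : ℕ} (c : ℝ) (α : AltForm A L k) : c • α = algebraMap ℝ A c • α :=
  AlternatingMap.ext fun v => Algebra.smul_def c (α v)

/-- The wedge product
`(α ∧ β)(v₁, …, v_n) = ∑ sign(σ) α(v_σ(1), …, v_σ(p)) β(v_σ(p+1), …, v_σ(n))`,
the sum running over the `(p, q)`-shuffles `σ`. -/
noncomputable def wedge {p q n : ℕ} (h : p + q = n) :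
    AltForm A L p →ₗ[A] AltForm A L q →ₗ[A] AltForm A L n :=
  (TensorProduct.mk A (AltForm A L p) (AltForm A L q)).compr₂
    ((AlternatingMap.domDomCongrₗ A (finSumFinEquiv.trans (finCongr h))).toLinearMap ∘ₗ
      LinearMap.compAlternatingMapₗ A (LinearMap.mul' A A) ∘ₗ AlternatingMap.domCoprod')

theorem wedge_eq {p q n : ℕ} (h : p + q = n) (α : AltForm A L p) (β : AltForm A L q) :
    wedge h α β = ((LinearMap.mul' A A).compAlternatingMap
      (α.domCoprod β)).domDomCongr (finSumFinEquiv.trans (finCongr h)) := rfl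

end Calculus
end AltForm

/-! Inhomogeneous forms -/

/-- Inhomogeneous differential forms `ω = ∑ k, ω k` with `ω k` of degree `k`. On a manifold the
forms of degree larger than the dimension vanish, so this is the direct sum `⨁ k, Ω^k`. -/
abbrev Forms (A L : Type*) [CommRing A] [LieRing L] [Module A L] : Type _ :=
  ∀ k : ℕ, AltForm A L k

namespace Forms

section Calculus

variable {A L : Type*} [CommRing A] [Algebra ℝ A] [LieRing L] [LieAlgebra ℝ L] [Module A L]
  [LieRingModule L A] [LieRinehartRing A L] [LieRinehartAlgebra ℝ A L]

/-- A form of degree `k`, as an inhomogeneous form. -/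
def of {k : ℕ} (α : AltForm A L k) : Forms A L := Pi.single k α

/-- The exterior derivative `d`. -/
def d : Forms A L →ₗ[ℝ] Forms A L where
  toFun ω
    | 0 => 0
    | k + 1 => AltForm.extDer (ω k)
  map_add' α β := by
    funext k
    cases k with
    | zero => exact (add_zero 0).symm
    | succ k => exact map_add AltForm.extDer (α k) (β k)
  map_smul' c α := by
    funext k
    cases k with
    | zero => exact (smul_zero c).symm
    | succ k => exact map_smul AltForm.extDer c (α k)

/-- The interior product `ι_X`. -/
def interior (X : L) : Forms A L →ₗ[ℝ] Forms A L where
  toFun ω k := (ω (k + 1)).curryLeft X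
  map_add' _ _ := rfl
  map_smul' _ _ := rfl

/-- The Lie derivative `L_X`. -/
def lie (X : L) : Forms A L →ₗ[ℝ] Forms A L where
  toFun ω k := AltForm.lieDeriv X (ω k)
  map_add' α β := funext fun k => map_add (AltForm.lieDeriv X) (α k) (β k)
  map_smul' c α := funext fun k => map_smul (AltForm.lieDeriv X) c (α k)

/-- The wedge product. -/
noncomputable def wedge : Forms A L →ₗ[ℝ] Forms A L →ₗ[ℝ] Forms A L :=
  LinearMap.mk₂ ℝ
    (fun α β n => ∑ x : Finset.HasAntidiagonal.antidiagonal n,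
      AltForm.wedge (Finset.HasAntidiagonal.mem_antidiagonal.1 x.2) (α x.1.1) (β x.1.2))
    (fun α α' β => by
      funext n
      simp only [Pi.add_apply, map_add, LinearMap.add_apply, Finset.sum_add_distrib])
    (fun c α β => by
      funext n
      simp only [Pi.smul_apply, AltForm.real_smul, map_smul, LinearMap.smul_apply,
        Finset.smul_sum])
    (fun α β β' => by
      funext n
      simp only [Pi.add_apply, map_add, Finset.sum_add_distrib])
    (fun c α β => by
      funext n
      simp only [Pi.smul_apply, AltForm.real_smul, map_smul, Finset.smul_sum])

/-- The powers `B ∧ ⋯ ∧ B` of a `2`-form, with `B⁰ = 1`. -/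
noncomputable def pow2 (B : AltForm A L 2) : ℕ → Forms A L
  | 0 => of (AlternatingMap.constOfIsEmpty A L (Fin 0) 1)
  | j + 1 => wedge (of B) (pow2 B j)

/-- The exponential `e^B = ∑ j, B^j / j!` of a `2`-form; in each degree the sum is finite, as `B^j`
has degree `2 j`. -/
noncomputable def exp2 (B : AltForm A L 2) : Forms A L :=
  fun k => ∑ j ∈ Finset.range (k + 1), ((j.factorial : ℝ)⁻¹ • pow2 B j) k

/-- The inhomogeneous forms of even (`i = 0`) or odd (`i = 1`) degree. -/
def parity (i : ZMod 2) : Submodule ℝ (Forms A L) where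
  carrier := {ω | ∀ k : ℕ, (k : ZMod 2) ≠ i → ω k = 0}
  add_mem' {α β} hα hβ k hk := by rw [Pi.add_apply, hα k hk, hβ k hk, add_zero]
  zero_mem' _ _ := rfl
  smul_mem' c α hα k hk := by rw [Pi.smul_apply, hα k hk, smul_zero]

end Calculus

end Forms

/-! Formal power series in `u₁, …, u_r` -/

/-- Formal power series `ρ = ∑ m, u^m ρ_m` in the variables `u₁, …, u_r` with coefficients in
`V`. -/
abbrev Series (r : ℕ) (V : Type*) : Type _ := (Fin r →₀ ℕ) → V

namespace Series

variable {r : ℕ} {V W : Type*} [AddCommGroup V] [Module ℝ V] [AddCommGroup W] [Module ℝ W]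

/-- The series `u^m v`. -/
def single (m : Fin r →₀ ℕ) (v : V) : Series r V := Pi.single m v

/-- Multiplication by the variable `u_j`. -/
noncomputable def mulVar (j : Fin r) : Series r V →ₗ[ℝ] Series r V where
  toFun ρ m := if m j = 0 then 0 else ρ (m - Finsupp.single j 1)
  map_add' ρ σ := by
    funext m
    by_cases h : m j = 0 <;> simp [h]
  map_smul' c ρ := by
    funext m
    by_cases h : m j = 0 <;> simp [h]

/-- The partial derivative `∂/∂u_j`. -/
noncomputable def partialDeriv (j : Fin r) : Series r V →ₗ[ℝ] Series r V where
  toFun ρ m := ((m j : ℝ) + 1) • ρ (m + Finsupp.single j 1)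
  map_add' ρ σ := by
    funext m
    simp
  map_smul' c ρ := by
    funext m
    simp [smul_comm c]

/-- A linear map, applied to each coefficient. -/
def map (f : V →ₗ[ℝ] W) : Series r V →ₗ[ℝ] Series r W := f.compLeft (Fin r →₀ ℕ)

/-- The series all of whose coefficients lie in a given subspace. -/
def coeffsIn (p : Submodule ℝ V) : Submodule ℝ (Series r V) :=
  Submodule.pi Set.univ fun _ => p

section Invariants

variable {𝔤 : Type*} [LieRing 𝔤] [LieAlgebra ℝ 𝔤] (b : Module.Basis (Fin r) ℝ 𝔤)

/-- For operators `θ τ` on `V`, `τ ∈ 𝔤`: the formal series `ρ` on `𝔤` (the variables `u_j` being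
the coordinates of the basis `b`) with `θ(τ) (ρ(τ)) = 0` for all `τ ∈ 𝔤`, that is, with
`∑ j, u_j θ(b_j) ρ = 0`. -/
noncomputable def annihilated (θ : 𝔤 → V →ₗ[ℝ] V) : Submodule ℝ (Series r V) :=
  LinearMap.ker (∑ j, mulVar j ∘ₗ map (θ (b j)))

/-- The coadjoint action of `τ ∈ 𝔤` on formal series on `𝔤`: the derivation with
`(τ · u_j)(σ) = - u_j([τ, σ])`. -/
noncomputable def coad (τ : 𝔤) : Series r V →ₗ[ℝ] Series r V :=
  - ∑ j, ∑ k, b.repr ⁅τ, b k⁆ j • (mulVar k ∘ₗ partialDeriv j)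

/-- The formal series that are invariant under the diagonal action of `𝔤`, which acts on the
coefficients by `θ` and on the variables by the coadjoint action. -/
noncomputable def invariants (θ : 𝔤 → V →ₗ[ℝ] V) : Submodule ℝ (Series r V) :=
  ⨅ τ : 𝔤, LinearMap.ker (map (θ τ) + coad b τ)

end Invariants

end Series

/-! Two-periodic complexes -/

section TwoPeriodic

variable {V : Type*} [AddCommGroup V] [Module ℝ V]

/-- The subspace `C` of the `ℤ/2`-graded space with graded parts `P 0`, `P 1` is graded, and the
operator `D` makes it a complex: `D` maps `C` to itself, is odd, and has square zero on `C`. -/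
structure IsTwoPeriodicComplex (P : ZMod 2 → Submodule ℝ V) (C : Submodule ℝ V)
    (D : V →ₗ[ℝ] V) : Prop where
  graded : C = (C ⊓ P 0) ⊔ (C ⊓ P 1)
  odd : ∀ i, ∀ x ∈ C ⊓ P i, D x ∈ C ⊓ P (i + 1)
  square_zero : ∀ x ∈ C, D (D x) = 0

/-- The cocycles of parity `i`. -/
def cocycles (P : ZMod 2 → Submodule ℝ V) (C : Submodule ℝ V) (D : V →ₗ[ℝ] V) (i : ZMod 2) :
    Submodule ℝ V :=
  C ⊓ P i ⊓ LinearMap.ker D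

/-- The coboundaries of parity `i`. -/
def coboundaries (P : ZMod 2 → Submodule ℝ V) (C : Submodule ℝ V) (D : V →ₗ[ℝ] V) (i : ZMod 2) :
    Submodule ℝ V :=
  (C ⊓ P (i + 1)).map D

/-- The cohomology in parity `i`: cocycles modulo coboundaries. -/
abbrev Cohomology (P : ZMod 2 → Submodule ℝ V) (C : Submodule ℝ V) (D : V →ₗ[ℝ] V)
    (i : ZMod 2) : Type _ :=
  cocycles P C D i ⧸ (coboundaries P C D i).submoduleOf (cocycles P C D i)

end TwoPeriodic

section TwoPeriodicMaps

variable {V V' : Type*} [AddCommGroup V] [Module ℝ V] [AddCommGroup V'] [Module ℝ V']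

/-- The linear map `Φ` restricts to an isomorphism from the complex `(C, D)` to the complex
`(C', D')`. -/
structure IsComplexIso (P : ZMod 2 → Submodule ℝ V) (C : Submodule ℝ V) (D : V →ₗ[ℝ] V)
    (P' : ZMod 2 → Submodule ℝ V') (C' : Submodule ℝ V') (D' : V' →ₗ[ℝ] V')
    (Φ : V →ₗ[ℝ] V') : Prop where
  source : IsTwoPeriodicComplex P C D
  target : IsTwoPeriodicComplex P' C' D'
  bijOn : Set.BijOn Φ C C'
  parity : ∀ i, ∀ x ∈ C, x ∈ P i ↔ Φ x ∈ P' i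
  comm : ∀ x ∈ C, Φ (D x) = D' (Φ x)

/-- The linear isomorphism `e` is the map in cohomology that is induced by `Φ`. -/
def IsInducedBy {P : ZMod 2 → Submodule ℝ V} {C : Submodule ℝ V} {D : V →ₗ[ℝ] V}
    {P' : ZMod 2 → Submodule ℝ V'} {C' : Submodule ℝ V'} {D' : V' →ₗ[ℝ] V'} {i : ZMod 2}
    (e : Cohomology P C D i ≃ₗ[ℝ] Cohomology P' C' D' i) (Φ : V →ₗ[ℝ] V') : Prop :=
  ∀ z : cocycles P C D i, ∃ h : Φ z ∈ cocycles P' C' D' i,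
    e (Submodule.Quotient.mk z) = Submodule.Quotient.mk ⟨Φ z, h⟩

end TwoPeriodicMaps

/-! Differential forms with formal power series coefficients -/

namespace Series

section Cartan

variable {A L : Type*} [CommRing A] [Algebra ℝ A] [LieRing L] [LieAlgebra ℝ L] [Module A L]
  [LieRingModule L A] [LieRinehartRing A L] [LieRinehartAlgebra ℝ A L] {r : ℕ}

/-- The wedge product with `α` on `Ω(M) ⊗ ℝ[[u₁, …, u_r]]`. -/
noncomputable def wedge (α : Series r (Forms A L)) :
    Series r (Forms A L) →ₗ[ℝ] Series r (Forms A L) :=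
  LinearMap.pi fun m => ∑ x ∈ Finset.HasAntidiagonal.antidiagonal m,
    Forms.wedge (α x.1) ∘ₗ LinearMap.proj x.2

/-- The Cartan differential `d_G = d - ∑ j, u_j ι_{X_j}`. -/
noncomputable def cartanD (X : Fin r → L) : Series r (Forms A L) →ₗ[ℝ] Series r (Forms A L) :=
  map Forms.d - ∑ j, mulVar j ∘ₗ map (Forms.interior (X j))

end Cartan

end Series

open scoped Manifold ContDiff Bundle


section Manifolds

set_option linter.unusedSectionVars false
variable {n : ℕ} {M : Type*} [TopologicalSpace M] [ChartedSpace (EuclideanSpace ℝ (Fin n)) M]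

/-- Smooth functions. -/
abbrev SmoothFn (n : ℕ) (M : Type*) [TopologicalSpace M]
    [ChartedSpace (EuclideanSpace ℝ (Fin n)) M] : Type _ := C^∞⟮𝓡 n, M; ℝ⟯

section Sections
variable {F : Type*} [NormedAddCommGroup F] [NormedSpace ℝ F]
  {E : M → Type*} [TopologicalSpace (Bundle.TotalSpace F E)] [∀ x, AddCommGroup (E x)]
  [∀ x, Module ℝ (E x)] [∀ x, TopologicalSpace (E x)] [FiberBundle F E] [VectorBundle ℝ F E]

/-- The module structure of smooth sections over smooth functions. -/
noncomputable instance sectionModule : Module (SmoothFn n M) Cₛ^∞⟮𝓡 n; F, E⟯ where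
  smul f u := ⟨fun x => f x • u x, f.contMDiff.smul_section u.contMDiff⟩
  one_smul u := by ext x; exact one_smul ℝ (u x)
  mul_smul f g u := by ext x; exact mul_smul (f x) (g x) (u x)
  smul_zero f := by ext x; exact smul_zero (f x)
  smul_add f u v := by ext x; exact smul_add (f x) (u x) (v x)
  add_smul f g u := by ext x; exact add_smul (f x) (g x) (u x)
  zero_smul u := by ext x; exact zero_smul ℝ (u x)

theorem section_smul_apply (f : SmoothFn n M) (u : Cₛ^∞⟮𝓡 n; F, E⟯) (x : M) :
    (f • u) x = f x • u x := rfl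

instance : IsScalarTower ℝ (SmoothFn n M) Cₛ^∞⟮𝓡 n; F, E⟯ where
  smul_assoc c f u := by ext x; exact smul_assoc c (f x) (u x)

end Sections

variable [IsManifold (𝓡 n) ∞ M]

/-- Smooth vector fields. -/
abbrev VecField (n : ℕ) (M : Type*) [TopologicalSpace M]
    [ChartedSpace (EuclideanSpace ℝ (Fin n)) M] [IsManifold (𝓡 n) ∞ M] : Type _ :=
  Cₛ^∞⟮𝓡 n; EuclideanSpace ℝ (Fin n), (TangentSpace (𝓡 n) : M → Type _)⟯

namespace VecField

theorem mdiff (X : VecField n M) (x : M) :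
    MDifferentiableAt (𝓡 n) (𝓡 n).tangent (fun y => (X y : TangentBundle (𝓡 n) M)) x :=
  X.mdifferentiableAt

theorem fn_mdiff (f : SmoothFn n M) (x : M) : MDifferentiableAt (𝓡 n) 𝓘(ℝ, ℝ) f x :=
  f.contMDiff.mdifferentiable (by simp) x

theorem isManifold_two : IsManifold (𝓡 n) 2 M := inferInstance

/-- The Lie bracket of smooth vector fields. -/
noncomputable instance : Bracket (VecField n M) (VecField n M) where
  bracket X Y := ⟨VectorField.mlieBracket (𝓡 n) X Y, by
    have : IsManifold (𝓡 n) (((⊤ : ℕ∞) : WithTop ℕ∞) + 1) M := by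
      simpa using ‹IsManifold (𝓡 n) ∞ M›
    have : IsManifold (𝓡 n) (minSmoothness ℝ 2) M := by simpa using isManifold_two
    exact ContDiff.mlieBracket_vectorField (m := ⊤) (n := ⊤) X.contMDiff Y.contMDiff (by simp)⟩

theorem lie_apply (X Y : VecField n M) (x : M) :
    ⁅X, Y⁆ x = VectorField.mlieBracket (𝓡 n) X Y x := rfl

noncomputable instance : LieRing (VecField n M) where
  add_lie X Y Z := by
    ext x
    exact VectorField.mlieBracket_add_left (X.mdiff x) (Y.mdiff x)
  lie_add X Y Z := by
    ext x
    exact VectorField.mlieBracket_add_right (Y.mdiff x) (Z.mdiff x)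
  lie_self X := by
    ext x
    exact congrFun VectorField.mlieBracket_self x
  leibniz_lie X Y Z := by
    have : IsManifold (𝓡 n) (minSmoothness ℝ 3) M := by
      simpa using (inferInstance : IsManifold (𝓡 n) 3 M)
    have h : minSmoothness ℝ 2 ≤ ∞ := by simpa using ENat.LEInfty.out
    ext x
    exact VectorField.leibniz_identity_mlieBracket_apply
      (X.contMDiff.of_le h x) (Y.contMDiff.of_le h x) (Z.contMDiff.of_le h x)

noncomputable instance : LieAlgebra ℝ (VecField n M) where
  lie_smul c X Y := by
    ext x
    exact VectorField.mlieBracket_const_smul_right (Y.mdiff x)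

/-- Vector fields act on functions by directional derivatives. -/
noncomputable instance : Bracket (VecField n M) (SmoothFn n M) where
  bracket X f := ⟨fun x => mvfderiv (𝓡 n) f x (X x), by
    have h1 : ContMDiff (𝓡 n).tangent 𝓘(ℝ, ℝ).tangent ∞ (tangentMap (𝓡 n) 𝓘(ℝ, ℝ) f) :=
      f.contMDiff.contMDiff_tangentMap (by simp)
    exact (contMDiff_snd_tangentBundle_modelSpace ℝ 𝓘(ℝ, ℝ)).comp (h1.comp X.contMDiff)⟩

theorem lie_fn_apply (X : VecField n M) (f : SmoothFn n M) (x : M) :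
    ⁅X, f⁆ x = mvfderiv (𝓡 n) f x (X x) := rfl

theorem lie_smul_fn (X Y : VecField n M) (f : SmoothFn n M) :
    ⁅X, f • Y⁆ = f • ⁅X, Y⁆ + ⁅X, f⁆ • Y := by
  ext x
  rw [add_comm]
  exact VectorField.mlieBracket_smul_right (fn_mdiff f x) (Y.mdiff x)

theorem lie_fn_add (X : VecField n M) (f g : SmoothFn n M) :
    ⁅X, f + g⁆ = ⁅X, f⁆ + ⁅X, g⁆ := by
  ext x
  show mvfderiv (𝓡 n) (f + g : M → ℝ) x (X x) = _
  rw [mvfderiv_add (fn_mdiff f x) (fn_mdiff g x)]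
  rfl

noncomputable instance : LieRingModule (VecField n M) (SmoothFn n M) where
  add_lie X Y f := by
    ext x
    exact map_add (mvfderiv (𝓡 n) f x) (X x) (Y x)
  lie_add := lie_fn_add
  leibniz_lie X Y f := by
    have key : ∀ Z : VecField n M, (⁅X, ⁅Y, f⁆⁆ - ⁅⁅X, Y⁆, f⁆ - ⁅Y, ⁅X, f⁆⁆) • Z = 0 := by
      intro Z
      have h := leibniz_lie X Y (f • Z)
      simp only [lie_smul_fn, lie_add, leibniz_lie X Y Z] at h
      rw [← sub_eq_zero] at h
      rw [← h]
      module
    ext x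
    have hX : (⁅X, ⁅Y, f⁆⁆ - ⁅⁅X, Y⁆, f⁆ - ⁅Y, ⁅X, f⁆⁆ : SmoothFn n M) x • X x = 0 :=
      congrArg (fun Z : VecField n M => Z x) (key X)
    have hY : (⁅X, ⁅Y, f⁆⁆ - ⁅⁅X, Y⁆, f⁆ - ⁅Y, ⁅X, f⁆⁆ : SmoothFn n M) x • Y x = 0 :=
      congrArg (fun Z : VecField n M => Z x) (key Y)
    have hsub : (⁅X, ⁅Y, f⁆⁆ - ⁅⁅X, Y⁆, f⁆ - ⁅Y, ⁅X, f⁆⁆ : SmoothFn n M) x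
        = ⁅X, ⁅Y, f⁆⁆ x - ⁅⁅X, Y⁆, f⁆ x - ⁅Y, ⁅X, f⁆⁆ x := rfl
    show ⁅X, ⁅Y, f⁆⁆ x = ⁅⁅X, Y⁆, f⁆ x + ⁅Y, ⁅X, f⁆⁆ x
    rcases smul_eq_zero.1 hX with h | h
    · rw [hsub] at h
      linear_combination h
    rcases smul_eq_zero.1 hY with h' | h'
    · rw [hsub] at h'
      linear_combination h'
    have h0 : ⁅X, Y⁆ x = 0 := by
      rw [lie_apply, ← VectorField.mlieBracketWithin_univ]
      exact VectorField.mlieBracketWithin_eq_zero_of_eq_zero h h'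
    simp only [lie_fn_apply, h, h', h0, map_zero, add_zero]

noncomputable instance : LieRinehartRing (SmoothFn n M) (VecField n M) where
  lie_smul_eq_mul' f g X := by
    ext x
    exact map_smul (mvfderiv (𝓡 n) g x) (f x) (X x)
  leibniz_mul_right' X f g := by
    ext x
    show mvfderiv (𝓡 n) (f * g : M → ℝ) x (X x) = _
    rw [mvfderiv_mul (fn_mdiff f x) (fn_mdiff g x)]
    show f x * mvfderiv (𝓡 n) g x (X x) + g x * mvfderiv (𝓡 n) f x (X x) =
      f x * mvfderiv (𝓡 n) g x (X x) + mvfderiv (𝓡 n) f x (X x) * g x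
    ring
  leibniz_smul_right' X Y f := lie_smul_fn X Y f

noncomputable instance : LieRinehartAlgebra ℝ (SmoothFn n M) (VecField n M) where
  smul_lie c X f := by
    ext x
    exact map_smul (mvfderiv (𝓡 n) f x) c (X x)
  lie_smul c X f := by
    ext x
    show mvfderiv (𝓡 n) ((fun _ : M => c) • (f : M → ℝ)) x (X x) = _
    rw [mvfderiv_smul mdifferentiableAt_const (fn_mdiff f x), mvfderiv_const]
    simp
    exact Or.inl rfl

end VecField
end Manifolds

/-! Exact Courant algebroids -/

section Courant

set_option linter.unusedSectionVars false

/-- Smooth sections of a vector bundle. -/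
abbrev SmoothSec (n : ℕ) {M : Type*} [TopologicalSpace M]
    [ChartedSpace (EuclideanSpace ℝ (Fin n)) M]
    (F : Type*) [NormedAddCommGroup F] [NormedSpace ℝ F]
    (E : M → Type*) [TopologicalSpace (Bundle.TotalSpace F E)] [∀ x, AddCommGroup (E x)]
    [∀ x, Module ℝ (E x)] [∀ x, TopologicalSpace (E x)] [FiberBundle F E]
    [VectorBundle ℝ F E] : Type _ :=
  Cₛ^∞⟮𝓡 n; F, E⟯

/-- An exact Courant algebroid (extended tangent bundle) structure on the smooth vector bundle `E`
over `M`. -/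
structure ExactCourantAlgebroid (n : ℕ) {M : Type*} [TopologicalSpace M]
    [ChartedSpace (EuclideanSpace ℝ (Fin n)) M] [IsManifold (𝓡 n) ∞ M]
    (F : Type*) [NormedAddCommGroup F] [NormedSpace ℝ F]
    (E : M → Type*) [TopologicalSpace (Bundle.TotalSpace F E)] [∀ x, AddCommGroup (E x)]
    [∀ x, Module ℝ (E x)] [∀ x, TopologicalSpace (E x)] [FiberBundle F E]
    [VectorBundle ℝ F E] where
  /-- The pairing `⟨ , ⟩`. -/
  pairing : ∀ x : M, E x →ₗ[ℝ] E x →ₗ[ℝ] ℝ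
  pairing_symm : ∀ x e e', pairing x e e' = pairing x e' e
  pairing_nondegenerate : ∀ x e, (∀ e', pairing x e e' = 0) → e = 0
  pairing_smooth : ∀ 𝔛 𝔜 : SmoothSec n F E,
    ContMDiff (𝓡 n) 𝓘(ℝ, ℝ) ∞ fun x => pairing x (𝔛 x) (𝔜 x)
  /-- The anchor `a : E → TM`. -/
  anchor : ∀ x : M, E x →ₗ[ℝ] TangentSpace (𝓡 n) x
  anchor_smooth : ContMDiff ((𝓡 n).prod 𝓘(ℝ, F)) (𝓡 n).tangent ∞
    fun e : Bundle.TotalSpace F E => (⟨e.proj, anchor e.proj e.2⟩ : TangentBundle (𝓡 n) M)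
  /-- The Loday bracket `𝔛 * 𝔜`. -/
  bracket : SmoothSec n F E →ₗ[ℝ] SmoothSec n F E →ₗ[ℝ] SmoothSec n F E
  jacobi : ∀ 𝔛 𝔜 ℨ : SmoothSec n F E,
    bracket 𝔛 (bracket 𝔜 ℨ) = bracket (bracket 𝔛 𝔜) ℨ + bracket 𝔜 (bracket 𝔛 ℨ)
  anchor_pairing : ∀ (𝔛 𝔜 ℨ : SmoothSec n F E) (x : M),
    mvfderiv (𝓡 n) (fun y => pairing y (𝔜 y) (ℨ y)) x (anchor x (𝔛 x)) =
      pairing x (𝔛 x) ((bracket 𝔜 ℨ + bracket ℨ 𝔜) x)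
  anchor_pairing' : ∀ (𝔛 𝔜 ℨ : SmoothSec n F E) (x : M),
    mvfderiv (𝓡 n) (fun y => pairing y (𝔜 y) (ℨ y)) x (anchor x (𝔛 x)) =
      pairing x (bracket 𝔛 𝔜 x) (ℨ x) + pairing x (𝔜 x) (bracket 𝔛 ℨ x)
  anchor_surjective : ∀ x, Surjective (anchor x)
  /-- The kernel of the anchor is the image of `a^* : T^*M → E`, the dual of the anchor when `E` is
  identified with its dual by `2⟨ , ⟩`. -/
  anchor_ker : ∀ (x : M) (e : E x), anchor x e = 0 ↔
    ∃ ξ : TangentSpace (𝓡 n) x →ₗ[ℝ] ℝ, ∀ e', 2 * pairing x e e' = ξ (anchor x e')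

variable {n : ℕ} {M : Type*} [TopologicalSpace M] [ChartedSpace (EuclideanSpace ℝ (Fin n)) M]
  [IsManifold (𝓡 n) ∞ M] {F : Type*} [NormedAddCommGroup F] [NormedSpace ℝ F]
  {E : M → Type*} [TopologicalSpace (Bundle.TotalSpace F E)] [∀ x, AddCommGroup (E x)]
  [∀ x, Module ℝ (E x)] [∀ x, TopologicalSpace (E x)] [FiberBundle F E] [VectorBundle ℝ F E]

namespace ExactCourantAlgebroid

variable (C : ExactCourantAlgebroid n F E)

/-- The pairing of smooth sections. -/
noncomputable def pair :
    SmoothSec n F E →ₗ[SmoothFn n M] SmoothSec n F E →ₗ[SmoothFn n M] SmoothFn n M :=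
  LinearMap.mk₂ (SmoothFn n M) (fun 𝔛 𝔜 => ⟨fun x => C.pairing x (𝔛 x) (𝔜 x),
      C.pairing_smooth 𝔛 𝔜⟩)
    (fun 𝔛 𝔛' 𝔜 => by
      ext x
      exact LinearMap.map_add₂ (C.pairing x) (𝔛 x) (𝔛' x) (𝔜 x))
    (fun f 𝔛 𝔜 => by
      ext x
      exact LinearMap.map_smul₂ (C.pairing x) (f x) (𝔛 x) (𝔜 x))
    (fun 𝔛 𝔜 𝔜' => by
      ext x
      exact map_add (C.pairing x (𝔛 x)) (𝔜 x) (𝔜' x))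
    (fun f 𝔛 𝔜 => by
      ext x
      exact map_smul (C.pairing x (𝔛 x)) (f x) (𝔜 x))

theorem pair_apply (𝔛 𝔜 : SmoothSec n F E) (x : M) :
    C.pair 𝔛 𝔜 x = C.pairing x (𝔛 x) (𝔜 x) := rfl

/-- The anchor on smooth sections. -/
noncomputable def anchorField : SmoothSec n F E →ₗ[SmoothFn n M] VecField n M where
  toFun 𝔛 := ⟨fun x => C.anchor x (𝔛 x), C.anchor_smooth.comp 𝔛.contMDiff⟩
  map_add' 𝔛 𝔜 := by
    ext x : 1
    exact map_add (C.anchor x) (𝔛 x) (𝔜 x)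
  map_smul' f 𝔛 := by
    ext x : 1
    exact map_smul (C.anchor x) (f x) (𝔛 x)

theorem anchorField_apply (𝔛 : SmoothSec n F E) (x : M) :
    C.anchorField 𝔛 x = C.anchor x (𝔛 x) := rfl

/-- An isotropic splitting `s : TM → E`. -/
structure IsotropicSplitting where
  /-- The underlying map. -/
  toFun : ∀ x : M, TangentSpace (𝓡 n) x →ₗ[ℝ] E x
  smooth : ContMDiff (𝓡 n).tangent ((𝓡 n).prod 𝓘(ℝ, F)) ∞
    fun v : TangentBundle (𝓡 n) M => (⟨v.proj, toFun v.proj v.2⟩ : Bundle.TotalSpace F E)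
  anchor_toFun : ∀ x v, C.anchor x (toFun x v) = v
  isotropic : ∀ x v w, C.pairing x (toFun x v) (toFun x w) = 0

namespace IsotropicSplitting

variable {C} (s s' : C.IsotropicSplitting)

/-- The splitting on vector fields. -/
noncomputable def sec : VecField n M →ₗ[SmoothFn n M] SmoothSec n F E where
  toFun X := ⟨fun x => s.toFun x (X x), s.smooth.comp X.contMDiff⟩
  map_add' X Y := by
    ext x : 1
    exact map_add (s.toFun x) (X x) (Y x)
  map_smul' f X := by
    ext x : 1
    exact map_smul (s.toFun x) (f x) (X x)

theorem sec_apply (X : VecField n M) (x : M) : s.sec X x = s.toFun x (X x) := rfl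

/-- The function `2⟨s(X), s(Y) * s(Z)⟩`. -/
noncomputable def triple (X Y Z : VecField n M) : SmoothFn n M :=
  (2 : ℝ) • C.pair (s.sec X) (C.bracket (s.sec Y) (s.sec Z))

theorem mvfderiv_zero_pairing (X : VecField n M) (Y : VecField n M) (x : M)
    (v : TangentSpace (𝓡 n) x) :
    mvfderiv (𝓡 n) (fun y => C.pairing y (s.sec X y) (s.sec Y y)) x v = 0 := by
  have : (fun y => C.pairing y (s.sec X y) (s.sec Y y)) = fun _ => (0 : ℝ) :=
    funext fun y => s.isotropic y _ _
  rw [this, mvfderiv_const]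
  rfl

theorem triple_swap_right (X Y Z : VecField n M) : s.triple X Y Z = - s.triple X Z Y := by
  ext x
  have h := C.anchor_pairing (s.sec X) (s.sec Y) (s.sec Z) x
  rw [mvfderiv_zero_pairing] at h
  have h' : C.pairing x (s.sec X x) ((C.bracket (s.sec Y) (s.sec Z) +
      C.bracket (s.sec Z) (s.sec Y)) x) = C.pairing x (s.sec X x) (C.bracket (s.sec Y) (s.sec Z) x)
      + C.pairing x (s.sec X x) (C.bracket (s.sec Z) (s.sec Y) x) := map_add _ _ _
  show 2 * C.pairing x (s.sec X x) (C.bracket (s.sec Y) (s.sec Z) x) =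
    - (2 * C.pairing x (s.sec X x) (C.bracket (s.sec Z) (s.sec Y) x))
  linarith

theorem triple_swap_outer (X Y Z : VecField n M) : s.triple X Y Z = - s.triple Z Y X := by
  ext x
  have h := C.anchor_pairing' (s.sec Y) (s.sec X) (s.sec Z) x
  rw [mvfderiv_zero_pairing, C.pairing_symm x _ (s.sec Z x)] at h
  show 2 * C.pairing x (s.sec X x) (C.bracket (s.sec Y) (s.sec Z) x) =
    - (2 * C.pairing x (s.sec Z x) (C.bracket (s.sec Y) (s.sec X) x))
  linarith

theorem triple_cycle (X Y Z : VecField n M) : s.triple X Y Z = s.triple Y Z X := by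
  rw [triple_swap_outer, triple_swap_right, triple_swap_outer, triple_swap_right, neg_neg,
    triple_swap_outer, triple_swap_right, neg_neg]

theorem eq_zero_of_eq_neg {f : SmoothFn n M} (h : f = -f) : f = 0 := by
  ext x
  have : f x = - f x := congrArg (fun g : SmoothFn n M => g x) h
  show f x = 0
  linarith

theorem triple_add (X X' Y Z : VecField n M) :
    s.triple (X + X') Y Z = s.triple X Y Z + s.triple X' Y Z := by
  simp only [triple, map_add, LinearMap.add_apply, smul_add]

theorem triple_smul (f : SmoothFn n M) (X Y Z : VecField n M) :
    s.triple (f • X) Y Z = f • s.triple X Y Z := by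
  simp only [triple, map_smul, LinearMap.smul_apply]
  exact smul_comm _ _ _

/-- The twisting form `H(X, Y, Z) = 2⟨s(X), s(Y) * s(Z)⟩` of a splitting. -/
noncomputable def twist : AltForm (SmoothFn n M) (VecField n M) 3 where
  toFun v := s.triple (v 0) (v 1) (v 2)
  map_update_add' := by
    intro inst v i x y
    obtain rfl : inst = instDecidableEqFin 3 := Subsingleton.elim _ _
    fin_cases i
    · exact s.triple_add x y (v 1) (v 2)
    · show s.triple (v 0) (x + y) (v 2) = s.triple (v 0) x (v 2) + s.triple (v 0) y (v 2)
      rw [triple_cycle, triple_add, s.triple_cycle (v 0) x, s.triple_cycle (v 0) y]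
    · show s.triple (v 0) (v 1) (x + y) = s.triple (v 0) (v 1) x + s.triple (v 0) (v 1) y
      rw [← triple_cycle, triple_add, s.triple_cycle x, s.triple_cycle y]
  map_update_smul' := by
    intro inst v i c x
    obtain rfl : inst = instDecidableEqFin 3 := Subsingleton.elim _ _
    fin_cases i
    · exact s.triple_smul c x (v 1) (v 2)
    · show s.triple (v 0) (c • x) (v 2) = c • s.triple (v 0) x (v 2)
      rw [triple_cycle, triple_smul, ← triple_cycle]
    · show s.triple (v 0) (v 1) (c • x) = c • s.triple (v 0) (v 1) x
      rw [← triple_cycle, triple_smul, triple_cycle]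
  map_eq_zero_of_eq' := by
    have h1 : ∀ X Y, s.triple X Y Y = 0 := fun X Y =>
      eq_zero_of_eq_neg (s.triple_swap_right X Y Y)
    intro v i j hv hij
    show s.triple (v 0) (v 1) (v 2) = 0
    fin_cases i <;> fin_cases j
    · exact absurd rfl hij
    · rw [show v 1 = v 0 from hv.symm, ← triple_cycle, h1]
    · rw [show v 2 = v 0 from hv.symm, triple_cycle, h1]
    · rw [show v 1 = v 0 from hv, ← triple_cycle, h1]
    · exact absurd rfl hij
    · rw [show v 1 = v 2 from hv, h1]
    · rw [show v 2 = v 0 from hv, triple_cycle, h1]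
    · rw [show v 2 = v 1 from hv, h1]
    · exact absurd rfl hij

theorem twist_apply (v : Fin 3 → VecField n M) :
    s.twist v = (2 : ℝ) • C.pair (s.sec (v 0)) (C.bracket (s.sec (v 1)) (s.sec (v 2))) := rfl

/-- The `1`-form `ξ = 𝔛 - s(a(𝔛))`, an element of `T^*M ⊆ E`: `ξ(Y) = 2⟨𝔛, s(Y)⟩`. -/
noncomputable def oneForm (𝔛 : SmoothSec n F E) : AltForm (SmoothFn n M) (VecField n M) 1 :=
  AlternatingMap.ofSubsingleton (SmoothFn n M) (VecField n M) (SmoothFn n M) (0 : Fin 1)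
    ((2 : ℝ) • C.pair 𝔛 ∘ₗ s.sec)

theorem oneForm_apply (𝔛 : SmoothSec n F E) (v : Fin 1 → VecField n M) :
    s.oneForm 𝔛 v = (2 : ℝ) • C.pair 𝔛 (s.sec (v 0)) := rfl

theorem pair_sec_self (X : VecField n M) : C.pair (s'.sec X) (s.sec X) = 0 := by
  ext x
  have h0 : C.anchor x (s'.toFun x (X x) - s.toFun x (X x)) = 0 := by
    rw [map_sub, s.anchor_toFun, s'.anchor_toFun, sub_self]
  obtain ⟨ξ, hξ⟩ := (C.anchor_ker x _).1 h0
  have h1 := hξ (s'.toFun x (X x) - s.toFun x (X x))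
  simp only [h0, map_zero, map_sub, LinearMap.sub_apply, s.isotropic, s'.isotropic,
    C.pairing_symm x (s.toFun x (X x)) (s'.toFun x (X x))] at h1
  show C.pairing x (s'.toFun x (X x)) (s.toFun x (X x)) = 0
  linarith

/-- The difference `B` of two splittings, `s'(X) = s(X) + ι_X B`, where `ι_X B` is regarded as an
element of `T^*M ⊆ E`: `B(X, Y) = 2⟨s'(X) - s(X), s(Y)⟩ = 2⟨s'(X), s(Y)⟩`. -/
noncomputable def diff : AltForm (SmoothFn n M) (VecField n M) 2 where
  toFun v := (2 : ℝ) • C.pair (s'.sec (v 0)) (s.sec (v 1))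
  map_update_add' := by
    intro inst v i x y
    obtain rfl : inst = instDecidableEqFin 2 := Subsingleton.elim _ _
    fin_cases i
    · show (2 : ℝ) • C.pair (s'.sec (x + y)) (s.sec (v 1)) = (2 : ℝ) • C.pair (s'.sec x)
        (s.sec (v 1)) + (2 : ℝ) • C.pair (s'.sec y) (s.sec (v 1))
      rw [map_add, map_add, LinearMap.add_apply, smul_add]
    · show (2 : ℝ) • C.pair (s'.sec (v 0)) (s.sec (x + y)) = (2 : ℝ) • C.pair (s'.sec (v 0))
        (s.sec x) + (2 : ℝ) • C.pair (s'.sec (v 0)) (s.sec y)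
      rw [map_add, map_add, smul_add]
  map_update_smul' := by
    intro inst v i c x
    obtain rfl : inst = instDecidableEqFin 2 := Subsingleton.elim _ _
    fin_cases i
    · show (2 : ℝ) • C.pair (s'.sec (c • x)) (s.sec (v 1)) =
        c • (2 : ℝ) • C.pair (s'.sec x) (s.sec (v 1))
      rw [map_smul, map_smul, LinearMap.smul_apply, smul_comm]
    · show (2 : ℝ) • C.pair (s'.sec (v 0)) (s.sec (c • x)) =
        c • (2 : ℝ) • C.pair (s'.sec (v 0)) (s.sec x)
      rw [map_smul, map_smul, smul_comm]
  map_eq_zero_of_eq' := by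
    intro v i j hv hij
    have h : v 0 = v 1 := by
      fin_cases i <;> fin_cases j
      · exact absurd rfl hij
      · exact hv
      · exact hv.symm
      · exact absurd rfl hij
    rw [h, pair_sec_self, smul_zero]

theorem diff_apply (v : Fin 2 → VecField n M) :
    s.diff s' v = (2 : ℝ) • C.pair (s'.sec (v 0)) (s.sec (v 1)) := rfl

/-- The `2`-form `dξ - ι_X H`, for a section `𝔛 = s(X) + ξ`. -/
noncomputable def kappaForm (𝔛 : SmoothSec n F E) : AltForm (SmoothFn n M) (VecField n M) 2 :=
  AltForm.extDer (s.oneForm 𝔛) - s.twist.curryLeft (C.anchorField 𝔛)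

/-- The infinitesimal symmetry `κ(𝔛) = (X, dξ - ι_X H)` generated by a section `𝔛 = s(X) + ξ`, in
the splitting `s`. -/
noncomputable def kappa (𝔛 : SmoothSec n F E) :
    VecField n M × AltForm (SmoothFn n M) (VecField n M) 2 :=
  (C.anchorField 𝔛, s.kappaForm 𝔛)

end IsotropicSplitting

/-- The Lie bracket `[(X, A), (Y, B)] = ([X, Y], L_X B - L_Y A)` of infinitesimal symmetries. -/
noncomputable def symmetryBracket (p q : VecField n M × AltForm (SmoothFn n M) (VecField n M) 2) :
    VecField n M × AltForm (SmoothFn n M) (VecField n M) 2 :=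
  (⁅p.1, q.1⁆, AltForm.lieDeriv p.1 q.2 - AltForm.lieDeriv q.1 p.2)

section Spinors

/-- Families of forms, indexed by the isotropic splittings. -/
abbrev FormFamily : Type _ := C.IsotropicSplitting → Forms (SmoothFn n M) (VecField n M)

/-- The abstract spinors. A spinor has a representative `ρ s ∈ Ω(M)` in each splitting `s`, and
`ρ s' = e^B ∧ ρ s` if `s' = s + ι_• B`; that is, `(s', ρ)` and `(s, e^{-B} ∧ ρ)` represent the same
spinor. -/
noncomputable def spinors : Submodule ℝ C.FormFamily where
  carrier := {ρ | ∀ s s', ρ s' = Forms.wedge (Forms.exp2 (s.diff s')) (ρ s)}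
  add_mem' {ρ σ} hρ hσ s s' := by rw [Pi.add_apply, hρ s s', hσ s s', Pi.add_apply, map_add]
  zero_mem' s s' := by simp
  smul_mem' c ρ hρ s s' := by rw [Pi.smul_apply, hρ s s', Pi.smul_apply, map_smul]

/-- An operator on forms for each splitting, as an operator on families. -/
noncomputable def familyMap (f : C.IsotropicSplitting → Forms (SmoothFn n M) (VecField n M) →ₗ[ℝ]
    Forms (SmoothFn n M) (VecField n M)) : C.FormFamily →ₗ[ℝ] C.FormFamily :=
  LinearMap.pi fun s => f s ∘ₗ LinearMap.proj s

/-- The differential of spinors, `d ρ - H ∧ ρ` in a splitting. -/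
noncomputable def spinorD : C.FormFamily →ₗ[ℝ] C.FormFamily :=
  C.familyMap fun s => Forms.d - Forms.wedge (Forms.of s.twist)

/-- The Clifford action of `𝔛 = s(X) + ξ` on spinors, `ι_X ρ + ξ ∧ ρ` in the splitting `s`. -/
noncomputable def spinorInterior (𝔛 : SmoothSec n F E) : C.FormFamily →ₗ[ℝ] C.FormFamily :=
  C.familyMap fun s =>
    Forms.interior (C.anchorField 𝔛) + Forms.wedge (Forms.of (s.oneForm 𝔛))

/-- The Lie derivative of spinors along `𝔛 = s(X) + ξ`, `L_X ρ + (dξ - ι_X H) ∧ ρ` in the splitting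
`s`. -/
noncomputable def spinorLie (𝔛 : SmoothSec n F E) : C.FormFamily →ₗ[ℝ] C.FormFamily :=
  C.familyMap fun s => Forms.lie (C.anchorField 𝔛) + Forms.wedge (Forms.of (s.kappaForm 𝔛))

/-- The families of even (`i = 0`) or odd (`i = 1`) forms. -/
noncomputable def familyParity (i : ZMod 2) : Submodule ℝ C.FormFamily :=
  Submodule.pi Set.univ fun _ => Forms.parity i

end Spinors

section Action

variable {r : ℕ} {𝔤 : Type*} [LieRing 𝔤] [LieAlgebra ℝ 𝔤]
  (δ : 𝔤 →ₗ[ℝ] SmoothSec n F E) (b : Module.Basis (Fin r) ℝ 𝔤) (s : C.IsotropicSplitting)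

/-- The map `δ` defines an action of `𝔤` by extended symmetries: `κ ∘ δ` is a homomorphism of Lie
algebras. -/
def IsExtendedAction : Prop :=
  ∀ (s : C.IsotropicSplitting) (τ σ : 𝔤),
    s.kappa (δ ⁅τ, σ⁆) = symmetryBracket (s.kappa (δ τ)) (s.kappa (δ σ))

/-- The image of `δ` is isotropic. -/
def IsIsotropicAction : Prop := ∀ τ σ : 𝔤, C.pair (δ τ) (δ σ) = 0

/-- The action preserves the splitting `s`: `dξ_τ - ι_{X_τ} H = 0`, where
`δ(τ) = s(X_τ) + ξ_τ`. -/
def PreservesSplitting : Prop := ∀ τ : 𝔤, s.kappaForm (δ τ) = 0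

/-- The differential `d - ∑ j, u_j ι_{δ(b_j)}` on formal series with values in spinors. -/
noncomputable def extD : Series r C.FormFamily →ₗ[ℝ] Series r C.FormFamily :=
  Series.map C.spinorD - ∑ j, Series.mulVar j ∘ₗ Series.map (C.spinorInterior (δ (b j)))

/-- The extended Cartan complex: the formal series `ρ` on `𝔤` with values in spinors such that
`L_{δ(τ)} (ρ(τ)) = 0` for all `τ ∈ 𝔤`. -/
noncomputable def extCartan : Submodule ℝ (Series r C.FormFamily) :=
  Series.coeffsIn C.spinors ⊓ Series.annihilated b fun τ => C.spinorLie (δ τ)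

/-- The variant of the extended Cartan complex consisting of the formal series that are invariant
under the diagonal action of `𝔤`. -/
noncomputable def extCartanInv : Submodule ℝ (Series r C.FormFamily) :=
  Series.coeffsIn C.spinors ⊓ Series.invariants b fun τ => C.spinorLie (δ τ)

/-- The Cartan complex of `M`: the formal series `ρ` on `𝔤` with values in forms such that
`L_{X_τ} (ρ(τ)) = 0` for all `τ ∈ 𝔤`. -/
noncomputable def cartan : Submodule ℝ (Series r (Forms (SmoothFn n M) (VecField n M))) :=
  Series.annihilated b fun τ => Forms.lie (C.anchorField (δ τ))

/-- The variant of the Cartan complex of `M` consisting of the formal series that are invariant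
under the diagonal action of `𝔤`. -/
noncomputable def cartanInv : Submodule ℝ (Series r (Forms (SmoothFn n M) (VecField n M))) :=
  Series.invariants b fun τ => Forms.lie (C.anchorField (δ τ))

/-- The equivariant differential `d_G = d - ∑ j, u_j ι_{X_j}`, where `X_j = a(δ(b_j))`. -/
noncomputable def equivD : Series r (Forms (SmoothFn n M) (VecField n M)) →ₗ[ℝ]
    Series r (Forms (SmoothFn n M) (VecField n M)) :=
  Series.cartanD fun j => C.anchorField (δ (b j))

/-- The form `H_G = H + ∑ j, u_j ξ_j`, where `δ(b_j) = s(X_j) + ξ_j`. -/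
noncomputable def equivH : Series r (Forms (SmoothFn n M) (VecField n M)) :=
  Series.single 0 (Forms.of s.twist) +
    ∑ j, Series.single (Finsupp.single j 1) (Forms.of (s.oneForm (δ (b j))))

/-- The twisted equivariant differential `d_G - H_G ∧`. -/
noncomputable def twistedD : Series r (Forms (SmoothFn n M) (VecField n M)) →ₗ[ℝ]
    Series r (Forms (SmoothFn n M) (VecField n M)) :=
  C.equivD δ b - Series.wedge (C.equivH δ b s)

/-- The formal series with values in spinors of parity `i`. -/
noncomputable def extParity (r : ℕ) (i : ZMod 2) : Submodule ℝ (Series r C.FormFamily) :=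
  Series.coeffsIn (C.familyParity i)

/-- The formal series with values in forms of parity `i`. -/
noncomputable def formParity (n : ℕ) (M : Type*) [TopologicalSpace M]
    [ChartedSpace (EuclideanSpace ℝ (Fin n)) M] [IsManifold (𝓡 n) ∞ M] (r : ℕ) (i : ZMod 2) :
    Submodule ℝ (Series r (Forms (SmoothFn n M) (VecField n M))) :=
  Series.coeffsIn (Forms.parity i)

/-- The representative in the splitting `s` of a formal series with values in spinors. -/
noncomputable def inSplitting (r : ℕ) : Series r C.FormFamily →ₗ[ℝ]
    Series r (Forms (SmoothFn n M) (VecField n M)) :=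
  Series.map (LinearMap.proj s)

end Action

end ExactCourantAlgebroid

end Courant

/-! A spinor is determined by its representative in `s`, and the rule `ρ_{s'} = e^B ∧ ρ_s` produces
the other representatives from it. Three transformation laws govern a change of splitting: `H' = H +
dB` (`twist_eq_add`), `ξ' = ξ - ι_X B` (`oneForm_eq_sub`) and `κ' = κ - L_X B` (`kappaForm_eq_sub`,
for the 2-form parts). They cancel exactly the terms that arise when `d`, `ι_X` and `L_X` are moved
past `e^B`, so `d_T`, `ι_𝔛` and `L_𝔛` map spinors to spinors. In the splitting `s` they become `D =
d - H ∧`, `K_τ = ι_{X_τ} + ξ_τ ∧` and, as the action preserves `s`, the plain `L_{X_τ}`. Moreover `D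
- ∑ u_j K_j` is `d_G - H_G ∧` (`twistedD_eq`). This gives the isomorphism of complexes.

That these are complexes rests on three relations: `D² = 0`, because `H` is closed (`extDer_twist`);
`D K_τ + K_τ D = L_{X_τ}`, because `dξ_τ = ι_{X_τ} H`; and the `K_τ` anticommute, because the action
is isotropic. Hence `(D - ∑ u_j K_j)² = - ∑ u_j L_{X_j}` (`cartanOp_cartanOp`), and the defining
condition of the Cartan complex says that the square of the differential kills `ρ`; this passes from
`ρ` to its differential. Similarly `d_G² = - ∑ u_j L_{X_j}`, so `H_G` lies in the Cartan complex
once `d_G H_G = 0`. The coefficients of `d_G H_G` are `dH`, `dξ_j - ι_{X_j} H` and the symmetric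
part of `- ι_{X_j} ξ_k`, all zero.

If `δ` respects brackets, the formula for the 1-form part of a bracket (`oneForm_bracket`) gives
`L_{X_τ} ξ_σ = ξ_{[τ,σ]}`, hence the invariance of `H_G` and of the differential. Invariant series
satisfy the Cartan condition because `∑ u_j u_k [b_j, b_k] = 0`.

The calculus of forms is obtained by induction on the degree: a form of positive degree is
determined by its interior products. In the same spirit `e^B` is characterised by `ι_X φ = ι_X B ∧
φ` and its value `1` in degree `0`. -/

namespace AltForm

/-! ### Reduction of forms to their interior products -/

variable {A L : Type*} [CommRing A] [LieRing L] [Module A L]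

theorem ext_zero {α β : AltForm A L 0} (h : α ![] = β ![]) : α = β := by
  ext v
  rwa [Subsingleton.elim v ![]]

/-- Inserting one vector lowers the degree by one, so identities between forms can be proved by
induction on the degree, starting from functions. Most of the calculus below is obtained in this
way. -/
theorem ext_curryLeft {k : ℕ} {α β : AltForm A L (k + 1)}
    (h : ∀ X, α.curryLeft X = β.curryLeft X) : α = β := by
  ext v
  rw [← Fin.cons_self_tail v]
  exact congrArg (fun γ : AltForm A L k => γ (Fin.tail v)) (h (v 0))

section Calculus

set_option linter.unusedSectionVars false

variable [Algebra ℝ A] [LieAlgebra ℝ L]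
  [LieRingModule L A] [LieRinehartRing A L] [LieRinehartAlgebra ℝ A L]

theorem lieDeriv_zero_apply (X : L) (α : AltForm A L 0) (v : Fin 0 → L) :
    lieDeriv X α v = ⁅X, α v⁆ := by
  simp [lieDeriv_apply]

theorem curryLeft_lieDeriv {k : ℕ} (X Y : L) (α : AltForm A L (k + 1)) :
    (lieDeriv X α).curryLeft Y = lieDeriv X (α.curryLeft Y) - α.curryLeft ⁅X, Y⁆ := by
  ext v
  show lieDeriv X α (Fin.cons Y v : Fin (k + 1) → L) =
    lieDeriv X (α.curryLeft Y) v - α (Fin.cons ⁅X, Y⁆ v : Fin (k + 1) → L)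
  have hc : ∀ w : Fin k → L, α.curryLeft Y w = α (Fin.cons Y w : Fin (k + 1) → L) :=
    fun w => rfl
  simp only [lieDeriv_apply, Fin.sum_univ_succ, Fin.cons_zero, Fin.cons_succ, hc,
    Fin.update_cons_zero, ← Fin.cons_update]
  abel

end Calculus

end AltForm

/-! ### Cartan calculus of `d`, `ι_X` and `L_X` -/

namespace Forms

section Calculus

set_option linter.unusedSectionVars false

variable {A L : Type*} [CommRing A] [Algebra ℝ A] [LieRing L] [LieAlgebra ℝ L] [Module A L]
  [LieRingModule L A] [LieRinehartRing A L] [LieRinehartAlgebra ℝ A L]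

theorem interior_apply (X : L) (φ : Forms A L) (k : ℕ) :
    interior X φ k = (φ (k + 1)).curryLeft X := rfl

theorem d_zero (φ : Forms A L) : d φ 0 = 0 := rfl

theorem d_succ (φ : Forms A L) (k : ℕ) : d φ (k + 1) = AltForm.extDer (φ k) := rfl

theorem lie_apply (X : L) (φ : Forms A L) (k : ℕ) : lie X φ k = AltForm.lieDeriv X (φ k) := rfl

theorem apply_succ_eq_zero {φ : Forms A L} {n : ℕ} (h : ∀ X, interior X φ n = 0) :
    φ (n + 1) = 0 :=
  AltForm.ext_curryLeft fun X => by
    rw [← interior_apply, h, AlternatingMap.curryLeft_zero, LinearMap.zero_apply]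

theorem apply_succ_eq {φ η : Forms A L} {n : ℕ} (h : ∀ X, interior X φ n = interior X η n) :
    φ (n + 1) = η (n + 1) :=
  AltForm.ext_curryLeft h

/-- Cartan's formula. -/
theorem interior_d (X : L) (φ : Forms A L) :
    interior X (d φ) = lie X φ - d (interior X φ) := by
  funext k
  ext v
  cases k with
  | zero =>
    -- In degree `0` every `d η` vanishes by definition, so `d ι_X φ` contributes nothing.
    show AltForm.koszul (φ 0) (Fin.cons X v : Fin 1 → L) = AltForm.lieDeriv X (φ 0) v - 0
    rw [AltForm.koszul_zero, AltForm.lieDeriv_zero_apply, Subsingleton.elim v ![], sub_zero,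
      Fin.cons_zero]
  | succ k => exact AltForm.koszul_cons (φ (k + 1)) X v

/-- Polarization of `ι_Z² = 0` at `Z = X + Y`. -/
theorem interior_interior (X Y : L) (φ : Forms A L) :
    interior X (interior Y φ) = - interior Y (interior X φ) := by
  have h : ∀ Z : L, interior Z (interior Z φ) = 0 := fun Z => by
    funext k
    exact AlternatingMap.curryLeft_same _ _
  have hadd : ∀ (Z W : L) (η : Forms A L), interior (Z + W) η = interior Z η + interior W η :=
    fun Z W η => by
      funext k
      exact map_add (η (k + 1)).curryLeft Z W
  have := h (X + Y)
  simp only [hadd, map_add, h, zero_add, add_zero] at this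
  exact eq_neg_of_add_eq_zero_left this

theorem interior_lie (X Y : L) (φ : Forms A L) :
    interior Y (lie X φ) = lie X (interior Y φ) - interior ⁅X, Y⁆ φ := by
  funext k
  exact AltForm.curryLeft_lieDeriv X Y (φ (k + 1))

theorem interior_add (X Y : L) (φ : Forms A L) :
    interior (X + Y) φ = interior X φ + interior Y φ := by
  funext k
  exact map_add (φ (k + 1)).curryLeft X Y

theorem interior_smul (c : ℝ) (X : L) (φ : Forms A L) :
    interior (c • X) φ = c • interior X φ := by
  funext k
  rw [← algebraMap_smul A c X]
  exact (map_smul (φ (k + 1)).curryLeft (algebraMap ℝ A c) X).trans (AltForm.real_smul c _).symm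

/-- On functions this is the Lie module axiom. By the Jacobi identity the defect `[L_X, L_Y] -
L_{[X,Y]}` commutes with every `ι_Z`, so induction on the degree applies. -/
theorem lie_lie (X Y : L) (φ : Forms A L) :
    lie X (lie Y φ) - lie Y (lie X φ) = lie ⁅X, Y⁆ φ := by
  rw [← sub_eq_zero]
  funext n
  induction n generalizing φ with
  | zero =>
    refine AltForm.ext_zero ?_
    show AltForm.lieDeriv X (AltForm.lieDeriv Y (φ 0)) ![] -
      AltForm.lieDeriv Y (AltForm.lieDeriv X (φ 0)) ![] - AltForm.lieDeriv ⁅X, Y⁆ (φ 0) ![] = 0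
    simp only [AltForm.lieDeriv_zero_apply, leibniz_lie X Y]
    abel
  | succ n ih =>
    refine apply_succ_eq_zero fun Z => ?_
    refine Eq.trans (congrFun ?_ n) (ih (interior Z φ))
    have h : interior ⁅X, ⁅Y, Z⁆⁆ φ = interior ⁅⁅X, Y⁆, Z⁆ φ + interior ⁅Y, ⁅X, Z⁆⁆ φ := by
      rw [leibniz_lie, interior_add]
    simp only [map_sub, interior_lie, h]
    abel

/-- By Cartan's formula and `lie_lie`, the defect `L_X d - d L_X` anticommutes with every `ι_Y`. -/
theorem lie_d (X : L) (φ : Forms A L) : lie X (d φ) = d (lie X φ) := by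
  rw [← sub_eq_zero]
  funext n
  induction n generalizing φ with
  | zero =>
    show AltForm.lieDeriv X (0 : AltForm A L 0) - 0 = 0
    rw [map_zero, sub_zero]
  | succ n ih =>
    refine apply_succ_eq_zero fun Y => ?_
    -- The sign comes from the anticommutation: `ι_Y` of the defect at `φ` is minus the defect at
    -- `ι_Y φ`.
    rw [← neg_eq_zero, ← Pi.neg_apply]
    refine Eq.trans (congrFun ?_ n) (ih (interior Y φ))
    simp only [map_sub, interior_lie, interior_d, ← lie_lie X Y]
    abel

/-- Cartan's formula, used twice, gives `ι_X d d φ = d d ι_X φ`, because `L_X` commutes with `d`. -/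
theorem d_d (φ : Forms A L) : d (d φ) = 0 := by
  funext n
  induction n generalizing φ with
  | zero => rfl
  | succ n ih =>
    refine apply_succ_eq_zero fun X => ?_
    rw [interior_d, interior_d, map_sub, lie_d, sub_sub_cancel]
    exact ih _

end Calculus

end Forms

/-! ### The wedge product as a sum over permutations -/

open Equiv in
/-- Expansion of a signed sum over all permutations along the position of the first vector. -/
theorem sum_perm_sign_cons {A L : Type*} [AddCommGroup A] {n : ℕ} (f : (Fin (n + 1) → L) → A)
    (X : L) (v : Fin n → L) :
    ∑ σ : Perm (Fin (n + 1)), Perm.sign σ • f ((Fin.cons X v : Fin (n + 1) → L) ∘ σ) =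
      ∑ i : Fin (n + 1), (-1 : ℤˣ) ^ (i : ℕ) •
        ∑ τ : Perm (Fin n), Perm.sign τ • f (i.insertNth X (v ∘ τ)) := by
  -- A permutation is coded by the place `i` that it sends to `0` and a permutation `τ` of the
  -- remaining indices; the factor `cycleRange` has sign `(-1)^i`.
  let g : Fin (n + 1) × Perm (Fin n) → Perm (Fin (n + 1)) := fun x =>
    Perm.decomposeFin.symm (0, x.2) * x.1.cycleRange
  have hg0 : ∀ x, g x x.1 = 0 := fun x => by simp [g]
  have hg : Bijective g := by
    rw [Fintype.bijective_iff_injective_and_card]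
    refine ⟨fun x y hxy => ?_, by simp [Fintype.card_perm, Nat.factorial_succ]⟩
    have h1 : x.1 = y.1 := (g y).injective (by rw [← hxy, hg0, hxy, hg0])
    obtain ⟨i, τ⟩ := x
    obtain ⟨j, τ'⟩ := y
    obtain rfl : i = j := h1
    have h2 := Perm.decomposeFin.symm.injective (mul_right_cancel hxy)
    simpa using h2
  rw [← hg.sum_comp, Fintype.sum_prod_type]
  refine Finset.sum_congr rfl fun i _ => ?_
  rw [Finset.smul_sum]
  refine Finset.sum_congr rfl fun τ _ => ?_
  have hs : Perm.sign (g (i, τ)) = (-1) ^ (i : ℕ) * Perm.sign τ := by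
    simp [g, Fin.sign_cycleRange, mul_comm]
  have hc : (Fin.cons X v : Fin (n + 1) → L) ∘ g (i, τ) = i.insertNth X (v ∘ τ) := by
    rw [← Fin.cons_comp_cycleRange]
    funext k
    show (Fin.cons X v : Fin (n + 1) → L) (Perm.decomposeFin.symm (0, τ) (i.cycleRange k)) =
      (Fin.cons X (v ∘ τ) : Fin (n + 1) → L) (i.cycleRange k)
    refine Fin.cases ?_ (fun l => ?_) (i.cycleRange k) <;> simp
  rw [hs, hc, mul_smul]

namespace AltForm

section Calculus

set_option linter.unusedSectionVars false

variable {A L : Type*} [CommRing A] [Algebra ℝ A] [LieRing L] [LieAlgebra ℝ L] [Module A L]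
  [LieRingModule L A] [LieRinehartRing A L] [LieRinehartAlgebra ℝ A L]

/-- The first `p` of `n = p + q` indices. -/
def idxL {p q n : ℕ} (h : p + q = n) (i : Fin p) : Fin n := Fin.cast h (Fin.castAdd q i)

/-- The last `q` of `n = p + q` indices. -/
def idxR {p q n : ℕ} (h : p + q = n) (j : Fin q) : Fin n := Fin.cast h (Fin.natAdd p j)

/-- The wedge product as a sum over all permutations. -/
theorem factorial_smul_wedge {p q n : ℕ} (h : p + q = n) (α : AltForm A L p) (β : AltForm A L q)
    (v : Fin n → L) :
    (p.factorial * q.factorial) • wedge h α β v = ∑ σ : Equiv.Perm (Fin n),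
      Equiv.Perm.sign σ • (α ((v ∘ σ) ∘ idxL h) * β ((v ∘ σ) ∘ idxR h)) := by
  subst h
  -- Alternating over all permutations counts every shuffle `p! q!` times.
  have h1 := MultilinearMap.domCoprod_alternization_eq α β
  simp only [Fintype.card_fin] at h1
  have h2 : (p.factorial * q.factorial) • wedge rfl α β v = LinearMap.mul' A A
      (((p.factorial * q.factorial) • α.domCoprod β) (v ∘ finSumFinEquiv)) := by
    rw [wedge_eq, AlternatingMap.smul_apply, map_nsmul]
    rfl
  rw [h2, ← h1, MultilinearMap.alternatization_apply, map_sum,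
    ← (Equiv.permCongr (finSumFinEquiv (m := p) (n := q))).sum_comp]
  refine Finset.sum_congr rfl fun σ _ => ?_
  rw [Equiv.Perm.sign_permCongr]
  rw [Units.smul_def, Units.smul_def, map_zsmul]
  congr 1
  simp only [MultilinearMap.domDomCongr_apply, MultilinearMap.domCoprod_apply,
    LinearMap.mul'_apply, AlternatingMap.coe_multilinearMap]
  congr 2
  · funext i
    simp [idxL]
  · funext i
    simp [idxR]

/-- A vector inserted within the first block lengthens this block and only shifts the second one by
a place, so the second factor still sees the old vectors. -/
theorem insertNth_idxL_comp {L : Type*} {p q n : ℕ} (h : p + 1 + q = n + 1) (h' : p + q = n)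
    (i : Fin (p + 1)) (X : L) (w : Fin n → L) :
    ((idxL h i).insertNth X w : Fin (n + 1) → L) ∘ idxL h = i.insertNth X (w ∘ idxL h') ∧
      ((idxL h i).insertNth X w : Fin (n + 1) → L) ∘ idxR h = w ∘ idxR h' := by
  constructor
  · funext j
    refine i.succAboveCases ?_ (fun j => ?_) j
    · simp
    · have : idxL h (i.succAbove j) = (idxL h i).succAbove (idxL h' j) := by
        ext
        simp only [idxL, Fin.succAbove, Fin.lt_def]
        split_ifs <;> simp_all
        omega
      simp [this]
  · funext j
    have : idxR h j = (idxL h i).succAbove (idxR h' j) := by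
      ext
      have := i.2
      simp only [idxL, idxR, Fin.succAbove, Fin.lt_def]
      split_ifs <;> simp_all <;> omega
    simp [this]

theorem insertNth_idxR_comp {L : Type*} {p q n : ℕ} (h : p + (q + 1) = n + 1) (h' : p + q = n)
    (i : Fin (q + 1)) (X : L) (w : Fin n → L) :
    ((idxR h i).insertNth X w : Fin (n + 1) → L) ∘ idxR h = i.insertNth X (w ∘ idxR h') ∧
      ((idxR h i).insertNth X w : Fin (n + 1) → L) ∘ idxL h = w ∘ idxL h' := by
  constructor
  · funext j
    refine i.succAboveCases ?_ (fun j => ?_) j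
    · simp
    · have : idxR h (i.succAbove j) = (idxR h i).succAbove (idxR h' j) := by
        ext
        simp only [idxR, Fin.succAbove, Fin.lt_def]
        split_ifs <;> simp_all <;> omega
      simp [this]
  · funext j
    have : idxL h j = (idxR h i).succAbove (idxL h' j) := by
      ext
      have := j.2
      simp only [idxL, idxR, Fin.succAbove, Fin.lt_def]
      split_ifs <;> simp_all <;> omega
    simp [this]

theorem sum_idx {B : Type*} [AddCommMonoid B] {p q n : ℕ} (h : p + q = n) (f : Fin n → B) :
    ∑ i, f i = ∑ i, f (idxL h i) + ∑ j, f (idxR h j) := by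
  subst h
  exact Fin.sum_univ_add f

theorem smul_apply_insertNth {p : ℕ} (α : AltForm A L (p + 1)) (i : Fin (p + 1)) (X : L)
    (u : Fin p → L) : α (i.insertNth X u) = (-1) ^ (i : ℕ) * α.curryLeft X u := by
  rw [AlternatingMap.map_insertNth, zsmul_eq_mul]
  push_cast
  rfl

/-- The terms of the expansion of `α ∧ β` in which the first vector is put into `α`. -/
theorem sum_idxL {p q n : ℕ} (h : p + 1 + q = n + 1) (h' : p + q = n) (α : AltForm A L (p + 1))
    (β : AltForm A L q) (X : L) (v : Fin n → L) :
    ∑ i : Fin (p + 1), (-1 : ℤˣ) ^ ((idxL h i : Fin (n + 1)) : ℕ) •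
        ∑ τ : Equiv.Perm (Fin n), Equiv.Perm.sign τ •
          (α (((idxL h i).insertNth X (v ∘ τ) : Fin (n + 1) → L) ∘ idxL h) *
            β (((idxL h i).insertNth X (v ∘ τ) : Fin (n + 1) → L) ∘ idxR h)) =
      ((p + 1).factorial * q.factorial) • wedge h' (α.curryLeft X) β v := by
  have key : ∀ i : Fin (p + 1), (-1 : ℤˣ) ^ ((idxL h i : Fin (n + 1)) : ℕ) •
        ∑ τ : Equiv.Perm (Fin n), Equiv.Perm.sign τ •
          (α (((idxL h i).insertNth X (v ∘ τ) : Fin (n + 1) → L) ∘ idxL h) *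
            β (((idxL h i).insertNth X (v ∘ τ) : Fin (n + 1) → L) ∘ idxR h)) =
      (p.factorial * q.factorial) • wedge h' (α.curryLeft X) β v := by
    intro i
    rw [factorial_smul_wedge, Finset.smul_sum]
    refine Finset.sum_congr rfl fun τ _ => ?_
    rw [(insertNth_idxL_comp h h' i X _).1, (insertNth_idxL_comp h h' i X _).2,
      smul_apply_insertNth, smul_comm]
    congr 1
    rcases Nat.even_or_odd (i : ℕ) with h' | h' <;> simp [idxL, h'.neg_one_pow, Units.smul_def]
  -- The `p + 1` places of insertion contribute equally, which turns `p!` into `(p + 1)!`.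
  rw [Finset.sum_congr rfl fun i _ => key i, Finset.sum_const, Finset.card_univ, Fintype.card_fin,
    smul_smul, Nat.factorial_succ, mul_assoc]

/-- The terms of the expansion of `α ∧ β` in which the first vector is put into `β`. -/
theorem sum_idxR {p q n : ℕ} (h : p + (q + 1) = n + 1) (h' : p + q = n) (α : AltForm A L p)
    (β : AltForm A L (q + 1)) (X : L) (v : Fin n → L) :
    ∑ i : Fin (q + 1), (-1 : ℤˣ) ^ ((idxR h i : Fin (n + 1)) : ℕ) •
        ∑ τ : Equiv.Perm (Fin n), Equiv.Perm.sign τ •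
          (α (((idxR h i).insertNth X (v ∘ τ) : Fin (n + 1) → L) ∘ idxL h) *
            β (((idxR h i).insertNth X (v ∘ τ) : Fin (n + 1) → L) ∘ idxR h)) =
      (p.factorial * (q + 1).factorial) • ((-1) ^ p * wedge h' α (β.curryLeft X) v) := by
  have key : ∀ i : Fin (q + 1), (-1 : ℤˣ) ^ ((idxR h i : Fin (n + 1)) : ℕ) •
        ∑ τ : Equiv.Perm (Fin n), Equiv.Perm.sign τ •
          (α (((idxR h i).insertNth X (v ∘ τ) : Fin (n + 1) → L) ∘ idxL h) *
            β (((idxR h i).insertNth X (v ∘ τ) : Fin (n + 1) → L) ∘ idxR h)) =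
      (p.factorial * q.factorial) • ((-1) ^ p * wedge h' α (β.curryLeft X) v) := by
    intro i
    rw [← mul_smul_comm, factorial_smul_wedge, Finset.smul_sum, Finset.mul_sum]
    refine Finset.sum_congr rfl fun τ _ => ?_
    rw [(insertNth_idxR_comp h h' i X _).1, (insertNth_idxR_comp h h' i X _).2,
      smul_apply_insertNth, smul_comm, mul_smul_comm]
    congr 1
    -- The place in the whole list gives `(-1)^(p + i)` and the place within `β` gives `(-1)^i`;
    -- what remains is `(-1)^p`.
    rcases Nat.even_or_odd (i : ℕ) with h' | h' <;> rcases Nat.even_or_odd p with h'' | h'' <;>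
      simp [idxR, pow_add, h'.neg_one_pow, h''.neg_one_pow, Units.smul_def]
  rw [Finset.sum_congr rfl fun i _ => key i, Finset.sum_const, Finset.card_univ, Fintype.card_fin,
    smul_smul, Nat.factorial_succ, mul_left_comm]

theorem factorial_smul_wedge_cons {p q n : ℕ} (h : p + q = n + 1) (α : AltForm A L p)
    (β : AltForm A L q) (X : L) (v : Fin n → L) :
    (p.factorial * q.factorial) • wedge h α β (Fin.cons X v : Fin (n + 1) → L) =
      ∑ i : Fin p, (-1 : ℤˣ) ^ ((idxL h i : Fin (n + 1)) : ℕ) •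
        ∑ τ : Equiv.Perm (Fin n), Equiv.Perm.sign τ •
          (α (((idxL h i).insertNth X (v ∘ τ) : Fin (n + 1) → L) ∘ idxL h) *
            β (((idxL h i).insertNth X (v ∘ τ) : Fin (n + 1) → L) ∘ idxR h)) +
      ∑ i : Fin q, (-1 : ℤˣ) ^ ((idxR h i : Fin (n + 1)) : ℕ) •
        ∑ τ : Equiv.Perm (Fin n), Equiv.Perm.sign τ •
          (α (((idxR h i).insertNth X (v ∘ τ) : Fin (n + 1) → L) ∘ idxL h) *
            β (((idxR h i).insertNth X (v ∘ τ) : Fin (n + 1) → L) ∘ idxR h)) := by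
  rw [factorial_smul_wedge, sum_perm_sign_cons
    (fun w => α (w ∘ idxL h) * β (w ∘ idxR h)), sum_idx h]

/-- The permutation expansion computes `p! q!` times the wedge product; the factor is invertible
because `A` is a real vector space. -/
theorem factorial_smul_cancel {p q : ℕ} {x y : A}
    (h : (p.factorial * q.factorial) • x = (p.factorial * q.factorial) • y) : x = y := by
  rw [← Nat.cast_smul_eq_nsmul ℝ, ← Nat.cast_smul_eq_nsmul ℝ] at h
  have h0 : ((p.factorial * q.factorial : ℕ) : ℝ) ≠ 0 :=
    Nat.cast_ne_zero.2 (mul_ne_zero p.factorial_ne_zero q.factorial_ne_zero)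
  exact smul_right_injective A h0 h

/-- The interior product is an antiderivation. -/
theorem curryLeft_wedge {p q n : ℕ} (h : p + 1 + (q + 1) = n + 1) (h₁ : p + (q + 1) = n)
    (h₂ : p + 1 + q = n) (α : AltForm A L (p + 1)) (β : AltForm A L (q + 1)) (X : L) :
    (wedge h α β).curryLeft X = wedge h₁ (α.curryLeft X) β +
      (-1 : A) ^ (p + 1) • wedge h₂ α (β.curryLeft X) := by
  ext v
  refine factorial_smul_cancel (p := p + 1) (q := q + 1) ?_
  refine (factorial_smul_wedge_cons h α β X v).trans ?_
  rw [sum_idxL h h₁, sum_idxR h h₂, ← smul_add]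
  rfl

/-- A factor of degree `0` cannot absorb the vector, so its block of insertions is empty. It needs a
separate statement because `curryLeft` exists only in positive degree. -/
theorem curryLeft_wedge_zero_right {p n : ℕ} (h : p + 1 + 0 = n + 1) (h₁ : p + 0 = n)
    (α : AltForm A L (p + 1)) (β : AltForm A L 0) (X : L) :
    (wedge h α β).curryLeft X = wedge h₁ (α.curryLeft X) β := by
  ext v
  refine factorial_smul_cancel (p := p + 1) (q := 0) ?_
  refine (factorial_smul_wedge_cons h α β X v).trans ?_
  rw [sum_idxL h h₁, Finset.univ_eq_empty (α := Fin 0), Finset.sum_empty, add_zero]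

theorem curryLeft_wedge_zero_left {q n : ℕ} (h : 0 + (q + 1) = n + 1) (h₁ : 0 + q = n)
    (α : AltForm A L 0) (β : AltForm A L (q + 1)) (X : L) :
    (wedge h α β).curryLeft X = wedge h₁ α (β.curryLeft X) := by
  ext v
  refine factorial_smul_cancel (p := 0) (q := q + 1) ?_
  refine (factorial_smul_wedge_cons h α β X v).trans ?_
  rw [sum_idxR h h₁, Finset.univ_eq_empty (α := Fin 0), Finset.sum_empty, zero_add, pow_zero,
    one_mul]

theorem wedge_zero_zero (h : 0 + 0 = 0) (α β : AltForm A L 0) :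
    wedge h α β ![] = α ![] * β ![] := by
  refine factorial_smul_cancel (p := 0) (q := 0) ?_
  rw [factorial_smul_wedge]
  have h0 : ∀ w : Fin 0 → L, w = ![] := fun w => Subsingleton.elim _ _
  simp only [Finset.univ_unique, Finset.sum_singleton, h0 (_ ∘ _)]
  simp

end Calculus
end AltForm

/-! ### The algebra of inhomogeneous forms -/

namespace Forms

section Wedge

set_option linter.unusedSectionVars false

variable {A L : Type*} [CommRing A] [Algebra ℝ A] [LieRing L] [LieAlgebra ℝ L] [Module A L]
  [LieRingModule L A] [LieRinehartRing A L] [LieRinehartAlgebra ℝ A L]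

theorem neg_real_smul {k : ℕ} (c : ℝ) (α : AltForm A L k) : (-c) • α = -(c • α) :=
  AlternatingMap.ext fun v => neg_smul c (α v)

/-- The grading involution, `(-1)^k` in degree `k`. -/
def sgn : Forms A L →ₗ[ℝ] Forms A L where
  toFun φ k := (-1 : ℝ) ^ k • φ k
  map_add' _ _ := funext fun _ => smul_add _ _ _
  map_smul' c φ := funext fun k => smul_comm ((-1 : ℝ) ^ k) c (φ k)

theorem sgn_apply (φ : Forms A L) (k : ℕ) : sgn φ k = (-1 : ℝ) ^ k • φ k := rfl

theorem sgn_sgn (φ : Forms A L) : sgn (sgn φ) = φ := by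
  funext k
  rw [sgn_apply, sgn_apply, smul_smul, ← mul_pow, neg_mul_neg, one_mul, one_pow, one_smul]

theorem interior_sgn (X : L) (φ : Forms A L) : interior X (sgn φ) = - sgn (interior X φ) := by
  funext k
  show ((-1 : ℝ) ^ (k + 1) • φ (k + 1)).curryLeft X = - ((-1 : ℝ) ^ k • (φ (k + 1)).curryLeft X)
  rw [pow_succ, mul_neg_one, neg_real_smul]
  rfl

/-- The wedge product of homogeneous forms, `0` if the degrees do not add up. -/
noncomputable def wedgeD {p q : ℕ} (n : ℕ) (α : AltForm A L p) (β : AltForm A L q) :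
    AltForm A L n :=
  if h : p + q = n then AltForm.wedge h α β else 0

theorem wedgeD_eq {p q n : ℕ} (h : p + q = n) (α : AltForm A L p) (β : AltForm A L q) :
    wedgeD n α β = AltForm.wedge h α β := dif_pos h

/-- Replaces the sum over pairs that carry a proof of `p + q = n` by a sum over plain pairs, to
which the reindexing lemmas for antidiagonals apply. -/
theorem wedge_apply (φ ψ : Forms A L) (n : ℕ) :
    wedge φ ψ n = ∑ x ∈ Finset.HasAntidiagonal.antidiagonal n, wedgeD n (φ x.1) (ψ x.2) := by
  rw [← Finset.sum_coe_sort]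
  show ∑ x : Finset.HasAntidiagonal.antidiagonal n,
    AltForm.wedge (Finset.HasAntidiagonal.mem_antidiagonal.1 x.2) (φ x.1.1) (ψ x.1.2) = _
  exact Finset.sum_congr rfl fun x _ =>
    (wedgeD_eq (Finset.HasAntidiagonal.mem_antidiagonal.1 x.2) (φ x.1.1) (ψ x.1.2)).symm

theorem wedge_zero_apply (φ ψ : Forms A L) : wedge φ ψ 0 ![] = φ 0 ![] * ψ 0 ![] := by
  rw [wedge_apply, Finset.Nat.antidiagonal_zero, Finset.sum_singleton, wedgeD_eq (zero_add 0)]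
  exact AltForm.wedge_zero_zero _ _ _

/-- The interior product is an antiderivation. -/
theorem interior_wedge (X : L) (φ ψ : Forms A L) :
    interior X (wedge φ ψ) = wedge (interior X φ) ψ + wedge (sgn φ) (interior X ψ) := by
  funext n
  -- The terms in which `X` goes into `φ` (`l`) or into `ψ` (`r`), with default `0` when that factor
  -- is a function. Splitting off the zero terms reindexes the sums from the antidiagonal of `n + 1`
  -- to that of `n`.
  let l : ℕ × ℕ → AltForm A L n := fun x =>
    Nat.casesOn x.1 0 fun p => wedgeD n (interior X φ p) (ψ x.2)
  let r : ℕ × ℕ → AltForm A L n := fun x =>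
    Nat.casesOn x.2 0 fun q => wedgeD n (sgn φ x.1) (interior X ψ q)
  have key : ∀ x ∈ Finset.HasAntidiagonal.antidiagonal (n + 1),
      (wedgeD (n + 1) (φ x.1) (ψ x.2)).curryLeft X = l x + r x := by
    rintro ⟨p, q⟩ hx
    have h : p + q = n + 1 := Finset.HasAntidiagonal.mem_antidiagonal.1 hx
    have hs : ∀ (k m : ℕ) (α : AltForm A L m), (-1 : A) ^ k • α = (-1 : ℝ) ^ k • α := by
      intro k m α
      rw [AltForm.real_smul, map_pow, map_neg, map_one]
    rw [wedgeD_eq h]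
    cases p with
    | zero =>
      cases q with
      | zero => omega
      | succ q =>
        have h' : 0 + q = n := by omega
        simp only [l, r, wedgeD_eq h', sgn_apply, pow_zero, one_smul]
        rw [AltForm.curryLeft_wedge_zero_left h h']
        exact (zero_add _).symm
    | succ p =>
      cases q with
      | zero =>
        have h' : p + 0 = n := by omega
        simp only [l, r, wedgeD_eq h']
        rw [AltForm.curryLeft_wedge_zero_right h h']
        exact (add_zero _).symm
      | succ q =>
        have h₁ : p + (q + 1) = n := by omega
        have h₂ : p + 1 + q = n := by omega
        simp only [l, r, wedgeD_eq h₁, wedgeD_eq h₂, sgn_apply]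
        rw [AltForm.curryLeft_wedge h h₁ h₂, ← hs, map_smul, LinearMap.smul_apply]
        rfl
  have hsum : interior X (wedge φ ψ) n = ∑ x ∈ Finset.HasAntidiagonal.antidiagonal (n + 1),
      (wedgeD (n + 1) (φ x.1) (ψ x.2)).curryLeft X := by
    rw [interior_apply, wedge_apply]
    exact map_sum (LinearMap.applyₗ X ∘ₗ AlternatingMap.curryLeftLinearMap) _ _
  rw [hsum, Finset.sum_congr rfl key, Finset.sum_add_distrib, Finset.Nat.sum_antidiagonal_succ,
    Finset.Nat.sum_antidiagonal_succ', Pi.add_apply, wedge_apply, wedge_apply]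
  simp only [l, r]
  exact congrArg₂ _ (zero_add _) (zero_add _)

theorem sgn_wedge (φ ψ : Forms A L) : sgn (wedge φ ψ) = wedge (sgn φ) (sgn ψ) := by
  funext n
  rw [sgn_apply, wedge_apply, wedge_apply, Finset.smul_sum]
  refine Finset.sum_congr rfl fun x hx => ?_
  have h := Finset.HasAntidiagonal.mem_antidiagonal.1 hx
  rw [wedgeD_eq h, wedgeD_eq h, sgn_apply, sgn_apply]
  have hs : (-1 : ℝ) ^ n = (-1) ^ x.2 * (-1) ^ x.1 := by rw [← pow_add, add_comm, h]
  simp only [hs, AltForm.real_smul, map_smul, LinearMap.smul_apply, smul_smul, map_mul]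

/-- Under `ι_X` both sides expand into the same three triple products, as `sgn` is multiplicative;
in degree `0` it is associativity in `A`. -/
theorem wedge_assoc (φ ψ χ : Forms A L) :
    wedge (wedge φ ψ) χ = wedge φ (wedge ψ χ) := by
  funext n
  induction n generalizing φ ψ χ with
  | zero => exact AltForm.ext_zero (by simp only [wedge_zero_apply, mul_assoc])
  | succ n ih =>
    refine apply_succ_eq fun X => ?_
    simp only [interior_wedge, map_add, LinearMap.add_apply, Pi.add_apply, sgn_wedge, ih, add_assoc]

/-- The even and the odd case have to be proved together, since `ι_X` exchanges the parity of `φ`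
and each case uses the other one in lower degree. -/
theorem wedge_comm_aux (n : ℕ) (φ ψ : Forms A L) :
    (sgn φ = φ → wedge φ ψ n = wedge ψ φ n) ∧
      (sgn φ = -φ → wedge φ ψ n = wedge (sgn ψ) φ n) := by
  induction n generalizing φ ψ with
  | zero =>
    refine ⟨fun _ => AltForm.ext_zero ?_, fun h => AltForm.ext_zero ?_⟩
    · simp only [wedge_zero_apply, mul_comm]
    · have h1 : φ 0 = - φ 0 := by
        have := congrFun h 0
        rwa [sgn_apply, pow_zero, one_smul] at this
      simp only [wedge_zero_apply, sgn_apply, pow_zero, one_smul, mul_comm]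
  | succ n ih =>
    refine ⟨fun h => apply_succ_eq fun X => ?_, fun h => apply_succ_eq fun X => ?_⟩
    · have hX : sgn (interior X φ) = - interior X φ := by
        rw [← neg_eq_iff_eq_neg, ← interior_sgn, h]
      rw [interior_wedge, interior_wedge, h, Pi.add_apply, Pi.add_apply, (ih _ _).2 hX,
        (ih _ _).1 h, add_comm]
    · have hX : sgn (interior X φ) = interior X φ := by
        rw [← neg_inj, ← interior_sgn, h, map_neg]
      rw [interior_wedge, interior_wedge, h, sgn_sgn, Pi.add_apply, Pi.add_apply,
        (ih _ _).1 hX, interior_sgn, map_neg, map_neg, LinearMap.neg_apply, LinearMap.neg_apply,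
        Pi.neg_apply, Pi.neg_apply, (ih _ _).2 h, add_comm]

theorem wedge_comm_of_even {φ : Forms A L} (h : sgn φ = φ) (ψ : Forms A L) :
    wedge φ ψ = wedge ψ φ :=
  funext fun n => (wedge_comm_aux n φ ψ).1 h

theorem wedge_comm_of_odd {φ : Forms A L} (h : sgn φ = -φ) (ψ : Forms A L) :
    wedge φ ψ = wedge (sgn ψ) φ :=
  funext fun n => (wedge_comm_aux n φ ψ).2 h

theorem lie_sgn (X : L) (φ : Forms A L) : lie X (sgn φ) = sgn (lie X φ) :=
  funext fun k => map_smul (AltForm.lieDeriv X) ((-1 : ℝ) ^ k) (φ k)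

theorem d_sgn (φ : Forms A L) : d (sgn φ) = - sgn (d φ) := by
  funext k
  cases k with
  | zero =>
    show (0 : AltForm A L 0) = -((-1 : ℝ) ^ 0 • 0)
    rw [smul_zero, neg_zero]
  | succ k =>
    refine (map_smul AltForm.extDer ((-1 : ℝ) ^ k) (φ k)).trans ?_
    show _ = -((-1 : ℝ) ^ (k + 1) • AltForm.extDer (φ k))
    rw [pow_succ, mul_neg_one, neg_real_smul, neg_neg]

/-- The Lie derivative is a derivation. -/
theorem lie_wedge (X : L) (φ ψ : Forms A L) :
    lie X (wedge φ ψ) = wedge (lie X φ) ψ + wedge φ (lie X ψ) := by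
  funext n
  induction n generalizing φ ψ with
  | zero =>
    refine AltForm.ext_zero ?_
    rw [Pi.add_apply, AlternatingMap.add_apply, lie_apply, AltForm.lieDeriv_zero_apply,
      wedge_zero_apply, wedge_zero_apply, wedge_zero_apply, lie_apply, lie_apply,
      AltForm.lieDeriv_zero_apply, AltForm.lieDeriv_zero_apply,
      LieRinehartRing.leibniz_mul_right, add_comm, smul_eq_mul]
  | succ n ih =>
    refine apply_succ_eq fun Y => ?_
    simp only [interior_lie, interior_wedge, map_add, map_sub,
      LinearMap.sub_apply, Pi.add_apply, Pi.sub_apply, ih, lie_sgn]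
    abel

/-- The exterior derivative is an antiderivation. -/
theorem d_wedge (φ ψ : Forms A L) :
    d (wedge φ ψ) = wedge (d φ) ψ + wedge (sgn φ) (d ψ) := by
  funext n
  induction n generalizing φ ψ with
  | zero =>
    refine AltForm.ext_zero ?_
    rw [Pi.add_apply, AlternatingMap.add_apply, wedge_zero_apply, wedge_zero_apply]
    simp only [d_zero, AlternatingMap.zero_apply, zero_mul, mul_zero, add_zero]
  | succ n ih =>
    refine apply_succ_eq fun Y => ?_
    -- Cartan's formula replaces `ι_Y d` by `L_Y - d ι_Y`. The `L_Y` terms match by `lie_wedge`, and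
    -- the others are the induction hypothesis for the pairs `(ι_Y φ, ψ)` and `(sgn φ, ι_Y ψ)`.
    simp only [interior_d, interior_wedge, lie_wedge, map_add, map_sub,
      LinearMap.sub_apply, Pi.add_apply, Pi.sub_apply, ih, interior_sgn, d_sgn, sgn_sgn, map_neg,
      LinearMap.neg_apply, Pi.neg_apply]
    abel

/-! Homogeneous forms -/

theorem of_self {k : ℕ} (α : AltForm A L k) : of α k = α := Pi.single_eq_same k α

theorem of_ne {k l : ℕ} (h : l ≠ k) (α : AltForm A L k) : of α l = 0 := Pi.single_eq_of_ne h α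

theorem eq_of_iff {k : ℕ} {φ : Forms A L} {α : AltForm A L k} :
    φ = of α ↔ φ k = α ∧ ∀ l, l ≠ k → φ l = 0 := by
  refine ⟨?_, fun h => ?_⟩
  · rintro rfl
    exact ⟨of_self α, fun l hl => of_ne hl α⟩
  · funext l
    by_cases hl : l = k
    · subst hl
      rw [h.1, of_self]
    · rw [h.2 l hl, of_ne hl]

theorem of_add {k : ℕ} (α β : AltForm A L k) : of (α + β) = of α + of β := Pi.single_add k α β

theorem of_sub {k : ℕ} (α β : AltForm A L k) : of (α - β) = of α - of β := Pi.single_sub k α β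

theorem of_neg {k : ℕ} (α : AltForm A L k) : of (-α) = - of α := Pi.single_neg k α

theorem of_zero (k : ℕ) : of (0 : AltForm A L k) = 0 := Pi.single_zero k

theorem of_smul {k : ℕ} (c : ℝ) (α : AltForm A L k) : of (c • α) = c • of α := Pi.single_smul k c α

theorem sgn_of {k : ℕ} (α : AltForm A L k) : sgn (of α) = (-1 : ℝ) ^ k • of α := by
  rw [← of_smul, eq_of_iff]
  refine ⟨by rw [sgn_apply, of_self], fun l hl => by rw [sgn_apply, of_ne hl, smul_zero]⟩

theorem interior_of {k : ℕ} (X : L) (α : AltForm A L (k + 1)) :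
    interior X (of α) = of (α.curryLeft X) := by
  rw [eq_of_iff]
  refine ⟨by rw [interior_apply, of_self], fun l hl => ?_⟩
  rw [interior_apply, of_ne (by simpa using hl)]
  rfl

theorem interior_of_zero (X : L) (α : AltForm A L 0) : interior X (of α) = 0 := by
  funext l
  rw [interior_apply, of_ne (Nat.succ_ne_zero l)]
  rfl

theorem d_of {k : ℕ} (α : AltForm A L k) : d (of α) = of (AltForm.extDer α) := by
  rw [eq_of_iff]
  refine ⟨by rw [d_succ, of_self], fun l hl => ?_⟩
  cases l with
  | zero => rfl
  | succ l => rw [d_succ, of_ne (by simpa using hl), map_zero]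

theorem lie_of {k : ℕ} (X : L) (α : AltForm A L k) : lie X (of α) = of (AltForm.lieDeriv X α) := by
  rw [eq_of_iff]
  exact ⟨by rw [lie_apply, of_self], fun l hl => by rw [lie_apply, of_ne hl, map_zero]⟩

theorem sgn_of_two (B : AltForm A L 2) : sgn (of B) = of B := by rw [sgn_of]; norm_num

theorem sgn_of_odd {k : ℕ} (hk : Odd k) (α : AltForm A L k) : sgn (of α) = - of α := by
  rw [sgn_of, hk.neg_one_pow, ← of_smul, neg_real_smul, one_smul, of_neg]

theorem sgn_of_one (α : AltForm A L 1) : sgn (of α) = - of α := sgn_of_odd odd_one α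

theorem sgn_of_three (α : AltForm A L 3) : sgn (of α) = - of α := sgn_of_odd (by decide) α

theorem one_wedge (φ : Forms A L) :
    wedge (of (AlternatingMap.constOfIsEmpty A L (Fin 0) 1)) φ = φ := by
  funext n
  induction n generalizing φ with
  | zero =>
    refine AltForm.ext_zero ?_
    rw [wedge_zero_apply, of_self]
    exact one_mul _
  | succ n ih =>
    refine apply_succ_eq fun X => ?_
    rw [interior_wedge, interior_of_zero, sgn_of, pow_zero, one_smul, map_zero,
      LinearMap.zero_apply, zero_add, ih]

/-! The exponential -/

theorem pow2_succ (B : AltForm A L 2) (j : ℕ) : pow2 B (j + 1) = wedge (of B) (pow2 B j) := rfl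

theorem sgn_pow2 (B : AltForm A L 2) (j : ℕ) : sgn (pow2 B j) = pow2 B j := by
  induction j with
  | zero =>
    rw [pow2, sgn_of, pow_zero, one_smul]
  | succ j ih => rw [pow2_succ, sgn_wedge, sgn_of_two, ih]

theorem interior_pow2_zero (X : L) (B : AltForm A L 2) : interior X (pow2 B 0) = 0 :=
  interior_of_zero X _

/-- The power rule holds because `B` is even: `ι_X` produces no signs on powers of `B`, and `B`
commutes with `ι_X B`. -/
theorem interior_pow2 (X : L) (B : AltForm A L 2) (j : ℕ) :
    interior X (pow2 B (j + 1)) = ((j : ℝ) + 1) • wedge (of (B.curryLeft X)) (pow2 B j) := by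
  induction j with
  | zero =>
    rw [pow2_succ, interior_wedge, interior_pow2_zero, interior_of, map_zero, add_zero,
      Nat.cast_zero, zero_add, one_smul]
  | succ j ih =>
    rw [pow2_succ, interior_wedge, ih, interior_of, sgn_of_two, map_smul, ← wedge_assoc,
      wedge_comm_of_even (sgn_of_two B), wedge_assoc, ← pow2_succ, Nat.cast_succ]
    module

theorem pow2_apply_of_lt (B : AltForm A L 2) {j k : ℕ} (h : k < 2 * j) : pow2 B j k = 0 := by
  induction j generalizing k with
  | zero => omega
  | succ j ih =>
    rw [pow2_succ, wedge_apply]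
    refine Finset.sum_eq_zero fun x hx => ?_
    have hx' := Finset.HasAntidiagonal.mem_antidiagonal.1 hx
    rw [wedgeD_eq hx']
    by_cases h2 : x.1 = 2
    · rw [ih (k := x.2) (by omega), map_zero]
    · rw [of_ne h2, map_zero, LinearMap.zero_apply]

theorem exp2_zero_apply (B : AltForm A L 2) : exp2 B 0 ![] = 1 := by
  simp [exp2, pow2, of_self]

/-- Since `B^j` has no part below degree `2 j`, a longer sum changes nothing. The cut-off, which
depends on the degree, can therefore be replaced by a common one. -/
theorem exp2_apply_of_le (B : AltForm A L 2) {k N : ℕ} (h : k ≤ N) :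
    exp2 B k = (∑ j ∈ Finset.range (N + 1), (j.factorial : ℝ)⁻¹ • pow2 B j) k := by
  rw [Finset.sum_apply]
  refine Finset.sum_subset (Finset.range_mono (by omega)) fun j _ hj => ?_
  rw [Finset.mem_range, not_lt] at hj
  rw [Pi.smul_apply, pow2_apply_of_lt B (by omega), smul_zero]

theorem wedge_congr_right (φ : Forms A L) {ψ χ : Forms A L} {n : ℕ} (h : ∀ k ≤ n, ψ k = χ k) :
    wedge φ ψ n = wedge φ χ n := by
  rw [wedge_apply, wedge_apply]
  refine Finset.sum_congr rfl fun x hx => ?_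
  rw [h x.2 (by have := Finset.HasAntidiagonal.mem_antidiagonal.1 hx; omega)]

/-- A 1-form raises the degree, so only strictly lower degrees of the other factor matter. This
makes the recursion in `eq_of_interior_eq_wedge` well founded. -/
theorem wedge_congr_right_of_one (α : AltForm A L 1) {ψ χ : Forms A L} {n : ℕ}
    (h : ∀ k < n, ψ k = χ k) : wedge (of α) ψ n = wedge (of α) χ n := by
  rw [wedge_apply, wedge_apply]
  refine Finset.sum_congr rfl fun x hx => ?_
  have hx' := Finset.HasAntidiagonal.mem_antidiagonal.1 hx
  rw [wedgeD_eq hx', wedgeD_eq hx']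
  by_cases h1 : x.1 = 1
  · rw [h x.2 (by omega)]
  · rw [of_ne h1, map_zero, LinearMap.zero_apply, LinearMap.zero_apply]

theorem interior_exp2 (X : L) (B : AltForm A L 2) :
    interior X (exp2 B) = wedge (of (B.curryLeft X)) (exp2 B) := by
  funext n
  have h1 : wedge (of (B.curryLeft X)) (exp2 B) n = wedge (of (B.curryLeft X))
      (∑ j ∈ Finset.range (n + 1), (j.factorial : ℝ)⁻¹ • pow2 B j) n :=
    wedge_congr_right _ fun k hk => exp2_apply_of_le B hk
  -- Degree `n` of `ι_X e^B` comes from degree `n + 1` of `e^B`, hence one more summand than in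
  -- `h1`. The extra one compensates the index shift caused by `ι_X 1 = 0`.
  have h2 : interior X (exp2 B) n =
      interior X (∑ j ∈ Finset.range (n + 2), (j.factorial : ℝ)⁻¹ • pow2 B j) n := by
    rw [interior_apply, exp2_apply_of_le B le_rfl, interior_apply]
  rw [h1, h2, map_sum, Finset.sum_range_succ', map_smul, interior_pow2_zero, smul_zero, add_zero,
    map_sum]
  refine congrFun (Finset.sum_congr rfl fun j _ => ?_) n
  have h3 : ((j : ℝ) + 1) ≠ 0 := by positivity
  rw [map_smul, map_smul, interior_pow2, smul_smul, Nat.factorial_succ]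
  push_cast
  congr 1
  field_simp

/-- The equations `ι_X φ = α(X) ∧ φ` determine each degree from the lower ones, so a solution is
fixed by its part of degree `0`. For `α(X) = ι_X B` this characterises `e^B` and replaces
manipulations of the exponential series. -/
theorem eq_of_interior_eq_wedge {φ ψ : Forms A L} (α : L → AltForm A L 1)
    (h0 : φ 0 ![] = ψ 0 ![]) (hφ : ∀ X, interior X φ = wedge (of (α X)) φ)
    (hψ : ∀ X, interior X ψ = wedge (of (α X)) ψ) : φ = ψ := by
  funext n
  induction n using Nat.strong_induction_on with
  | _ n ih =>
    cases n with
    | zero => exact AltForm.ext_zero h0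
    | succ n =>
      refine apply_succ_eq fun X => ?_
      rw [hφ, hψ]
      exact wedge_congr_right_of_one _ fun k hk => ih k (by omega)

theorem sgn_exp2 (B : AltForm A L 2) : sgn (exp2 B) = exp2 B := by
  funext k
  rw [sgn_apply, exp2, Finset.smul_sum]
  refine Finset.sum_congr rfl fun j _ => ?_
  rw [Pi.smul_apply, smul_comm, ← sgn_apply, sgn_pow2]

theorem exp2_zero :
    exp2 (0 : AltForm A L 2) = of (AlternatingMap.constOfIsEmpty A L (Fin 0) 1) := by
  refine eq_of_interior_eq_wedge (fun _ => 0) ?_ (fun X => ?_) fun X => ?_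
  · rw [exp2_zero_apply, of_self]
    rfl
  · rw [interior_exp2]
    rfl
  · rw [interior_of_zero, of_zero, map_zero, LinearMap.zero_apply]

/-- Both sides solve `ι_X φ = ι_X (B + B') ∧ φ` with value `1` in degree `0`. -/
theorem exp2_add (B B' : AltForm A L 2) : exp2 (B + B') = wedge (exp2 B) (exp2 B') := by
  refine eq_of_interior_eq_wedge (fun X => (B + B').curryLeft X) ?_
    (fun X => interior_exp2 X _) fun X => ?_
  · rw [wedge_zero_apply, exp2_zero_apply, exp2_zero_apply, exp2_zero_apply, mul_one]
  · rw [interior_wedge, interior_exp2, interior_exp2, sgn_exp2, AlternatingMap.curryLeft_add,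
      LinearMap.add_apply, of_add, map_add, LinearMap.add_apply, wedge_assoc,
      wedge_comm_of_even (sgn_exp2 B), wedge_comm_of_even (sgn_exp2 B), wedge_assoc]

theorem odd_wedge_anticomm {α β : Forms A L} (hα : sgn α = -α) (hβ : sgn β = -β)
    (φ : Forms A L) : wedge α (wedge β φ) = - wedge β (wedge α φ) := by
  rw [← wedge_assoc, wedge_comm_of_odd hα, hβ, map_neg, LinearMap.neg_apply, map_neg,
    LinearMap.neg_apply, wedge_assoc]

theorem eq_zero_of_interior_eq_wedge {φ : Forms A L} (α : L → AltForm A L 1)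
    (h0 : φ 0 ![] = 0) (hφ : ∀ X, interior X φ = wedge (of (α X)) φ) : φ = 0 :=
  eq_of_interior_eq_wedge α h0 hφ fun X => by rw [map_zero, map_zero]

/-- The difference of the two sides vanishes in degree `0` and again solves `ι_Y φ = ι_Y B ∧ φ`, so
it is zero. The same argument proves `d_exp2`. -/
theorem lie_exp2 (X : L) (B : AltForm A L 2) :
    lie X (exp2 B) = wedge (lie X (of B)) (exp2 B) := by
  rw [← sub_eq_zero]
  refine eq_zero_of_interior_eq_wedge (fun Y => B.curryLeft Y) ?_ fun Y => ?_
  · rw [Pi.sub_apply, AlternatingMap.sub_apply, wedge_zero_apply, lie_of, of_ne (by norm_num),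
      lie_apply, AltForm.lieDeriv_zero_apply, exp2_zero_apply]
    -- The derivative of a constant vanishes by the Leibniz rule for `1 · 1`.
    have h1 : ⁅X, (1 : A)⁆ = 0 := by
      have := LieRinehartRing.leibniz_mul_right X (1 : A) 1
      rwa [mul_one, one_smul, mul_one, left_eq_add] at this
    rw [h1, AlternatingMap.zero_apply, zero_mul, sub_zero]
  · have h : sgn (lie X (of B)) = lie X (of B) := by rw [← lie_sgn, sgn_of_two]
    rw [map_sub, map_sub, interior_lie, interior_wedge, interior_exp2, interior_exp2, lie_wedge, h,
      interior_lie, interior_of, interior_of, map_sub, LinearMap.sub_apply, ← wedge_assoc,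
      ← wedge_assoc, wedge_comm_of_even h]
    abel

theorem d_exp2 (B : AltForm A L 2) : d (exp2 B) = wedge (d (of B)) (exp2 B) := by
  rw [← sub_eq_zero]
  refine eq_zero_of_interior_eq_wedge (fun Y => B.curryLeft Y) ?_ fun Y => ?_
  · rw [Pi.sub_apply, AlternatingMap.sub_apply, wedge_zero_apply, d_zero, d_zero,
      AlternatingMap.zero_apply, zero_mul, sub_zero]
  · have h : sgn (d (of B)) = - d (of B) := by rw [← neg_eq_iff_eq_neg, ← d_sgn, sgn_of_two]
    rw [map_sub, map_sub, interior_d, interior_wedge, interior_exp2, lie_exp2, d_wedge,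
      interior_d, interior_of, sgn_of_one, h, map_neg, map_neg, LinearMap.neg_apply,
      LinearMap.neg_apply, map_sub, LinearMap.sub_apply,
      odd_wedge_anticomm h (sgn_of_one _)]
    abel

/-- Conjugation by `e^B` adds `ι_X B ∧` to `ι_X`. This and its analogues for `d` and `L_X` show
which correction an operator on representatives needs under a change of splitting. -/
theorem interior_wedge_exp2 (X : L) (B : AltForm A L 2) (φ : Forms A L) :
    interior X (wedge (exp2 B) φ) =
      wedge (exp2 B) (interior X φ + wedge (of (B.curryLeft X)) φ) := by
  rw [interior_wedge, interior_exp2, sgn_exp2, map_add, ← wedge_assoc,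
    wedge_comm_of_even (sgn_exp2 B) (of _), add_comm]

theorem d_wedge_exp2 (B : AltForm A L 2) (φ : Forms A L) :
    d (wedge (exp2 B) φ) = wedge (exp2 B) (d φ + wedge (of (AltForm.extDer B)) φ) := by
  rw [d_wedge, d_exp2, sgn_exp2, map_add, ← wedge_assoc, d_of,
    wedge_comm_of_even (sgn_exp2 B) (of _), add_comm]

theorem lie_wedge_exp2 (X : L) (B : AltForm A L 2) (φ : Forms A L) :
    lie X (wedge (exp2 B) φ) =
      wedge (exp2 B) (lie X φ + wedge (of (AltForm.lieDeriv X B)) φ) := by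
  rw [lie_wedge, lie_exp2, map_add, ← wedge_assoc, lie_of,
    wedge_comm_of_even (sgn_exp2 B) (of _), add_comm]

theorem wedge_wedge_exp2 (B : AltForm A L 2) (φ ψ : Forms A L) :
    wedge φ (wedge (exp2 B) ψ) = wedge (exp2 B) (wedge φ ψ) := by
  rw [← wedge_assoc, ← wedge_comm_of_even (sgn_exp2 B), wedge_assoc]

/-! Parity -/

theorem wedge_mem_parity {i j : ZMod 2} {φ ψ : Forms A L} (hφ : φ ∈ parity i)
    (hψ : ψ ∈ parity j) : wedge φ ψ ∈ parity (i + j) := by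
  intro n hn
  rw [wedge_apply]
  refine Finset.sum_eq_zero fun x hx => ?_
  have h := Finset.HasAntidiagonal.mem_antidiagonal.1 hx
  rw [wedgeD_eq h]
  by_cases h1 : (x.1 : ZMod 2) = i
  · have h2 : (x.2 : ZMod 2) ≠ j := by
      rintro rfl
      apply hn
      rw [← h1, ← Nat.cast_add, h]
    rw [hψ _ h2, map_zero]
  · rw [hφ _ h1, map_zero, LinearMap.zero_apply]

theorem of_mem_parity {k : ℕ} (α : AltForm A L k) : of α ∈ parity (A := A) (L := L) k := by
  intro n hn
  refine of_ne ?_ α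
  rintro rfl
  exact hn rfl

theorem d_mem_parity {i : ZMod 2} {φ : Forms A L} (hφ : φ ∈ parity i) : d φ ∈ parity (i + 1) := by
  intro n hn
  cases n with
  | zero => rfl
  | succ n =>
    rw [d_succ, hφ n, map_zero]
    rintro rfl
    exact hn (by push_cast; rfl)

theorem interior_mem_parity {i : ZMod 2} {φ : Forms A L} (X : L) (hφ : φ ∈ parity i) :
    interior X φ ∈ parity (i + 1) := by
  intro n hn
  rw [interior_apply, hφ (n + 1)]
  · rfl
  · rintro rfl
    apply hn
    push_cast
    rw [add_assoc, CharTwo.add_self_eq_zero, add_zero]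

theorem exp2_mem_parity (B : AltForm A L 2) : exp2 B ∈ parity (A := A) (L := L) 0 := by
  have h : ∀ j, pow2 B j ∈ parity (A := A) (L := L) 0 := by
    intro j
    induction j with
    | zero => exact of_mem_parity _
    | succ j ih =>
      rw [pow2_succ]
      exact wedge_mem_parity (of_mem_parity (k := 2) B) ih
  intro n hn
  refine Finset.sum_eq_zero fun j _ => ?_
  rw [Pi.smul_apply, h j n hn, smul_zero]

/-- The projection to the forms of even (`i = 0`) or odd (`i = 1`) degree. -/
def parityProj (i : ZMod 2) : Forms A L →ₗ[ℝ] Forms A L where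
  toFun φ k := if (k : ZMod 2) = i then φ k else 0
  map_add' φ ψ := by
    funext k
    by_cases h : (k : ZMod 2) = i <;> simp [h]
  map_smul' c φ := by
    funext k
    by_cases h : (k : ZMod 2) = i <;> simp [h]

theorem parityProj_apply (i : ZMod 2) (φ : Forms A L) (k : ℕ) :
    parityProj i φ k = if (k : ZMod 2) = i then φ k else 0 := rfl

theorem parityProj_mem (i : ZMod 2) (φ : Forms A L) : parityProj i φ ∈ parity i :=
  fun _ hk => if_neg hk

theorem parityProj_add (φ : Forms A L) : parityProj 0 φ + parityProj 1 φ = φ := by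
  funext k
  have h : ∀ i : ZMod 2, i = 0 ∨ i = 1 := by decide
  rw [Pi.add_apply, parityProj_apply, parityProj_apply]
  rcases h k with h | h
  · rw [if_pos h, if_neg (by rw [h]; decide), add_zero]
  · rw [if_pos h, if_neg (by rw [h]; decide), zero_add]

theorem parityProj_lie (i : ZMod 2) (X : L) (φ : Forms A L) :
    parityProj i (lie X φ) = lie X (parityProj i φ) := by
  funext k
  rw [lie_apply, parityProj_apply, parityProj_apply, lie_apply]
  split_ifs
  · rfl
  · rw [map_zero]

end Wedge
end Forms

/-! Operators on formal power series -/

namespace Series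

variable {r : ℕ} {V W : Type*} [AddCommGroup V] [Module ℝ V] [AddCommGroup W] [Module ℝ W]

theorem map_apply (f : V →ₗ[ℝ] W) (ρ : Series r V) (m : Fin r →₀ ℕ) : map f ρ m = f (ρ m) := rfl

theorem mulVar_apply (j : Fin r) (ρ : Series r V) (m : Fin r →₀ ℕ) :
    mulVar j ρ m = if m j = 0 then 0 else ρ (m - Finsupp.single j 1) := rfl

theorem partialDeriv_apply (j : Fin r) (ρ : Series r V) (m : Fin r →₀ ℕ) :
    partialDeriv j ρ m = ((m j : ℝ) + 1) • ρ (m + Finsupp.single j 1) := rfl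

theorem map_mulVar (f : V →ₗ[ℝ] W) (j : Fin r) (ρ : Series r V) :
    map f (mulVar j ρ) = mulVar j (map f ρ) := by
  funext m
  rw [map_apply, mulVar_apply, mulVar_apply]
  split_ifs
  · rw [map_zero]
  · rfl

theorem map_partialDeriv (f : V →ₗ[ℝ] W) (j : Fin r) (ρ : Series r V) :
    map f (partialDeriv j ρ) = partialDeriv j (map f ρ) := by
  funext m
  rw [map_apply, partialDeriv_apply, partialDeriv_apply, map_smul]
  rfl

theorem mulVar_mulVar (j k : Fin r) (ρ : Series r V) :
    mulVar j (mulVar k ρ) = mulVar k (mulVar j ρ) := by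
  rcases eq_or_ne j k with rfl | hjk
  · rfl
  funext m
  have h1 : (m - Finsupp.single j 1 : Fin r →₀ ℕ) k = m k := by
    simp [hjk]
  have h2 : (m - Finsupp.single k 1 : Fin r →₀ ℕ) j = m j := by
    simp [hjk.symm]
  simp only [mulVar_apply, h1, h2, tsub_right_comm (a := m) (b := Finsupp.single j 1)]
  split_ifs <;> rfl

/-- The Weyl relation `[∂_j, u_k] = δ_{jk}`; it makes the coadjoint action a derivation. -/
theorem partialDeriv_mulVar (j k : Fin r) (ρ : Series r V) :
    partialDeriv j (mulVar k ρ) = mulVar k (partialDeriv j ρ) + if j = k then ρ else 0 := by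
  funext m
  rcases eq_or_ne j k with rfl | hjk
  · rw [if_pos rfl, Pi.add_apply, partialDeriv_apply, mulVar_apply, mulVar_apply,
      if_neg (by simp), add_tsub_cancel_right]
    split_ifs with h
    · rw [h, Nat.cast_zero, zero_add, one_smul, zero_add]
    · have h1 : (m - Finsupp.single j 1 : Fin r →₀ ℕ) j = m j - 1 := by simp
      have h2 : m - Finsupp.single j 1 + Finsupp.single j 1 = m :=
        tsub_add_cancel_of_le (by simpa using Nat.one_le_iff_ne_zero.2 h)
      rw [partialDeriv_apply, h1, h2, Nat.cast_sub (Nat.one_le_iff_ne_zero.2 h), Nat.cast_one,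
        sub_add_cancel, add_smul, one_smul]
  · rw [if_neg hjk, add_zero, partialDeriv_apply, mulVar_apply, mulVar_apply]
    have h1 : (m + Finsupp.single j 1 : Fin r →₀ ℕ) k = m k := by
      simp [hjk]
    have h2 : (m - Finsupp.single k 1 : Fin r →₀ ℕ) j = m j := by
      simp [hjk.symm]
    rw [h1]
    split_ifs with h
    · rw [smul_zero]
    · rw [partialDeriv_apply, h2]
      congr 2
      ext l
      have := Nat.one_le_iff_ne_zero.2 h
      rcases eq_or_ne l k with rfl | hl
      · simp [hjk]
      · simp [Finsupp.single_apply, hl.symm]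

theorem mulVar_single (j : Fin r) (v : V) :
    mulVar j (single 0 v) = single (Finsupp.single j 1) v := by
  funext m
  rw [mulVar_apply, single, single, Pi.single_apply, Pi.single_apply]
  by_cases h : m = Finsupp.single j 1
  · subst h
    simp
  · rw [if_neg h]
    split_ifs with h1 h2
    · rfl
    · refine absurd ?_ h
      have h3 := tsub_add_cancel_of_le
        (show Finsupp.single j 1 ≤ m by simpa using Nat.one_le_iff_ne_zero.2 h1)
      rw [h2, zero_add] at h3
      exact h3.symm
    · rfl

theorem map_single (f : V →ₗ[ℝ] W) (m : Fin r →₀ ℕ) (v : V) :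
    map f (single m v) = single m (f v) := by
  funext m'
  rw [map_apply, single, single, Pi.single_apply, Pi.single_apply, apply_ite f, map_zero]

theorem partialDeriv_single_zero (j : Fin r) (v : V) : partialDeriv j (single 0 v) = 0 := by
  funext m
  have h : m + Finsupp.single j 1 ≠ 0 := fun h => by simpa using DFunLike.congr_fun h j
  rw [partialDeriv_apply, single, Pi.single_eq_of_ne h, smul_zero]
  rfl

theorem eq_zero_of_eq_neg {v : V} (h : v = -v) : v = 0 := by
  have h2 : (2 : ℝ) • v = 0 := by rw [two_smul, ← sub_neg_eq_add, ← h, sub_self]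
  exact (smul_eq_zero.1 h2).resolve_left two_ne_zero

/-- The product `u_j u_k` is symmetric, so antisymmetric coefficients cancel in pairs. It is applied
to anticommuting operators, to the structure constants of `𝔤` and to the functions `ι_{X_j} ξ_k`. -/
theorem sum_mulVar_mulVar_eq_zero {f : Fin r → Fin r → Series r V}
    (h : ∀ j k, f j k = - f k j) : ∑ j, ∑ k, mulVar j (mulVar k (f j k)) = 0 := by
  refine eq_zero_of_eq_neg (Finset.sum_comm.trans ?_)
  rw [← Finset.sum_neg_distrib]
  refine Finset.sum_congr rfl fun j _ => ?_
  rw [← Finset.sum_neg_distrib]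
  refine Finset.sum_congr rfl fun k _ => ?_
  rw [mulVar_mulVar, h k j, map_neg, map_neg]

/-! ### The coadjoint action and differentials of Cartan type -/

section Equivariant

variable {𝔤 : Type*} [LieRing 𝔤] [LieAlgebra ℝ 𝔤] (b : Module.Basis (Fin r) ℝ 𝔤)

theorem coad_apply (τ : 𝔤) (ρ : Series r V) :
    coad b τ ρ = - ∑ j, ∑ k, b.repr ⁅τ, b k⁆ j • mulVar k (partialDeriv j ρ) := by
  simp [coad]

theorem map_coad (f : V →ₗ[ℝ] W) (τ : 𝔤) (ρ : Series r V) :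
    map f (coad b τ ρ) = coad b τ (map f ρ) := by
  simp only [coad_apply, map_neg, map_sum, map_smul, map_mulVar, map_partialDeriv]

theorem coad_mulVar (τ : 𝔤) (l : Fin r) (ρ : Series r V) :
    coad b τ (mulVar l ρ) = mulVar l (coad b τ ρ) - ∑ k, b.repr ⁅τ, b k⁆ l • mulVar k ρ := by
  simp only [coad_apply, partialDeriv_mulVar, map_add, smul_add, Finset.sum_add_distrib, map_neg,
    map_sum, map_smul, mulVar_mulVar l, neg_add, ← sub_eq_add_neg]
  congr 1
  rw [Finset.sum_eq_single l]
  · simp only [if_true]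
  · intro j _ hj
    simp only [if_neg hj, map_zero, smul_zero, Finset.sum_const_zero]
  · exact fun h => absurd (Finset.mem_univ l) h

theorem coad_single_zero (τ : 𝔤) (v : V) : coad b τ (single 0 v) = 0 := by
  simp only [coad_apply, partialDeriv_single_zero, map_zero, smul_zero, Finset.sum_const_zero,
    neg_zero]

theorem mem_annihilated {θ : 𝔤 → V →ₗ[ℝ] V} {ρ : Series r V} :
    ρ ∈ annihilated b θ ↔ ∑ j, mulVar j (map (θ (b j)) ρ) = 0 := by
  simp [annihilated]

theorem mem_invariants {θ : 𝔤 → V →ₗ[ℝ] V} {ρ : Series r V} :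
    ρ ∈ invariants b θ ↔ ∀ τ, map (θ τ) ρ + coad b τ ρ = 0 := by
  simp [invariants]

/-- Invariance expresses `θ(b_j) ρ` by the coadjoint action. After multiplication by `u_j` the sum
is `∑ u_j u_k [b_j, b_k]^l ∂_l ρ`, which vanishes by antisymmetry: the coadjoint vector field of `τ`
is zero at the point `τ`. -/
theorem invariants_le_annihilated (θ : 𝔤 → V →ₗ[ℝ] V) : invariants b θ ≤ annihilated b θ := by
  intro ρ hρ
  rw [mem_invariants] at hρ
  rw [mem_annihilated]
  have h1 : ∀ j, mulVar j (map (θ (b j)) ρ) = ∑ k, mulVar j (mulVar k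
      (∑ l, b.repr ⁅b j, b k⁆ l • partialDeriv l ρ)) := by
    intro j
    rw [eq_neg_of_add_eq_zero_left (hρ (b j)), coad_apply, neg_neg, Finset.sum_comm]
    simp only [map_sum, map_smul]
  rw [Finset.sum_congr rfl fun j _ => h1 j]
  refine sum_mulVar_mulVar_eq_zero fun j k => ?_
  rw [← Finset.sum_neg_distrib]
  refine Finset.sum_congr rfl fun l _ => ?_
  rw [← lie_skew, map_neg, Finsupp.neg_apply, neg_smul]

/-- The operator `D₀ - ∑ j, u_j K_j`. -/
noncomputable def cartanOp (D₀ : V →ₗ[ℝ] V) (K : Fin r → V →ₗ[ℝ] V) :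
    Series r V →ₗ[ℝ] Series r V :=
  map D₀ - ∑ j, mulVar j ∘ₗ map (K j)

theorem cartanOp_apply (D₀ : V →ₗ[ℝ] V) (K : Fin r → V →ₗ[ℝ] V) (ρ : Series r V) :
    cartanOp D₀ K ρ = map D₀ ρ - ∑ j, mulVar j (map (K j) ρ) := by
  simp [cartanOp]

/-- The square of `D₀ - ∑ j, u_j K_j` is `- ∑ j, u_j Θ_j` if `D₀` and the `K_j` generate a
Clifford-like algebra with `D₀ K_j + K_j D₀ = Θ_j`. -/
theorem cartanOp_cartanOp {D₀ : V →ₗ[ℝ] V} {K Θ : Fin r → V →ₗ[ℝ] V}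
    (h₀ : ∀ v, D₀ (D₀ v) = 0) (h₁ : ∀ j v, D₀ (K j v) + K j (D₀ v) = Θ j v)
    (h₂ : ∀ j k v, K j (K k v) = - K k (K j v)) (ρ : Series r V) :
    cartanOp D₀ K (cartanOp D₀ K ρ) = - ∑ j, mulVar j (map (Θ j) ρ) := by
  have e0 : map D₀ (map D₀ ρ) = 0 := funext fun m => h₀ (ρ m)
  have e1 : ∀ j, map (Θ j) ρ = map D₀ (map (K j) ρ) + map (K j) (map D₀ ρ) := fun j =>
    funext fun m => (h₁ j (ρ m)).symm
  -- The part of the square that is quadratic in `u` vanishes, as the `K j` anticommute.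
  have e2 : ∑ j, ∑ k, mulVar j (mulVar k (map (K j) (map (K k) ρ))) = 0 :=
    sum_mulVar_mulVar_eq_zero fun j k => funext fun m => h₂ j k (ρ m)
  have e3 : ∀ j, mulVar j (map (K j) (∑ k, mulVar k (map (K k) ρ))) =
      ∑ k, mulVar j (mulVar k (map (K j) (map (K k) ρ))) := fun j => by
    simp only [map_sum, map_mulVar]
  have e4 : map D₀ (∑ j, mulVar j (map (K j) ρ)) = ∑ j, mulVar j (map D₀ (map (K j) ρ)) := by
    simp only [map_sum, map_mulVar]
  simp only [cartanOp_apply, map_sub, e0, e1, e3, e4, map_add, Finset.sum_add_distrib, e2]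
  abel

/-- For the operator `D = D₀ - ∑ u_j K(b_j)`, being annihilated means `D² ρ = 0`, and `D² (D ρ) = D
(D² ρ)`. -/
theorem cartanOp_mem_annihilated {D₀ : V →ₗ[ℝ] V} {K Θ : 𝔤 → V →ₗ[ℝ] V}
    (h₀ : ∀ v, D₀ (D₀ v) = 0) (h₁ : ∀ τ v, D₀ (K τ v) + K τ (D₀ v) = Θ τ v)
    (h₂ : ∀ τ σ v, K τ (K σ v) = - K σ (K τ v)) {ρ : Series r V} (hρ : ρ ∈ annihilated b Θ) :
    cartanOp D₀ (fun j => K (b j)) ρ ∈ annihilated b Θ := by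
  have h := cartanOp_cartanOp (r := r) h₀ (fun j => h₁ (b j)) fun j k => h₂ (b j) (b k)
  rw [mem_annihilated] at hρ ⊢
  rw [← neg_eq_zero, ← h, h ρ, hρ, neg_zero, map_zero]

/-- The element `∑ u_j K(b_j)` is invariant: the commutator `K [τ, b_j]` of the coefficients cancels
against the coadjoint variation of the `u_j`. So the whole operator commutes with the diagonal
action. -/
theorem cartanOp_mem_invariants {D₀ : V →ₗ[ℝ] V} {K : 𝔤 →ₗ[ℝ] V →ₗ[ℝ] V} {Θ : 𝔤 → V →ₗ[ℝ] V}
    (h₀ : ∀ τ v, Θ τ (D₀ v) = D₀ (Θ τ v))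
    (h₁ : ∀ τ σ v, Θ τ (K σ v) = K σ (Θ τ v) + K ⁅τ, σ⁆ v) {ρ : Series r V}
    (hρ : ρ ∈ invariants b Θ) : cartanOp D₀ (fun j => K (b j)) ρ ∈ invariants b Θ := by
  rw [mem_invariants] at hρ ⊢
  intro τ
  have hρ' : coad b τ ρ = - map (Θ τ) ρ := eq_neg_of_add_eq_zero_right (hρ τ)
  have e0 : map (Θ τ) (map D₀ ρ) = map D₀ (map (Θ τ) ρ) := funext fun m => h₀ τ (ρ m)
  have e1 : ∀ j, map (Θ τ) (map (K (b j)) ρ) = map (K (b j)) (map (Θ τ) ρ) +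
      ∑ k, b.repr ⁅τ, b j⁆ k • map (K (b k)) ρ := fun j => funext fun m => by
    refine (h₁ τ (b j) (ρ m)).trans ?_
    have : K ⁅τ, b j⁆ (ρ m) = ∑ k, b.repr ⁅τ, b j⁆ k • K (b k) (ρ m) := by
      conv_lhs => rw [← b.sum_repr ⁅τ, b j⁆, map_sum, LinearMap.sum_apply]
      simp only [map_smul, LinearMap.smul_apply]
    rw [this, Pi.add_apply, Finset.sum_apply]
    rfl
  have e2 : ∑ j, ∑ k, b.repr ⁅τ, b j⁆ k • mulVar j (map (K (b k)) ρ) =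
      ∑ j, ∑ k, b.repr ⁅τ, b k⁆ j • mulVar k (map (K (b j)) ρ) := Finset.sum_comm
  simp only [cartanOp_apply, map_sub, map_sum, map_mulVar, coad_mulVar, ← map_coad, hρ', e0, e1,
    map_add, map_neg, map_smul, Finset.sum_add_distrib, Finset.sum_sub_distrib,
    Finset.sum_neg_distrib, e2]
  abel

end Equivariant

end Series

/-! Two-periodic complexes -/

section TwoPeriodic

variable {V V' : Type*} [AddCommGroup V] [Module ℝ V] [AddCommGroup V'] [Module ℝ V']

theorem graded_of_proj {P : ZMod 2 → Submodule ℝ V} {C : Submodule ℝ V}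
    (pr : ZMod 2 → V →ₗ[ℝ] V) (h : ∀ x, pr 0 x + pr 1 x = x) (hP : ∀ i x, pr i x ∈ P i)
    (hC : ∀ i, ∀ x ∈ C, pr i x ∈ C) : C = (C ⊓ P 0) ⊔ (C ⊓ P 1) := by
  refine le_antisymm (fun x hx => ?_) (sup_le inf_le_left inf_le_left)
  rw [← h x]
  exact Submodule.add_mem_sup ⟨hC 0 x hx, hP 0 x⟩ ⟨hC 1 x hx, hP 1 x⟩

/-- An isomorphism onto a complex that is compatible with parities and differentials. -/
theorem IsComplexIso.of_target {P : ZMod 2 → Submodule ℝ V} {C : Submodule ℝ V} {D : V →ₗ[ℝ] V}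
    {P' : ZMod 2 → Submodule ℝ V'} {C' : Submodule ℝ V'} {D' : V' →ₗ[ℝ] V'} {Φ : V →ₗ[ℝ] V'}
    (target : IsTwoPeriodicComplex P' C' D') (bijOn : Set.BijOn Φ C C')
    (parity : ∀ i, ∀ x ∈ C, x ∈ P i ↔ Φ x ∈ P' i) (comm : ∀ x ∈ C, Φ (D x) = D' (Φ x))
    (mem : ∀ x ∈ C, D x ∈ C) : IsComplexIso P C D P' C' D' Φ where
  source :=
    { graded := by
        refine le_antisymm (fun x hx => ?_) (sup_le inf_le_left inf_le_left)
        have h := bijOn.mapsTo hx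
        rw [SetLike.mem_coe, target.graded] at h
        obtain ⟨y₀, ⟨h₀, p₀⟩, y₁, ⟨h₁, p₁⟩, hy⟩ := Submodule.mem_sup.1 h
        obtain ⟨x₀, hx₀, rfl⟩ := bijOn.surjOn h₀
        obtain ⟨x₁, hx₁, rfl⟩ := bijOn.surjOn h₁
        rw [← map_add] at hy
        rw [← bijOn.injOn (C.add_mem hx₀ hx₁) hx hy]
        exact Submodule.add_mem_sup ⟨hx₀, (parity 0 x₀ hx₀).2 p₀⟩ ⟨hx₁, (parity 1 x₁ hx₁).2 p₁⟩
      odd := fun i x hx => by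
        refine ⟨mem x hx.1, (parity _ _ (mem x hx.1)).2 ?_⟩
        rw [comm x hx.1]
        exact (target.odd i (Φ x) ⟨bijOn.mapsTo hx.1, (parity i x hx.1).1 hx.2⟩).2
      square_zero := fun x hx => by
        refine bijOn.injOn (mem _ (mem x hx)) C.zero_mem ?_
        rw [comm _ (mem x hx), comm x hx, target.square_zero _ (bijOn.mapsTo hx), map_zero] }
  target := target
  bijOn := bijOn
  parity := parity
  comm := comm

namespace IsComplexIso

variable {P : ZMod 2 → Submodule ℝ V} {C : Submodule ℝ V} {D : V →ₗ[ℝ] V}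
  {P' : ZMod 2 → Submodule ℝ V'} {C' : Submodule ℝ V'} {D' : V' →ₗ[ℝ] V'} {Φ : V →ₗ[ℝ] V'}

theorem map_mem_cocycles (h : IsComplexIso P C D P' C' D' Φ) {i : ZMod 2} {x : V}
    (hx : x ∈ cocycles P C D i) : Φ x ∈ cocycles P' C' D' i := by
  refine ⟨⟨h.bijOn.mapsTo hx.1.1, (h.parity i x hx.1.1).1 hx.1.2⟩, ?_⟩
  have hD : D x = 0 := hx.2
  show D' (Φ x) = 0
  rw [← h.comm x hx.1.1, hD, map_zero]

/-- The isomorphism of cocycles. -/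
noncomputable def cocyclesEquiv (h : IsComplexIso P C D P' C' D' Φ) (i : ZMod 2) :
    cocycles P C D i ≃ₗ[ℝ] cocycles P' C' D' i :=
  LinearEquiv.ofBijective (Φ.restrict fun _ hx => h.map_mem_cocycles hx) (by
    refine ⟨fun x y hxy => ?_, fun y => ?_⟩
    · exact Subtype.ext (h.bijOn.injOn x.2.1.1 y.2.1.1 (congrArg Subtype.val hxy))
    · obtain ⟨x, hx, hxy⟩ := h.bijOn.surjOn y.2.1.1
      refine ⟨⟨x, ⟨hx, (h.parity i x hx).2 (hxy ▸ y.2.1.2)⟩, ?_⟩, Subtype.ext hxy⟩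
      have hy : D' y = 0 := y.2.2
      have hDx : D x ∈ C := by
        have h1 := h.source.odd i x ⟨hx, (h.parity i x hx).2 (hxy ▸ y.2.1.2)⟩
        exact h1.1
      refine h.bijOn.injOn hDx C.zero_mem ?_
      rw [h.comm x hx, hxy, hy, map_zero])

/-- An isomorphism of complexes induces an isomorphism in cohomology. -/
theorem exists_cohomology_equiv (h : IsComplexIso P C D P' C' D' Φ) (i : ZMod 2) :
    ∃ e : Cohomology P C D i ≃ₗ[ℝ] Cohomology P' C' D' i, IsInducedBy e Φ := by
  refine ⟨Submodule.Quotient.equiv _ _ (h.cocyclesEquiv i) ?_, fun z =>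
    ⟨h.map_mem_cocycles z.2, rfl⟩⟩
  ext y
  constructor
  · rintro ⟨x, ⟨z, ⟨hz, hzP⟩, hzx⟩, rfl⟩
    refine ⟨Φ z, ⟨h.bijOn.mapsTo hz, (h.parity _ z hz).1 hzP⟩, ?_⟩
    rw [← h.comm z hz, hzx]
    rfl
  · rintro ⟨w, ⟨hw, hwP⟩, hwy⟩
    obtain ⟨z, hz, rfl⟩ := h.bijOn.surjOn hw
    have hzP : z ∈ P (i + 1) := (h.parity _ z hz).2 hwP
    refine ⟨(h.cocyclesEquiv i).symm y, ⟨z, ⟨hz, hzP⟩, ?_⟩, (h.cocyclesEquiv i).apply_symm_apply y⟩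
    -- That `z` is a primitive of the preimage of `y` may be tested after applying `Φ`, which is
    -- injective on `C`.
    refine h.bijOn.injOn (h.source.odd _ z ⟨hz, hzP⟩).1 ((h.cocyclesEquiv i).symm y).2.1.1 ?_
    rw [h.comm z hz, hwy]
    exact (congrArg Subtype.val ((h.cocyclesEquiv i).apply_symm_apply y)).symm

end IsComplexIso

end TwoPeriodic

/-! ### Smooth sections and functions with prescribed values -/

section Sections

variable {n : ℕ} {M : Type*} [TopologicalSpace M] [ChartedSpace (EuclideanSpace ℝ (Fin n)) M]
  [IsManifold (𝓡 n) ∞ M] [T2Space M] {F : Type*} [NormedAddCommGroup F] [NormedSpace ℝ F]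
  {E : M → Type*} [TopologicalSpace (Bundle.TotalSpace F E)] [∀ x, AddCommGroup (E x)]
  [∀ x, Module ℝ (E x)] [∀ x, TopologicalSpace (E x)] [FiberBundle F E] [VectorBundle ℝ F E]

/-- Every vector in a smooth vector bundle is the value of a smooth section. -/
theorem exists_smoothSec_apply_eq [ContMDiffVectorBundle ∞ F E (𝓡 n)] {x : M} (e : E x) :
    ∃ 𝔛 : SmoothSec n F E, 𝔛 x = e := by
  -- A local extension of `e` is cut off by a bump function whose closed support lies in an open set
  -- on which the extension is smooth.
  obtain ⟨u, hu, hs⟩ := FiberBundle.exists_contMDiffOn_extend (k := ∞) (𝓡 n) F e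
  obtain ⟨u', hu', ho, hx⟩ := mem_nhds_iff.1 hu
  obtain ⟨f, hf, -⟩ := (SmoothBumpFunction.nhds_basis_support (I := 𝓡 n)
    (ho.mem_nhds hx)).mem_iff.1 (ho.mem_nhds hx)
  refine ⟨⟨fun y => f y • FiberBundle.extend F e y, ContMDiffOn.smul_section_of_tsupport
    f.contMDiff.contMDiffOn ho hf (hs.mono hu')⟩, ?_⟩
  show f x • FiberBundle.extend F e x = e
  rw [f.eq_one, one_smul, FiberBundle.extend_apply_self]

/-- Smooth functions separate tangent vectors. -/
theorem tangent_eq_zero_of_mvfderiv {x : M} {v : TangentSpace (𝓡 n) x}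
    (h : ∀ f : SmoothFn n M, mvfderiv (𝓡 n) f x v = 0) : v = 0 := by
  obtain ⟨φ⟩ : Nonempty (SmoothBumpFunction (𝓡 n) x) := inferInstance
  have hv : mfderiv (𝓡 n) 𝓘(ℝ, EuclideanSpace ℝ (Fin n)) (extChartAt (𝓡 n) x) x v = 0 := by
    have key : ∀ i, (show EuclideanSpace ℝ (Fin n) from
        mfderiv (𝓡 n) 𝓘(ℝ, EuclideanSpace ℝ (Fin n)) (extChartAt (𝓡 n) x) x v) i = 0 := by
      intro i
      let p : EuclideanSpace ℝ (Fin n) →L[ℝ] ℝ := EuclideanSpace.proj i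
      -- The test function is the `i`-th chart coordinate, cut off away from `x`. Its derivative
      -- along `v` is the `i`-th component of `v` in the chart, and the differential of the chart is
      -- injective.
      let f : SmoothFn n M := ⟨fun y => φ y • p (extChartAt (𝓡 n) x y),
        φ.contMDiff_smul (p.contMDiff.comp_contMDiffOn contMDiffOn_extChartAt)⟩
      have h1 : (f : M → ℝ) =ᶠ[nhds x] p ∘ extChartAt (𝓡 n) x := by
        filter_upwards [φ.eventuallyEq_one] with y hy
        show φ y • p (extChartAt (𝓡 n) x y) = p (extChartAt (𝓡 n) x y)
        rw [hy, Pi.one_apply, one_smul]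
      have h2 : mfderiv (𝓡 n) 𝓘(ℝ, ℝ) f x v = 0 := h f
      have h3 : MDifferentiableAt (𝓡 n) 𝓘(ℝ, EuclideanSpace ℝ (Fin n)) (extChartAt (𝓡 n) x) x :=
        mdifferentiableAt_extChartAt (mem_chart_source _ x)
      rw [h1.mfderiv_eq, mfderiv_comp x p.mdifferentiableAt h3] at h2
      rw [ContinuousLinearMap.mfderiv_eq] at h2
      exact h2
    exact (PiLp.ext key : (show EuclideanSpace ℝ (Fin n) from
      mfderiv (𝓡 n) 𝓘(ℝ, EuclideanSpace ℝ (Fin n)) (extChartAt (𝓡 n) x) x v) = 0)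
  have hinj := (isInvertible_mfderiv_extChartAt (I := 𝓡 n) (mem_extChartAt_source x)).injective
  exact hinj (hv.trans (map_zero _).symm)

theorem VecField.eq_of_lie_eq {X Y : VecField n M} (h : ∀ f : SmoothFn n M, ⁅X, f⁆ = ⁅Y, f⁆) :
    X = Y := by
  ext x
  rw [← sub_eq_zero]
  refine tangent_eq_zero_of_mvfderiv fun f => ?_
  rw [map_sub, sub_eq_zero]
  exact congrArg (fun g : SmoothFn n M => g x) (h f)

end Sections

/-! ### Evaluation of forms of low degree on explicit vectors -/

namespace AltForm

section Calculus

set_option linter.unusedSectionVars false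

variable {A L : Type*} [CommRing A] [Algebra ℝ A] [LieRing L] [LieAlgebra ℝ L] [Module A L]
  [LieRingModule L A] [LieRinehartRing A L] [LieRinehartAlgebra ℝ A L]

theorem lieDeriv_vecCons {k : ℕ} (X Y : L) (α : AltForm A L (k + 1)) (v : Fin k → L) :
    lieDeriv X α (Matrix.vecCons Y v) =
      lieDeriv X (α.curryLeft Y) v - α.curryLeft ⁅X, Y⁆ v :=
  congrArg (fun β : AltForm A L k => β v) (curryLeft_lieDeriv X Y α)

theorem extDer_vecCons {k : ℕ} (α : AltForm A L (k + 1)) (X : L) (v : Fin (k + 1) → L) :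
    extDer α (Matrix.vecCons X v) = lieDeriv X α v - extDer (α.curryLeft X) v :=
  koszul_cons α X v

theorem extDer_zero_apply (α : AltForm A L 0) (X : L) : extDer α ![X] = ⁅X, α ![]⁆ :=
  koszul_zero α ![X]

theorem extDer_curryLeft {k : ℕ} (X : L) (α : AltForm A L (k + 1)) :
    extDer (α.curryLeft X) = lieDeriv X α - (extDer α).curryLeft X := by
  ext v
  have h := extDer_vecCons α X v
  rw [eq_sub_iff_add_eq, add_comm] at h
  exact eq_sub_of_add_eq h

theorem ext_one {α β : AltForm A L 1} (h : ∀ X, α ![X] = β ![X]) : α = β :=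
  ext_curryLeft fun X => ext_zero (h X)

theorem ext_two {α β : AltForm A L 2} (h : ∀ X Y, α ![X, Y] = β ![X, Y]) : α = β :=
  ext_curryLeft fun X => ext_one (h X)

theorem ext_three {α β : AltForm A L 3} (h : ∀ X Y Z, α ![X, Y, Z] = β ![X, Y, Z]) : α = β :=
  ext_curryLeft fun X => ext_two (h X)

theorem ext_four {α β : AltForm A L 4} (h : ∀ X Y Z W, α ![X, Y, Z, W] = β ![X, Y, Z, W]) :
    α = β :=
  ext_curryLeft fun X => ext_three (h X)

end Calculus

end AltForm

/-! ### Consequences of the axioms of an exact Courant algebroid -/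

namespace ExactCourantAlgebroid

set_option linter.unusedSectionVars false

variable {n : ℕ} {M : Type*} [TopologicalSpace M] [ChartedSpace (EuclideanSpace ℝ (Fin n)) M]
  [IsManifold (𝓡 n) ∞ M] [T2Space M] {F : Type*} [NormedAddCommGroup F] [NormedSpace ℝ F]
  {E : M → Type*} [TopologicalSpace (Bundle.TotalSpace F E)] [∀ x, AddCommGroup (E x)]
  [∀ x, Module ℝ (E x)] [∀ x, TopologicalSpace (E x)] [FiberBundle F E] [VectorBundle ℝ F E]
  [ContMDiffVectorBundle ∞ F E (𝓡 n)] (C : ExactCourantAlgebroid n F E)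

theorem pair_comm (𝔛 𝔜 : SmoothSec n F E) : C.pair 𝔛 𝔜 = C.pair 𝔜 𝔛 := by
  ext x
  exact C.pairing_symm x _ _

theorem lie_pair (𝔛 𝔜 ℨ : SmoothSec n F E) :
    ⁅C.anchorField 𝔛, C.pair 𝔜 ℨ⁆ = C.pair (C.bracket 𝔛 𝔜) ℨ + C.pair 𝔜 (C.bracket 𝔛 ℨ) := by
  ext x
  exact C.anchor_pairing' 𝔛 𝔜 ℨ x

theorem lie_pair' (𝔛 𝔜 ℨ : SmoothSec n F E) :
    ⁅C.anchorField 𝔛, C.pair 𝔜 ℨ⁆ = C.pair 𝔛 (C.bracket 𝔜 ℨ) + C.pair 𝔛 (C.bracket ℨ 𝔜) := by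
  rw [← map_add]
  ext x
  exact C.anchor_pairing 𝔛 𝔜 ℨ x

/-- The pairing is nondegenerate in each fibre, and every vector of the fibre is the value of a
section. -/
theorem eq_of_pair_eq {𝔛 𝔜 : SmoothSec n F E} (h : ∀ ℨ, C.pair 𝔛 ℨ = C.pair 𝔜 ℨ) : 𝔛 = 𝔜 := by
  ext x
  rw [← sub_eq_zero]
  refine C.pairing_nondegenerate x _ fun e => ?_
  obtain ⟨ℨ, rfl⟩ := exists_smoothSec_apply_eq (n := n) (F := F) e
  rw [map_sub, LinearMap.sub_apply, sub_eq_zero]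
  exact congrArg (fun g : SmoothFn n M => g x) (h ℨ)

/-- The Leibniz rule follows from the invariance of the pairing: compute `a(𝔛)⟨f 𝔜, ℨ⟩` by
invariance and by the product rule for functions. -/
theorem bracket_smul (f : SmoothFn n M) (𝔛 𝔜 : SmoothSec n F E) :
    C.bracket 𝔛 (f • 𝔜) = f • C.bracket 𝔛 𝔜 + ⁅C.anchorField 𝔛, f⁆ • 𝔜 := by
  refine C.eq_of_pair_eq fun ℨ => ?_
  have h1 := C.lie_pair 𝔛 (f • 𝔜) ℨ
  have h2 := C.lie_pair 𝔛 𝔜 ℨ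
  simp only [map_add, map_smul, LinearMap.add_apply, LinearMap.smul_apply, smul_eq_mul] at h1 ⊢
  rw [LieRinehartRing.leibniz_mul_right, h2, smul_eq_mul] at h1
  linear_combination -h1

/-- Expanding the Jacobi identity for `𝔛`, `𝔜`, `f • ℨ` with the Leibniz rule leaves `(a(𝔛 * 𝔜) f -
[a(𝔛), a(𝔜)] f) • ℨ = 0`, and functions separate vector fields. -/
theorem anchorField_bracket (𝔛 𝔜 : SmoothSec n F E) :
    C.anchorField (C.bracket 𝔛 𝔜) = ⁅C.anchorField 𝔛, C.anchorField 𝔜⁆ := by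
  refine VecField.eq_of_lie_eq fun f => ?_
  have key : ∀ ℨ : SmoothSec n F E, (⁅C.anchorField (C.bracket 𝔛 𝔜), f⁆ -
      ⁅⁅C.anchorField 𝔛, C.anchorField 𝔜⁆, f⁆) • ℨ = 0 := by
    intro ℨ
    have h := C.jacobi 𝔛 𝔜 (f • ℨ)
    simp only [bracket_smul, map_add, C.jacobi 𝔛 𝔜 ℨ] at h
    have h' := leibniz_lie (C.anchorField 𝔛) (C.anchorField 𝔜) f
    rw [← sub_eq_iff_eq_add] at h'
    rw [← h', ← sub_eq_zero.2 h.symm]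
    module
  ext x
  by_contra hx
  -- Where the factor in front of `ℨ` is nonzero, the fibre of `E` must be zero. Then so is the
  -- tangent space, by surjectivity of the anchor, and the factor vanishes after all.
  have h0 : ∀ e : E x, e = 0 := by
    intro e
    obtain ⟨ℨ, rfl⟩ := exists_smoothSec_apply_eq (n := n) (F := F) e
    have := congrArg (fun 𝔚 : SmoothSec n F E => 𝔚 x) (key ℨ)
    exact (smul_eq_zero.1 this).resolve_left (sub_ne_zero.2 hx)
  have h1 : ∀ v : TangentSpace (𝓡 n) x, v = 0 := by
    intro v
    obtain ⟨e, rfl⟩ := C.anchor_surjective x v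
    rw [h0 e, map_zero]
  apply hx
  rw [VecField.lie_fn_apply, VecField.lie_fn_apply, h1 (C.anchorField (C.bracket 𝔛 𝔜) x),
    h1 (⁅C.anchorField 𝔛, C.anchorField 𝔜⁆ x)]

/-! ### The twisting form, the 1-form part and their dependence on the splitting -/

namespace IsotropicSplitting

variable {C} (s s' s'' : C.IsotropicSplitting)

theorem anchorField_sec (X : VecField n M) : C.anchorField (s.sec X) = X := by
  ext x
  exact s.anchor_toFun x (X x)

theorem pair_sec_sec (X Y : VecField n M) : C.pair (s.sec X) (s.sec Y) = 0 := by
  ext x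
  exact s.isotropic x _ _

/-- By exactness a vector in the kernel of the anchor is `a^* ξ`, and `2⟨a^* ξ, e⟩ = ξ(a(e))`: the
kernel is isotropic. -/
theorem pair_eq_zero_of_anchorField {𝔛 𝔜 : SmoothSec n F E} (h𝔛 : C.anchorField 𝔛 = 0)
    (h𝔜 : C.anchorField 𝔜 = 0) : C.pair 𝔛 𝔜 = 0 := by
  ext x
  have h1 : C.anchor x (𝔛 x) = 0 := congrArg (fun Z : VecField n M => Z x) h𝔛
  have h2 : C.anchor x (𝔜 x) = 0 := congrArg (fun Z : VecField n M => Z x) h𝔜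
  obtain ⟨ξ, hξ⟩ := (C.anchor_ker x _).1 h1
  have h3 := hξ (𝔜 x)
  rw [h2, map_zero] at h3
  show C.pairing x (𝔛 x) (𝔜 x) = 0
  linarith

/-- The 1-form parts `𝔛 - s(X)` and `𝔜 - s(Y)` pair to zero, and so do `s(X)` and `s(Y)`. -/
theorem pair_eq (𝔛 𝔜 : SmoothSec n F E) : C.pair 𝔛 𝔜 =
    C.pair 𝔛 (s.sec (C.anchorField 𝔜)) + C.pair (s.sec (C.anchorField 𝔛)) 𝔜 := by
  have h1 : ∀ ℨ : SmoothSec n F E, C.anchorField (ℨ - s.sec (C.anchorField ℨ)) = 0 := fun ℨ => by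
    rw [map_sub, anchorField_sec, sub_self]
  have h2 := pair_eq_zero_of_anchorField (h1 𝔛) (h1 𝔜)
  simp only [map_sub, LinearMap.sub_apply, pair_sec_sec] at h2
  linear_combination h2

theorem pair_of_anchorField {𝔛 : SmoothSec n F E} (h : C.anchorField 𝔛 = 0)
    (𝔜 : SmoothSec n F E) : C.pair 𝔛 𝔜 = C.pair 𝔛 (s.sec (C.anchorField 𝔜)) := by
  rw [s.pair_eq 𝔛 𝔜, h, map_zero, map_zero, LinearMap.zero_apply, add_zero]

theorem oneForm_vec (𝔛 : SmoothSec n F E) (Y : VecField n M) :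
    s.oneForm 𝔛 ![Y] = (2 : ℝ) • C.pair 𝔛 (s.sec Y) := rfl

theorem diff_vec (X Y : VecField n M) :
    s.diff s' ![X, Y] = (2 : ℝ) • C.pair (s'.sec X) (s.sec Y) := rfl

theorem twist_vec_eq_triple (X Y Z : VecField n M) : s.twist ![X, Y, Z] = s.triple X Y Z := rfl

theorem triple_eq (X Y Z : VecField n M) :
    s.triple X Y Z = 2 * C.pair (s.sec X) (C.bracket (s.sec Y) (s.sec Z)) := by
  rw [triple, two_smul, two_mul]

theorem two_pair_bracket_bracket (X Y Z W : VecField n M) :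
    2 * C.pair (C.bracket (s.sec X) (s.sec Y)) (C.bracket (s.sec Z) (s.sec W)) =
      s.triple ⁅Z, W⁆ X Y + s.triple ⁅X, Y⁆ Z W := by
  rw [s.pair_eq, anchorField_bracket, anchorField_bracket, pair_comm C _ (s.sec ⁅_, _⁆)]
  simp only [anchorField_sec, triple_eq]
  ring

theorem lie_two_mul (X : VecField n M) (f : SmoothFn n M) : ⁅X, 2 * f⁆ = 2 * ⁅X, f⁆ := by
  rw [two_mul, lie_add, two_mul]

/-- The twisting form is closed. -/
theorem extDer_twist : AltForm.extDer s.twist = 0 := by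
  refine AltForm.ext_four fun X Y Z W => ?_
  simp only [AltForm.extDer_vecCons, AltForm.extDer_zero_apply, AltForm.lieDeriv_vecCons,
    AltForm.lieDeriv_zero_apply, AlternatingMap.curryLeft_apply_apply, twist_vec_eq_triple,
    AlternatingMap.zero_apply]
  -- After the Jacobi identity, all pairings of `s(Y)` with iterated brackets cancel in `e1 - e2 -
  -- e3 + e4`. What remains are pairings of two brackets, which `p1`, `p2`, `p3` express by `H` with
  -- a commutator inserted.
  have e1 := C.lie_pair (s.sec X) (s.sec Y) (C.bracket (s.sec Z) (s.sec W))
  have e2 := C.lie_pair (s.sec Z) (s.sec Y) (C.bracket (s.sec X) (s.sec W))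
  have e3 := C.lie_pair' (s.sec Y) (C.bracket (s.sec X) (s.sec Z)) (s.sec W)
  have e4 := C.lie_pair (s.sec W) (s.sec Y) (C.bracket (s.sec X) (s.sec Z))
  rw [C.jacobi, map_add] at e1
  rw [pair_comm C (C.bracket _ _) (s.sec W)] at e3
  simp only [anchorField_sec] at e1 e2 e3 e4
  have p1 := s.two_pair_bracket_bracket X Y Z W
  have p2 := s.two_pair_bracket_bracket Z Y X W
  have p3 := s.two_pair_bracket_bracket W Y X Z
  rw [← lie_skew Z Y, ← neg_one_smul (SmoothFn n M), triple_smul] at p2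
  rw [← lie_skew W Y, ← neg_one_smul (SmoothFn n M), triple_smul] at p3
  rw [smul_eq_mul] at p2 p3
  have q1 : ⁅Y, s.triple X Z W⁆ = 2 * ⁅Y, C.pair (s.sec W) (C.bracket (s.sec X) (s.sec Z))⁆ := by
    rw [← lie_two_mul, ← triple_eq, s.triple_cycle W]
  have q2 : ⁅Z, s.triple X Y W⁆ = - (2 * ⁅Z, C.pair (s.sec Y) (C.bracket (s.sec X) (s.sec W))⁆) := by
    rw [← lie_two_mul, ← triple_eq, ← lie_neg, s.triple_cycle Y, ← s.triple_swap_right]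
  have q3 : ⁅W, s.triple X Y Z⁆ = - (2 * ⁅W, C.pair (s.sec Y) (C.bracket (s.sec X) (s.sec Z))⁆) := by
    rw [← lie_two_mul, ← triple_eq, ← lie_neg, s.triple_cycle X, s.triple_swap_right Y]
  have q0 : ⁅X, s.triple Y Z W⁆ = 2 * ⁅X, C.pair (s.sec Y) (C.bracket (s.sec Z) (s.sec W))⁆ := by
    rw [← lie_two_mul, ← triple_eq]
  rw [q0, q1, q2, q3, ← s.triple_cycle ⁅X, W⁆ Y Z, s.triple_cycle Y ⁅X, Z⁆ W,
    ← s.triple_cycle ⁅Y, W⁆ X Z, s.triple_cycle X ⁅Y, Z⁆ W, ← s.triple_cycle ⁅Z, W⁆ X Y,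
    s.triple_swap_right ⁅Y, Z⁆ W X]
  rw [s.triple_swap_right ⁅X, W⁆ Z Y] at p2
  linear_combination 2 * e1 - 2 * e2 - 2 * e3 + 2 * e4 + p1 - p2 + p3

/-- The difference of two splittings, applied to a vector field. -/
theorem anchorField_sec_sub (X : VecField n M) : C.anchorField (s'.sec X - s.sec X) = 0 := by
  rw [map_sub, anchorField_sec, anchorField_sec, sub_self]

theorem diff_eq (X Y : VecField n M) : s.diff s' ![X, Y] = 2 * C.pair (s'.sec X) (s.sec Y) := by
  rw [diff_vec, two_smul, two_mul]

/-- The difference `s'(X) - s(X)` lies in the kernel of the anchor, so it pairs with `𝔜` through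
`a(𝔜)` only. This identifies it with `a^*(ι_X B)`. -/
theorem two_pair_sec_sub (X : VecField n M) (𝔜 : SmoothSec n F E) :
    2 * C.pair (s'.sec X - s.sec X) 𝔜 = s.diff s' ![X, C.anchorField 𝔜] := by
  rw [s.pair_of_anchorField (s.anchorField_sec_sub s' X), diff_eq, map_sub, LinearMap.sub_apply,
    pair_sec_sec, sub_zero]

/-- In `⟨𝔛 * 𝔜, ℨ⟩ = a(𝔛)⟨𝔜, ℨ⟩ - ⟨𝔜, 𝔛 * ℨ⟩` the first term vanishes, and so does the second,
because `𝔛 * ℨ` is again in the kernel of the anchor. -/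
theorem bracket_eq_zero_of_anchorField {𝔛 𝔜 : SmoothSec n F E} (h𝔛 : C.anchorField 𝔛 = 0)
    (h𝔜 : C.anchorField 𝔜 = 0) : C.bracket 𝔛 𝔜 = 0 := by
  refine C.eq_of_pair_eq fun ℨ => ?_
  have h := C.lie_pair 𝔛 𝔜 ℨ
  have h0 : C.anchorField (C.bracket 𝔛 ℨ) = 0 := by rw [anchorField_bracket, h𝔛, zero_lie]
  rw [h𝔛, zero_lie, pair_eq_zero_of_anchorField h𝔜 h0, add_zero] at h
  rw [← h, map_zero, LinearMap.zero_apply]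

theorem diff_swap (X Y : VecField n M) : s.diff s' ![X, Y] = - s.diff s' ![Y, X] := by
  have h : ![X, Y] = ![Y, X] ∘ Equiv.swap (0 : Fin 2) 1 := by
    funext i
    fin_cases i <;> simp
  rw [h, AlternatingMap.map_swap _ _ (by decide)]

theorem diff_neg_right (X Y : VecField n M) : s.diff s' ![X, -Y] = - s.diff s' ![X, Y] := by
  rw [diff_vec, diff_vec, map_neg, map_neg, smul_neg]

/-- Write `s' = s + β` with `β(X) = a^*(ι_X B)` and expand. The terms linear in `β` add up to `dB`;
those of higher order vanish, because `β` takes values in the kernel of the anchor. -/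
theorem twist_eq_add : s'.twist = s.twist + AltForm.extDer (s.diff s') := by
  refine AltForm.ext_three fun X Y Z => ?_
  simp only [AltForm.extDer_vecCons, AltForm.extDer_zero_apply, AltForm.lieDeriv_vecCons,
    AltForm.lieDeriv_zero_apply, AlternatingMap.curryLeft_apply_apply, twist_vec_eq_triple,
    AlternatingMap.add_apply]
  obtain ⟨β, hβ⟩ : ∃ β : VecField n M → SmoothSec n F E, ∀ X, β X = s'.sec X - s.sec X :=
    ⟨_, fun _ => rfl⟩
  have ha : ∀ X, C.anchorField (β X) = 0 := fun X => by rw [hβ, anchorField_sec_sub]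
  have hp : ∀ X 𝔜, 2 * C.pair (β X) 𝔜 = s.diff s' ![X, C.anchorField 𝔜] := fun X 𝔜 => by
    rw [hβ, two_pair_sec_sub]
  have hs : ∀ X, s'.sec X = s.sec X + β X := fun X => by rw [hβ]; abel
  have hp' : ∀ X 𝔜, 2 * C.pair 𝔜 (β X) = s.diff s' ![X, C.anchorField 𝔜] := fun X 𝔜 => by
    rw [pair_comm, hp]
  have h0 : ∀ X, s.diff s' ![X, 0] = 0 := fun X => by
    rw [diff_vec, map_zero, map_zero, smul_zero]
  -- `e1`, `e2`, `e3` turn derivatives of `B` into the linear terms of the expansion; the pairing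
  -- with `s(Z) * β(Y)` occurs in `e2` and `e3` and drops out. The terms with two factors `β` vanish
  -- by `e5` and `e6`.
  have e1 : ⁅Y, s.diff s' ![Z, X]⁆ =
      s.diff s' ![Z, ⁅Y, X⁆] + 2 * C.pair (s.sec X) (C.bracket (s.sec Y) (β Z)) := by
    have h := C.lie_pair (s.sec Y) (s.sec X) (β Z)
    have h1 := hp' Z (s.sec X)
    have h2 := hp' Z (C.bracket (s.sec Y) (s.sec X))
    rw [anchorField_bracket, anchorField_sec, anchorField_sec] at h2
    rw [anchorField_sec] at h h1
    rw [← h1, ← h2, lie_two_mul, h]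
    ring
  have e2 : ⁅X, s.diff s' ![Y, Z]⁆ = 2 * C.pair (s.sec X) (C.bracket (β Y) (s.sec Z)) +
      2 * C.pair (s.sec X) (C.bracket (s.sec Z) (β Y)) := by
    have h := C.lie_pair' (s.sec X) (β Y) (s.sec Z)
    have h1 := hp Y (s.sec Z)
    rw [anchorField_sec] at h h1
    rw [← h1, lie_two_mul, h]
    ring
  have e3 : ⁅Z, s.diff s' ![Y, X]⁆ =
      s.diff s' ![Y, ⁅Z, X⁆] + 2 * C.pair (s.sec X) (C.bracket (s.sec Z) (β Y)) := by
    have h := C.lie_pair (s.sec Z) (s.sec X) (β Y)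
    have h1 := hp' Y (s.sec X)
    have h2 := hp' Y (C.bracket (s.sec Z) (s.sec X))
    rw [anchorField_bracket, anchorField_sec, anchorField_sec] at h2
    rw [anchorField_sec] at h h1
    rw [← h1, ← h2, lie_two_mul, h]
    ring
  have e4 := hp X (C.bracket (s.sec Y) (s.sec Z))
  have e5 := hp X (C.bracket (s.sec Y) (β Z))
  have e6 := hp X (C.bracket (β Y) (s.sec Z))
  rw [anchorField_bracket, anchorField_sec, anchorField_sec] at e4
  rw [anchorField_bracket, ha, lie_zero, h0] at e5
  rw [anchorField_bracket, ha, zero_lie, h0] at e6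
  have e7 : s.diff s' ![Z, ⁅Y, X⁆] = s.diff s' ![⁅X, Y⁆, Z] := by
    rw [← lie_skew Y X, diff_neg_right, s.diff_swap s' Z, neg_neg]
  have e8 : s.diff s' ![Y, ⁅Z, X⁆] = - s.diff s' ![Y, ⁅X, Z⁆] := by
    rw [← lie_skew Z X, diff_neg_right]
  rw [s.diff_swap s' Z X, lie_neg] at e1
  rw [s.diff_swap s' Y, lie_neg] at e3
  simp only [triple_eq, hs, map_add, LinearMap.add_apply,
    bracket_eq_zero_of_anchorField (ha Y) (ha Z), map_zero]
  linear_combination e4 + e5 + e6 - e1 - e2 + e3 - e7 + e8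

/-- The section stays the same and only its horizontal part moves: `s(X) + ξ = s'(X) + (ξ - ι_X B)`.
-/
theorem oneForm_eq_sub (𝔛 : SmoothSec n F E) :
    s'.oneForm 𝔛 = s.oneForm 𝔛 - (s.diff s').curryLeft (C.anchorField 𝔛) := by
  refine AltForm.ext_one fun Y => ?_
  have h := s.two_pair_sec_sub s' Y 𝔛
  rw [diff_swap, pair_comm, map_sub, mul_sub] at h
  rw [AlternatingMap.sub_apply, AlternatingMap.curryLeft_apply_apply, oneForm_vec, oneForm_vec,
    two_smul, two_smul]
  linear_combination h

/-- The changes `- d ι_X B` of `dξ` and `- ι_X dB` of `- ι_X H` combine to `- L_X B` by Cartan's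
formula. -/
theorem kappaForm_eq_sub (𝔛 : SmoothSec n F E) :
    s'.kappaForm 𝔛 = s.kappaForm 𝔛 - AltForm.lieDeriv (C.anchorField 𝔛) (s.diff s') := by
  rw [kappaForm, kappaForm, s.oneForm_eq_sub s', s.twist_eq_add s', map_sub,
    AltForm.extDer_curryLeft, AlternatingMap.curryLeft_add, LinearMap.add_apply]
  abel

theorem diff_self : s.diff s = 0 :=
  AltForm.ext_two fun X Y => by rw [diff_vec, pair_sec_sec, smul_zero]; rfl

/-- The cocycle rule: `s''(X) - s'(X)` and `s'(Y) - s(Y)` both lie in the isotropic kernel of the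
anchor, so their pairing vanishes. -/
theorem diff_add_diff : s.diff s'' = s.diff s' + s'.diff s'' := by
  refine AltForm.ext_two fun X Y => ?_
  have h := pair_eq_zero_of_anchorField (s'.anchorField_sec_sub s'' X) (s.anchorField_sec_sub s' Y)
  simp only [map_sub, LinearMap.sub_apply, pair_sec_sec] at h
  rw [AlternatingMap.add_apply, diff_eq, diff_eq, diff_eq]
  linear_combination -2 * h

/-- By `pair_eq`, `2⟨𝔛, 𝔜⟩ = ξ(Y) + η(X)` for `𝔛 = s(X) + ξ` and `𝔜 = s(Y) + η`. -/
theorem oneForm_add_of_pair_eq_zero {𝔛 𝔜 : SmoothSec n F E} (h : C.pair 𝔛 𝔜 = 0) :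
    s.oneForm 𝔛 ![C.anchorField 𝔜] = - s.oneForm 𝔜 ![C.anchorField 𝔛] := by
  rw [s.pair_eq, pair_comm C (s.sec _) 𝔜] at h
  rw [oneForm_vec, oneForm_vec, eq_neg_of_add_eq_zero_left h, smul_neg]

/-- The `1`-form part of the bracket. -/
theorem oneForm_bracket (𝔛 𝔜 : SmoothSec n F E) :
    s.oneForm (C.bracket 𝔛 𝔜) = AltForm.lieDeriv (C.anchorField 𝔛) (s.oneForm 𝔜) -
      (s.kappaForm 𝔛).curryLeft (C.anchorField 𝔜) := by
  refine AltForm.ext_one fun Z => ?_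
  obtain ⟨X, hX⟩ : ∃ X, X = C.anchorField 𝔛 := ⟨_, rfl⟩
  obtain ⟨Y, hY⟩ : ∃ Y, Y = C.anchorField 𝔜 := ⟨_, rfl⟩
  obtain ⟨ξ, hξ⟩ : ∃ ξ, ξ = 𝔛 - s.sec X := ⟨_, rfl⟩
  have hξ0 : C.anchorField ξ = 0 := by rw [hξ, map_sub, anchorField_sec, hX, sub_self]
  have hη0 : C.anchorField (𝔜 - s.sec Y) = 0 := by rw [map_sub, anchorField_sec, hY, sub_self]
  have h𝔛 : 𝔛 = s.sec X + ξ := by rw [hξ]; abel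
  have hξp : ∀ W : VecField n M, C.pair ξ (s.sec W) = C.pair 𝔛 (s.sec W) := fun W => by
    rw [hξ, map_sub, LinearMap.sub_apply, pair_sec_sec, sub_zero]
  have e1 := C.lie_pair 𝔛 𝔜 (s.sec Z)
  -- The 1-form part of `𝔜` sees only the anchor `[X, Z]` of the bracket; the horizontal part `s(Y)`
  -- gives a value of `H` and the term with `ξ * s(Z)`.
  have e2 : C.pair 𝔜 (C.bracket 𝔛 (s.sec Z)) = C.pair 𝔜 (s.sec ⁅X, Z⁆) +
      C.pair (s.sec Y) (C.bracket (s.sec X) (s.sec Z)) +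
      C.pair (s.sec Y) (C.bracket ξ (s.sec Z)) := by
    have h := s.pair_of_anchorField hη0 (C.bracket 𝔛 (s.sec Z))
    rw [anchorField_bracket, anchorField_sec, ← hX] at h
    simp only [map_sub, LinearMap.sub_apply, pair_sec_sec] at h
    have h2 : C.bracket 𝔛 (s.sec Z) = C.bracket (s.sec X) (s.sec Z) + C.bracket ξ (s.sec Z) := by
      conv_lhs => rw [h𝔛, map_add, LinearMap.add_apply]
    rw [add_assoc, ← map_add (C.pair (s.sec Y)), ← h2]
    linear_combination h
  -- `e3 - e4` eliminates `s(Z) * ξ` and expresses `⟨s(Y), ξ * s(Z)⟩` by derivatives of `ξ`, the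
  -- source of `dξ` in the result.
  have e3 := C.lie_pair' (s.sec Y) ξ (s.sec Z)
  have e4 := C.lie_pair (s.sec Z) (s.sec Y) ξ
  have e5 := s.pair_of_anchorField hξ0 (C.bracket (s.sec Z) (s.sec Y))
  rw [anchorField_bracket, anchorField_sec, anchorField_sec] at e5
  rw [pair_comm C (s.sec Y) ξ, pair_comm C (C.bracket _ _) ξ, e5] at e4
  simp only [anchorField_sec, hξp, ← hX] at e1 e3 e4
  have e6 : C.pair 𝔛 (s.sec ⁅Z, Y⁆) = - C.pair 𝔛 (s.sec ⁅Y, Z⁆) := by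
    rw [← lie_skew Z Y, map_neg, map_neg]
  have e7 := s.triple_eq Y X Z
  rw [s.triple_cycle Y, s.triple_swap_right] at e7
  simp only [kappaForm, ← hX, ← hY, AlternatingMap.sub_apply,
    AlternatingMap.curryLeft_apply_apply, AltForm.extDer_vecCons,
    AltForm.extDer_zero_apply, AltForm.lieDeriv_vecCons, AltForm.lieDeriv_zero_apply,
    twist_vec_eq_triple, oneForm_vec, two_smul, lie_add]
  linear_combination -2 * e1 - 2 * e2 + 2 * e3 - 2 * e4 - 2 * e6 + e7

end IsotropicSplitting

end ExactCourantAlgebroid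

/-! ### Series with coefficients in a subspace, and products of series of forms -/

namespace Series

variable {r : ℕ} {V W : Type*} [AddCommGroup V] [Module ℝ V] [AddCommGroup W] [Module ℝ W]

theorem map_mem_coeffsIn {p : Submodule ℝ V} {q : Submodule ℝ W} {f : V →ₗ[ℝ] W}
    (hf : ∀ v ∈ p, f v ∈ q) {ρ : Series r V} (hρ : ρ ∈ coeffsIn p) : map f ρ ∈ coeffsIn q :=
  fun m _ => hf _ (hρ m trivial)

theorem mulVar_mem_coeffsIn {p : Submodule ℝ V} (j : Fin r) {ρ : Series r V}
    (hρ : ρ ∈ coeffsIn p) : mulVar j ρ ∈ coeffsIn p := by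
  intro m _
  rw [mulVar_apply]
  split_ifs
  · exact p.zero_mem
  · exact hρ _ trivial

theorem partialDeriv_mem_coeffsIn {p : Submodule ℝ V} (j : Fin r) {ρ : Series r V}
    (hρ : ρ ∈ coeffsIn p) : partialDeriv j ρ ∈ coeffsIn p :=
  fun _ _ => p.smul_mem _ (hρ _ trivial)

theorem cartanOp_mem_coeffsIn {p q : Submodule ℝ V} {D₀ : V →ₗ[ℝ] V} {K : Fin r → V →ₗ[ℝ] V}
    (hD : ∀ v ∈ p, D₀ v ∈ q) (hK : ∀ j, ∀ v ∈ p, K j v ∈ q) {ρ : Series r V}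
    (hρ : ρ ∈ coeffsIn p) : cartanOp D₀ K ρ ∈ coeffsIn q := by
  rw [cartanOp_apply]
  exact Submodule.sub_mem _ (map_mem_coeffsIn hD hρ)
    (Submodule.sum_mem _ fun j _ => mulVar_mem_coeffsIn j (map_mem_coeffsIn (hK j) hρ))

theorem map_cartanOp {D₀ : V →ₗ[ℝ] V} {K : Fin r → V →ₗ[ℝ] V} {D₀' : W →ₗ[ℝ] W}
    {K' : Fin r → W →ₗ[ℝ] W} {f : V →ₗ[ℝ] W} (hD : ∀ v, f (D₀ v) = D₀' (f v))
    (hK : ∀ j v, f (K j v) = K' j (f v)) (ρ : Series r V) :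
    map f (cartanOp D₀ K ρ) = cartanOp D₀' K' (map f ρ) := by
  have e0 : map f (map D₀ ρ) = map D₀' (map f ρ) := funext fun m => hD (ρ m)
  have e1 : ∀ j, map f (map (K j) ρ) = map (K' j) (map f ρ) := fun j =>
    funext fun m => hK j (ρ m)
  simp only [cartanOp_apply, map_sub, map_sum, map_mulVar, e0, e1]

section Equivariant

variable {𝔤 : Type*} [LieRing 𝔤] [LieAlgebra ℝ 𝔤] (b : Module.Basis (Fin r) ℝ 𝔤)

theorem coad_mem_coeffsIn {p : Submodule ℝ V} (τ : 𝔤) {ρ : Series r V}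
    (hρ : ρ ∈ coeffsIn p) : coad b τ ρ ∈ coeffsIn p := by
  rw [coad_apply]
  exact Submodule.neg_mem _ (Submodule.sum_mem _ fun j _ => Submodule.sum_mem _ fun k _ =>
    Submodule.smul_mem _ _ (mulVar_mem_coeffsIn k (partialDeriv_mem_coeffsIn j hρ)))

/-- If a linear map `f` is injective on a subspace `p` and intertwines the operators, then a series
with coefficients in `p` is annihilated exactly if its image is. -/
theorem mem_annihilated_iff_map {p : Submodule ℝ V} {f : V →ₗ[ℝ] W} (hf : ∀ v ∈ p, f v = 0 → v = 0)
    {θ : 𝔤 → V →ₗ[ℝ] V} {θ' : 𝔤 → W →ₗ[ℝ] W} (hθ : ∀ τ, ∀ v ∈ p, θ τ v ∈ p)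
    (h : ∀ τ v, f (θ τ v) = θ' τ (f v)) {ρ : Series r V} (hρ : ρ ∈ coeffsIn p) :
    ρ ∈ annihilated b θ ↔ map f ρ ∈ annihilated b θ' := by
  have e : ∑ j, mulVar j (map (θ' (b j)) (map f ρ)) = map f (∑ j, mulVar j (map (θ (b j)) ρ)) := by
    rw [map_sum]
    refine Finset.sum_congr rfl fun j _ => ?_
    rw [map_mulVar]
    exact congrArg _ (funext fun m => (h (b j) (ρ m)).symm)
  rw [mem_annihilated, mem_annihilated, e]
  refine ⟨fun h0 => by rw [h0, map_zero], fun h0 => funext fun m => hf _ ?_ (congrFun h0 m)⟩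
  exact (Submodule.sum_mem (coeffsIn p) fun j _ =>
    mulVar_mem_coeffsIn j (map_mem_coeffsIn (hθ (b j)) hρ)) m trivial

theorem mem_invariants_iff_map {p : Submodule ℝ V} {f : V →ₗ[ℝ] W} (hf : ∀ v ∈ p, f v = 0 → v = 0)
    {θ : 𝔤 → V →ₗ[ℝ] V} {θ' : 𝔤 → W →ₗ[ℝ] W} (hθ : ∀ τ, ∀ v ∈ p, θ τ v ∈ p)
    (h : ∀ τ v, f (θ τ v) = θ' τ (f v)) {ρ : Series r V} (hρ : ρ ∈ coeffsIn p) :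
    ρ ∈ invariants b θ ↔ map f ρ ∈ invariants b θ' := by
  rw [mem_invariants, mem_invariants]
  refine forall_congr' fun τ => ?_
  have e : map (θ' τ) (map f ρ) + coad b τ (map f ρ) = map f (map (θ τ) ρ + coad b τ ρ) := by
    rw [map_add, map_coad]
    exact congrArg (· + _) (funext fun m => (h τ (ρ m)).symm)
  rw [e]
  refine ⟨fun h0 => by rw [h0, map_zero], fun h0 => funext fun m => hf _ ?_ (congrFun h0 m)⟩
  exact (Submodule.add_mem (coeffsIn p) (map_mem_coeffsIn (hθ τ) hρ)
    (coad_mem_coeffsIn b τ hρ)) m trivial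

theorem map_mem_annihilated {f : V →ₗ[ℝ] V} {θ : 𝔤 → V →ₗ[ℝ] V} (h : ∀ τ v, f (θ τ v) = θ τ (f v))
    {ρ : Series r V} (hρ : ρ ∈ annihilated b θ) : map f ρ ∈ annihilated b θ := by
  rw [mem_annihilated] at hρ ⊢
  rw [← map_zero (map f), ← hρ, map_sum]
  refine Finset.sum_congr rfl fun j _ => ?_
  rw [map_mulVar]
  exact congrArg _ (funext fun m => (h (b j) (ρ m)).symm)

theorem map_mem_invariants {f : V →ₗ[ℝ] V} {θ : 𝔤 → V →ₗ[ℝ] V} (h : ∀ τ v, f (θ τ v) = θ τ (f v))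
    {ρ : Series r V} (hρ : ρ ∈ invariants b θ) : map f ρ ∈ invariants b θ := by
  rw [mem_invariants] at hρ ⊢
  intro τ
  rw [← map_zero (map f), ← hρ τ, map_add, map_coad]
  exact congrArg (· + _) (funext fun m => (h τ (ρ m)).symm)

end Equivariant

section Wedge

variable {A L : Type*} [CommRing A] [Algebra ℝ A] [LieRing L] [LieAlgebra ℝ L] [Module A L]
  [LieRingModule L A] [LieRinehartRing A L] [LieRinehartAlgebra ℝ A L]

theorem wedge_apply (α ρ : Series r (Forms A L)) (m : Fin r →₀ ℕ) :
    wedge α ρ m = ∑ x ∈ Finset.HasAntidiagonal.antidiagonal m, Forms.wedge (α x.1) (ρ x.2) := by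
  simp [wedge]

theorem wedge_add (α β ρ : Series r (Forms A L)) :
    wedge (α + β) ρ = wedge α ρ + wedge β ρ := by
  funext m
  simp only [wedge_apply, Pi.add_apply, map_add, LinearMap.add_apply, Finset.sum_add_distrib]

theorem wedge_sum {ι : Type*} (s : Finset ι) (α : ι → Series r (Forms A L))
    (ρ : Series r (Forms A L)) : wedge (∑ i ∈ s, α i) ρ = ∑ i ∈ s, wedge (α i) ρ := by
  classical
  induction s using Finset.induction_on with
  | empty =>
    funext m
    simp [wedge_apply]
  | insert i s hi ih => rw [Finset.sum_insert hi, Finset.sum_insert hi, wedge_add, ih]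

theorem wedge_single_zero (φ : Forms A L) (ρ : Series r (Forms A L)) :
    wedge (single 0 φ) ρ = map (Forms.wedge φ) ρ := by
  funext m
  rw [wedge_apply, Finset.sum_eq_single (0, m)]
  · rw [single, Pi.single_eq_same]
    rfl
  · intro x hx hne
    have hx' := Finset.HasAntidiagonal.mem_antidiagonal.1 hx
    have h1 : x.1 ≠ 0 := by
      intro h
      rw [h, zero_add] at hx'
      exact hne (Prod.ext h hx')
    rw [single, Pi.single_eq_of_ne h1, map_zero, LinearMap.zero_apply]
  · intro h
    exact absurd (Finset.HasAntidiagonal.mem_antidiagonal.2 (zero_add m)) h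

/-- In the Cauchy product only one splitting of the monomial `u^m` contributes, `u_j` times the
rest, and it exists exactly if `u_j` divides `u^m`. -/
theorem wedge_single_one (j : Fin r) (φ : Forms A L) (ρ : Series r (Forms A L)) :
    wedge (single (Finsupp.single j 1) φ) ρ = mulVar j (map (Forms.wedge φ) ρ) := by
  funext m
  rw [wedge_apply, mulVar_apply]
  split_ifs with hm
  · refine Finset.sum_eq_zero fun x hx => ?_
    have hx' := Finset.HasAntidiagonal.mem_antidiagonal.1 hx
    have h1 : x.1 ≠ Finsupp.single j 1 := by
      intro h
      have := DFunLike.congr_fun hx' j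
      simp [h, hm] at this
    rw [single, Pi.single_eq_of_ne h1, map_zero, LinearMap.zero_apply]
  · have hle : Finsupp.single j 1 ≤ m := by simpa using Nat.one_le_iff_ne_zero.2 hm
    rw [Finset.sum_eq_single (Finsupp.single j 1, m - Finsupp.single j 1)]
    · rw [single, Pi.single_eq_same]
      rfl
    · intro x hx hne
      have hx' := Finset.HasAntidiagonal.mem_antidiagonal.1 hx
      have h1 : x.1 ≠ Finsupp.single j 1 := by
        intro h
        refine hne (Prod.ext h ?_)
        rw [← hx', h, add_tsub_cancel_left]
      rw [single, Pi.single_eq_of_ne h1, map_zero, LinearMap.zero_apply]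
    · intro h
      exact absurd (Finset.HasAntidiagonal.mem_antidiagonal.2 (add_tsub_cancel_of_le hle)) h

end Wedge

end Series

namespace ExactCourantAlgebroid

set_option linter.unusedSectionVars false

variable {n : ℕ} {M : Type*} [TopologicalSpace M] [ChartedSpace (EuclideanSpace ℝ (Fin n)) M]
  [IsManifold (𝓡 n) ∞ M] [T2Space M] {F : Type*} [NormedAddCommGroup F] [NormedSpace ℝ F]
  {E : M → Type*} [TopologicalSpace (Bundle.TotalSpace F E)] [∀ x, AddCommGroup (E x)]
  [∀ x, Module ℝ (E x)] [∀ x, TopologicalSpace (E x)] [FiberBundle F E] [VectorBundle ℝ F E]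
  [ContMDiffVectorBundle ∞ F E (𝓡 n)] (C : ExactCourantAlgebroid n F E)

/-! Spinors -/

theorem spinorD_apply (ρ : C.FormFamily) (s : C.IsotropicSplitting) :
    C.spinorD ρ s = Forms.d (ρ s) - Forms.wedge (Forms.of s.twist) (ρ s) := rfl

theorem spinorInterior_apply (𝔛 : SmoothSec n F E) (ρ : C.FormFamily) (s : C.IsotropicSplitting) :
    C.spinorInterior 𝔛 ρ s = Forms.interior (C.anchorField 𝔛) (ρ s) +
      Forms.wedge (Forms.of (s.oneForm 𝔛)) (ρ s) := rfl

theorem spinorLie_apply (𝔛 : SmoothSec n F E) (ρ : C.FormFamily) (s : C.IsotropicSplitting) :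
    C.spinorLie 𝔛 ρ s = Forms.lie (C.anchorField 𝔛) (ρ s) +
      Forms.wedge (Forms.of (s.kappaForm 𝔛)) (ρ s) := rfl

/-- Moving `d` past `e^B` creates `dB ∧`, which the change `H' = H + dB` removes. -/
theorem spinorD_mem {ρ : C.FormFamily} (hρ : ρ ∈ C.spinors) : C.spinorD ρ ∈ C.spinors := by
  intro s s'
  rw [spinorD_apply, spinorD_apply, hρ s s', Forms.d_wedge_exp2, Forms.wedge_wedge_exp2,
    s.twist_eq_add s', Forms.of_add]
  simp only [map_add, map_sub, LinearMap.add_apply]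
  abel

/-- The term `ι_X B ∧` from `e^B` is absorbed by `ξ' = ξ - ι_X B`. -/
theorem spinorInterior_mem (𝔛 : SmoothSec n F E) {ρ : C.FormFamily} (hρ : ρ ∈ C.spinors) :
    C.spinorInterior 𝔛 ρ ∈ C.spinors := by
  intro s s'
  rw [spinorInterior_apply, spinorInterior_apply, hρ s s', Forms.interior_wedge_exp2,
    Forms.wedge_wedge_exp2, s.oneForm_eq_sub s', Forms.of_sub, map_sub, LinearMap.sub_apply,
    ← map_add]
  congr 1
  abel

/-- The term `L_X B ∧` from `e^B` is absorbed by the change of `dξ - ι_X H`. -/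
theorem spinorLie_mem (𝔛 : SmoothSec n F E) {ρ : C.FormFamily} (hρ : ρ ∈ C.spinors) :
    C.spinorLie 𝔛 ρ ∈ C.spinors := by
  intro s s'
  rw [spinorLie_apply, spinorLie_apply, hρ s s', Forms.lie_wedge_exp2,
    Forms.wedge_wedge_exp2, s.kappaForm_eq_sub s', Forms.of_sub, map_sub, LinearMap.sub_apply,
    ← map_add]
  congr 1
  abel

theorem spinor_eq_zero (s : C.IsotropicSplitting) {ρ : C.FormFamily} (hρ : ρ ∈ C.spinors)
    (h : ρ s = 0) : ρ = 0 := by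
  funext s'
  rw [hρ s s', h, map_zero]
  rfl

/-- The spinor with a given representative in the splitting `s`. -/
noncomputable def spinorOf (s : C.IsotropicSplitting) (φ : Forms (SmoothFn n M) (VecField n M)) :
    C.FormFamily :=
  fun s' => Forms.wedge (Forms.exp2 (s.diff s')) φ

/-- Consistency between two further splittings is the cocycle rule for `B` together with `e^{B + B'}
= e^B ∧ e^{B'}`. -/
theorem spinorOf_mem (s : C.IsotropicSplitting) (φ : Forms (SmoothFn n M) (VecField n M)) :
    C.spinorOf s φ ∈ C.spinors := by
  intro s' s''
  rw [spinorOf, spinorOf, s.diff_add_diff s' s'', Forms.exp2_add, Forms.wedge_assoc,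
    Forms.wedge_wedge_exp2]

theorem spinorOf_apply_self (s : C.IsotropicSplitting)
    (φ : Forms (SmoothFn n M) (VecField n M)) : C.spinorOf s φ s = φ := by
  rw [spinorOf, s.diff_self, Forms.exp2_zero, Forms.one_wedge]

/-- The form `e^B` is even, so all representatives of a spinor have the same parity. -/
theorem spinor_mem_familyParity_iff (s : C.IsotropicSplitting) {ρ : C.FormFamily}
    (hρ : ρ ∈ C.spinors) (i : ZMod 2) : ρ ∈ C.familyParity i ↔ ρ s ∈ Forms.parity i := by
  refine ⟨fun h => h s trivial, fun h s' _ => ?_⟩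
  rw [hρ s s', ← zero_add i]
  exact Forms.wedge_mem_parity (Forms.exp2_mem_parity _) h

theorem bijOn_inSplitting (r : ℕ) (s : C.IsotropicSplitting) :
    Set.BijOn (C.inSplitting s r) (Series.coeffsIn C.spinors : Submodule ℝ (Series r C.FormFamily))
      Set.univ := by
  refine ⟨fun _ _ => trivial, fun ρ hρ σ hσ h => ?_, fun φ _ => ?_⟩
  · rw [← sub_eq_zero]
    funext m
    refine C.spinor_eq_zero s (C.spinors.sub_mem (hρ m trivial) (hσ m trivial)) ?_
    exact sub_eq_zero.2 (congrFun h m)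
  · exact ⟨fun m => C.spinorOf s (φ m), fun m _ => C.spinorOf_mem s (φ m),
      funext fun m => C.spinorOf_apply_self s (φ m)⟩

/-! The twisted Cartan complex -/

section Action

variable {r : ℕ} {𝔤 : Type*} [LieRing 𝔤] [LieAlgebra ℝ 𝔤]
  (δ : 𝔤 →ₗ[ℝ] SmoothSec n F E) (b : Module.Basis (Fin r) ℝ 𝔤) (s : C.IsotropicSplitting)

theorem anchorField_real_smul (c : ℝ) (𝔛 : SmoothSec n F E) :
    C.anchorField (c • 𝔛) = c • C.anchorField 𝔛 :=
  C.anchorField.map_smul_of_tower c 𝔛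

theorem oneForm_add (𝔛 𝔜 : SmoothSec n F E) :
    s.oneForm (𝔛 + 𝔜) = s.oneForm 𝔛 + s.oneForm 𝔜 := by
  refine AltForm.ext_one fun Z => ?_
  rw [AlternatingMap.add_apply, s.oneForm_vec, s.oneForm_vec, s.oneForm_vec, map_add,
    LinearMap.add_apply, smul_add]

theorem oneForm_real_smul (c : ℝ) (𝔛 : SmoothSec n F E) :
    s.oneForm (c • 𝔛) = c • s.oneForm 𝔛 := by
  refine AltForm.ext_one fun Z => ?_
  rw [AlternatingMap.smul_apply, s.oneForm_vec, s.oneForm_vec, C.pair.map_smul_of_tower,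
    LinearMap.smul_apply, smul_comm]

/-- The differential `d - H ∧` of forms. -/
noncomputable def twistedDer : Forms (SmoothFn n M) (VecField n M) →ₗ[ℝ]
    Forms (SmoothFn n M) (VecField n M) :=
  Forms.d - Forms.wedge (Forms.of s.twist)

/-- The `1`-form of `δ(τ)` as a constant formal series. -/
noncomputable def constOneForm (r : ℕ) : 𝔤 →ₗ[ℝ]
    Series r (Forms (SmoothFn n M) (VecField n M)) where
  toFun τ := Series.single 0 (Forms.of (s.oneForm (δ τ)))
  map_add' τ σ := by
    rw [map_add, oneForm_add, Forms.of_add]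
    exact Pi.single_add _ _ _
  map_smul' c τ := by
    rw [map_smul, oneForm_real_smul, Forms.of_smul]
    exact Pi.single_smul _ _ _

/-- The Clifford action `ι_X + ξ ∧` of `δ(τ)` on forms. -/
noncomputable def clifford : 𝔤 →ₗ[ℝ] Forms (SmoothFn n M) (VecField n M) →ₗ[ℝ]
    Forms (SmoothFn n M) (VecField n M) where
  toFun τ := Forms.interior (C.anchorField (δ τ)) + Forms.wedge (Forms.of (s.oneForm (δ τ)))
  map_add' τ σ := by
    ext φ : 1
    simp only [map_add, LinearMap.add_apply, Forms.interior_add, oneForm_add, Forms.of_add]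
    abel
  map_smul' c τ := by
    ext φ : 1
    simp only [map_smul, LinearMap.add_apply, LinearMap.smul_apply, anchorField_real_smul,
      Forms.interior_smul, oneForm_real_smul, Forms.of_smul, RingHom.id_apply, smul_add]

theorem twistedDer_apply (φ : Forms (SmoothFn n M) (VecField n M)) :
    C.twistedDer s φ = Forms.d φ - Forms.wedge (Forms.of s.twist) φ := rfl

theorem clifford_apply (τ : 𝔤) (φ : Forms (SmoothFn n M) (VecField n M)) :
    C.clifford δ s τ φ = Forms.interior (C.anchorField (δ τ)) φ +
      Forms.wedge (Forms.of (s.oneForm (δ τ))) φ := rfl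

/-- The square of `d - H ∧` is wedging with `- dH + H ∧ H`; `H` is closed, and `H ∧ H = 0` as `H` is
odd. -/
theorem twistedDer_twistedDer (φ : Forms (SmoothFn n M) (VecField n M)) :
    C.twistedDer s (C.twistedDer s φ) = 0 := by
  have h := Series.eq_zero_of_eq_neg (Forms.odd_wedge_anticomm (Forms.sgn_of_three s.twist)
    (Forms.sgn_of_three s.twist) φ)
  simp only [twistedDer_apply, map_sub, Forms.d_d, Forms.d_wedge, Forms.d_of, s.extDer_twist,
    Forms.of_zero, Forms.sgn_of_three, h, map_zero, LinearMap.zero_apply, map_neg,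
    LinearMap.neg_apply]
  abel

variable {C δ s}

theorem PreservesSplitting.extDer_oneForm (hs : C.PreservesSplitting δ s) (τ : 𝔤) :
    AltForm.extDer (s.oneForm (δ τ)) = s.twist.curryLeft (C.anchorField (δ τ)) :=
  sub_eq_zero.1 (hs τ)

/-- In general this anticommutator is `L_X + (dξ - ι_X H) ∧`, the Lie derivative of spinors;
preserving `s` kills the second term. -/
theorem twistedDer_clifford (hs : C.PreservesSplitting δ s) (τ : 𝔤)
    (φ : Forms (SmoothFn n M) (VecField n M)) :
    C.twistedDer s (C.clifford δ s τ φ) + C.clifford δ s τ (C.twistedDer s φ) =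
      Forms.lie (C.anchorField (δ τ)) φ := by
  simp only [twistedDer_apply, clifford_apply, map_sub, map_add, Forms.interior_d,
    Forms.interior_wedge, Forms.d_wedge, Forms.d_of, Forms.interior_of, Forms.sgn_of_three,
    Forms.sgn_of_one, hs.extDer_oneForm, map_neg, LinearMap.neg_apply,
    Forms.odd_wedge_anticomm (Forms.sgn_of_three s.twist) (Forms.sgn_of_one (s.oneForm (δ τ)))]
  abel

theorem interior_of_oneForm (hiso : C.IsIsotropicAction δ) (τ σ : 𝔤) :
    Forms.interior (C.anchorField (δ τ)) (Forms.of (s.oneForm (δ σ))) =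
      - Forms.interior (C.anchorField (δ σ)) (Forms.of (s.oneForm (δ τ))) := by
  rw [Forms.interior_of, Forms.interior_of, ← Forms.of_neg]
  congr 1
  exact AltForm.ext_zero (s.oneForm_add_of_pair_eq_zero (hiso σ τ))

/-- The Clifford relation: the anticommutator is multiplication by `ξ_σ(X_τ) + ξ_τ(X_σ) = 2⟨δ(τ),
δ(σ)⟩`, which is zero. -/
theorem clifford_clifford (hiso : C.IsIsotropicAction δ) (τ σ : 𝔤)
    (φ : Forms (SmoothFn n M) (VecField n M)) :
    C.clifford δ s τ (C.clifford δ s σ φ) = - C.clifford δ s σ (C.clifford δ s τ φ) := by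
  simp only [clifford_apply, map_add, Forms.interior_wedge, Forms.sgn_of_one, map_neg,
    LinearMap.neg_apply, interior_of_oneForm (s := s) hiso τ σ,
    Forms.interior_interior (C.anchorField (δ τ)) (C.anchorField (δ σ)),
    Forms.odd_wedge_anticomm (Forms.sgn_of_one (s.oneForm (δ τ))) (Forms.sgn_of_one (s.oneForm (δ σ)))]
  abel

/-- `L_X` is the anticommutator of `d - H ∧` with the Clifford action, and `d - H ∧` has square
zero. -/
theorem lie_twistedDer (hs : C.PreservesSplitting δ s) (τ : 𝔤)
    (φ : Forms (SmoothFn n M) (VecField n M)) :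
    Forms.lie (C.anchorField (δ τ)) (C.twistedDer s φ) =
      C.twistedDer s (Forms.lie (C.anchorField (δ τ)) φ) := by
  rw [← twistedDer_clifford hs, ← twistedDer_clifford hs, map_add, twistedDer_twistedDer,
    twistedDer_twistedDer, map_zero, add_zero, zero_add]

/-- The bracket formula `oneForm_bracket`, in which the correction term is `dξ - ι_X H = 0`. -/
theorem lieDeriv_oneForm (hs : C.PreservesSplitting δ s)
    (hbr : ∀ τ σ : 𝔤, δ ⁅τ, σ⁆ = C.bracket (δ τ) (δ σ)) (τ σ : 𝔤) :
    AltForm.lieDeriv (C.anchorField (δ τ)) (s.oneForm (δ σ)) = s.oneForm (δ ⁅τ, σ⁆) := by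
  rw [hbr, s.oneForm_bracket, hs τ, AlternatingMap.curryLeft_zero, LinearMap.zero_apply, sub_zero]

theorem lie_clifford (hs : C.PreservesSplitting δ s)
    (hbr : ∀ τ σ : 𝔤, δ ⁅τ, σ⁆ = C.bracket (δ τ) (δ σ)) (τ σ : 𝔤)
    (φ : Forms (SmoothFn n M) (VecField n M)) :
    Forms.lie (C.anchorField (δ τ)) (C.clifford δ s σ φ) =
      C.clifford δ s σ (Forms.lie (C.anchorField (δ τ)) φ) + C.clifford δ s ⁅τ, σ⁆ φ := by
  have h := Forms.interior_lie (C.anchorField (δ τ)) (C.anchorField (δ σ)) φ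
  rw [← anchorField_bracket, ← hbr] at h
  simp only [clifford_apply, map_add, Forms.lie_wedge, Forms.lie_of, lieDeriv_oneForm hs hbr, h]
  abel

/-! The form `H_G` -/

variable (C δ s)

theorem equivH_eq : C.equivH δ b s = Series.single 0 (Forms.of s.twist) +
    ∑ j, Series.mulVar j (Series.single 0 (Forms.of (s.oneForm (δ (b j))))) := by
  simp only [equivH, Series.mulVar_single]

/-- Sorting by powers of `u`: the form `H` joins `d`, and each `ξ_j` joins `ι_{X_j}`, so that `d_G -
H_G ∧` takes the same shape as the differential of spinors. -/
theorem twistedD_eq : C.twistedD δ b s =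
    Series.cartanOp (C.twistedDer s) fun j => C.clifford δ s (b j) := by
  ext ρ : 1
  have h : C.equivD δ b ρ = Series.cartanOp Forms.d
    (fun j => Forms.interior (C.anchorField (δ (b j)))) ρ := rfl
  rw [twistedD, LinearMap.sub_apply, h, equivH, Series.wedge_add, Series.wedge_sum,
    Series.wedge_single_zero, Series.cartanOp_apply, Series.cartanOp_apply]
  simp only [Series.wedge_single_one]
  have h1 : Series.map (C.twistedDer s) ρ =
    Series.map Forms.d ρ - Series.map (Forms.wedge (Forms.of s.twist)) ρ := rfl
  have h2 : ∀ j, Series.map (C.clifford δ s (b j)) ρ =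
    Series.map (Forms.interior (C.anchorField (δ (b j)))) ρ +
      Series.map (Forms.wedge (Forms.of (s.oneForm (δ (b j))))) ρ := fun j => rfl
  simp only [h1, h2, map_add, Finset.sum_add_distrib]
  abel

theorem equivH_apply_eq_zero (m : Fin r →₀ ℕ) (k : ℕ) (h : k + 2 * m.degree ≠ 3) :
    C.equivH δ b s m k = 0 := by
  rw [equivH, Pi.add_apply, Pi.add_apply, Finset.sum_apply, Finset.sum_apply]
  have h1 : Series.single (0 : Fin r →₀ ℕ) (Forms.of s.twist) m k = 0 := by
    rw [Series.single, Pi.single_apply]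
    split_ifs with hm
    · refine Forms.of_ne ?_ _
      rintro rfl
      exact h (by simp [hm])
    · rfl
  rw [h1, zero_add]
  refine Finset.sum_eq_zero fun j _ => ?_
  rw [Series.single, Pi.single_apply]
  split_ifs with hm
  · refine Forms.of_ne ?_ _
    rintro rfl
    exact h (by simp [hm])
  · rfl

variable {C δ s}

/-- The constant term is `dH = 0`; the coefficient of `u_j` is `dξ_j - ι_{X_j} H = 0`, as `s` is
preserved; and the functions `ι_{X_j} ξ_k` are antisymmetric in `j` and `k` by isotropy. -/
theorem equivD_equivH (hiso : C.IsIsotropicAction δ) (hs : C.PreservesSplitting δ s) :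
    C.equivD δ b (C.equivH δ b s) = 0 := by
  have h : C.equivD δ b (C.equivH δ b s) = Series.cartanOp Forms.d
    (fun j => Forms.interior (C.anchorField (δ (b j)))) (C.equivH δ b s) := rfl
  have h0 : ∑ j, ∑ k, Series.mulVar j (Series.mulVar k (Series.single 0
      (Forms.interior (C.anchorField (δ (b j))) (Forms.of (s.oneForm (δ (b k))))))) = 0 := by
    refine Series.sum_mulVar_mulVar_eq_zero fun j k => ?_
    rw [interior_of_oneForm hiso]
    exact Pi.single_neg _ _
  have h1 : ∀ j, Series.mulVar j (∑ k, Series.mulVar k (Series.single 0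
      (Forms.interior (C.anchorField (δ (b j))) (Forms.of (s.oneForm (δ (b k))))))) =
      ∑ k, Series.mulVar j (Series.mulVar k (Series.single 0
      (Forms.interior (C.anchorField (δ (b j))) (Forms.of (s.oneForm (δ (b k))))))) := fun j =>
    map_sum _ _ _
  have h2 : Series.single (0 : Fin r →₀ ℕ) (0 : Forms (SmoothFn n M) (VecField n M)) = 0 :=
    Pi.single_zero _
  rw [h, equivH_eq, Series.cartanOp_apply]
  simp only [map_add, map_sum (Series.map _), Series.map_mulVar, Series.map_single, Forms.d_of,
    s.extDer_twist, Forms.of_zero, h2, zero_add, hs.extDer_oneForm, Finset.sum_add_distrib, h1, h0,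
    add_zero, Forms.interior_of _ s.twist, sub_self]

/-- A consequence of closedness: `- ∑ u_j L_{X_j} H_G = d_G² H_G = 0`. -/
theorem equivH_mem_cartan (hiso : C.IsIsotropicAction δ) (hs : C.PreservesSplitting δ s) :
    C.equivH δ b s ∈ C.cartan δ b := by
  rw [cartan, Series.mem_annihilated]
  have h := Series.cartanOp_cartanOp (r := r) (D₀ := Forms.d)
    (K := fun j => Forms.interior (C.anchorField (δ (b j))))
    (Θ := fun j => Forms.lie (C.anchorField (δ (b j)))) Forms.d_d
    (fun j φ => by rw [Forms.interior_d, add_sub_cancel])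
    (fun j k φ => Forms.interior_interior _ _ φ) (C.equivH δ b s)
  have h0 : Series.cartanOp Forms.d (fun j => Forms.interior (C.anchorField (δ (b j))))
    (C.equivH δ b s) = 0 := equivD_equivH b hiso hs
  rw [h0, map_zero] at h
  exact neg_eq_zero.1 h.symm

theorem equivH_mem_cartanInv (hs : C.PreservesSplitting δ s)
    (hbr : ∀ τ σ : 𝔤, δ ⁅τ, σ⁆ = C.bracket (δ τ) (δ σ)) :
    C.equivH δ b s ∈ C.cartanInv δ b := by
  rw [cartanInv, Series.mem_invariants]
  intro τ
  -- As `H` is closed, `L_X H = d ι_X H = d d ξ = 0`.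
  have h0 : AltForm.lieDeriv (C.anchorField (δ τ)) s.twist = 0 := by
    have h := AltForm.extDer_curryLeft (C.anchorField (δ τ)) s.twist
    rw [s.extDer_twist, ← hs.extDer_oneForm, AlternatingMap.curryLeft_zero, LinearMap.zero_apply,
      sub_zero] at h
    rw [← h]
    have hd := Forms.d_d (Forms.of (s.oneForm (δ τ)))
    rw [Forms.d_of, Forms.d_of] at hd
    rw [← Forms.of_self (AltForm.extDer (AltForm.extDer (s.oneForm (δ τ)))), hd]
    rfl
  have h1 : ∀ k, Series.single (0 : Fin r →₀ ℕ) (Forms.of (s.oneForm (δ ⁅τ, b k⁆))) =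
      ∑ j, b.repr ⁅τ, b k⁆ j • Series.single 0 (Forms.of (s.oneForm (δ (b j)))) := by
    intro k
    have h : C.constOneForm δ s r ⁅τ, b k⁆ =
        ∑ j, b.repr ⁅τ, b k⁆ j • C.constOneForm δ s r (b j) := by
      conv_lhs => rw [← b.sum_repr ⁅τ, b k⁆, map_sum]
      simp only [map_smul]
    exact h
  have h2 : Series.single (0 : Fin r →₀ ℕ) (0 : Forms (SmoothFn n M) (VecField n M)) = 0 :=
    Pi.single_zero _
  rw [equivH_eq]
  simp only [map_add, map_sum (Series.map _), map_sum (Series.coad b τ), Series.map_mulVar,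
    Series.map_single, Forms.lie_of, h0, Forms.of_zero, h2, lieDeriv_oneForm hs hbr,
    Series.coad_mulVar, Series.coad_single_zero, map_zero, zero_sub, zero_add, h1, map_sum,
    map_smul, Finset.sum_neg_distrib]
  -- The terms `u_k ξ_{[τ, b_k]}` from the coefficients cancel the coadjoint variation of the `u_j`,
  -- once the two summation indices are exchanged.
  rw [Finset.sum_comm, add_neg_cancel]

end Action

end ExactCourantAlgebroid

namespace ExactCourantAlgebroid

set_option linter.unusedSectionVars false

variable {n : ℕ} {M : Type*} [TopologicalSpace M] [ChartedSpace (EuclideanSpace ℝ (Fin n)) M]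
  [IsManifold (𝓡 n) ∞ M] [T2Space M] {F : Type*} [NormedAddCommGroup F] [NormedSpace ℝ F]
  {E : M → Type*} [TopologicalSpace (Bundle.TotalSpace F E)] [∀ x, AddCommGroup (E x)]
  [∀ x, Module ℝ (E x)] [∀ x, TopologicalSpace (E x)] [FiberBundle F E] [VectorBundle ℝ F E]
  [ContMDiffVectorBundle ∞ F E (𝓡 n)] {C : ExactCourantAlgebroid n F E}
  {r : ℕ} {𝔤 : Type*} [LieRing 𝔤] [LieAlgebra ℝ 𝔤]
  {δ : 𝔤 →ₗ[ℝ] SmoothSec n F E} (b : Module.Basis (Fin r) ℝ 𝔤) {s : C.IsotropicSplitting}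

/-! The complexes -/

theorem twistedDer_mem_parity (i : ZMod 2) (φ : Forms (SmoothFn n M) (VecField n M))
    (hφ : φ ∈ Forms.parity i) : C.twistedDer s φ ∈ Forms.parity (i + 1) := by
  refine Submodule.sub_mem _ (Forms.d_mem_parity hφ) ?_
  rw [add_comm i, show (1 : ZMod 2) = ((3 : ℕ) : ZMod 2) by decide]
  exact Forms.wedge_mem_parity (Forms.of_mem_parity s.twist) hφ

theorem clifford_mem_parity (τ : 𝔤) (i : ZMod 2) (φ : Forms (SmoothFn n M) (VecField n M))
    (hφ : φ ∈ Forms.parity i) : C.clifford δ s τ φ ∈ Forms.parity (i + 1) := by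
  refine Submodule.add_mem _ (Forms.interior_mem_parity _ hφ) ?_
  rw [add_comm i, ← Nat.cast_one]
  exact Forms.wedge_mem_parity (Forms.of_mem_parity (s.oneForm (δ τ))) hφ

theorem twistedD_mem_formParity (i : ZMod 2)
    (φ : Series r (Forms (SmoothFn n M) (VecField n M))) (hφ : φ ∈ formParity n M r i) :
    C.twistedD δ b s φ ∈ formParity n M r (i + 1) := by
  rw [twistedD_eq]
  exact Series.cartanOp_mem_coeffsIn (twistedDer_mem_parity i)
    (fun j => clifford_mem_parity (b j) i) hφ

theorem twistedD_twistedD (hiso : C.IsIsotropicAction δ) (hs : C.PreservesSplitting δ s)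
    {φ : Series r (Forms (SmoothFn n M) (VecField n M))} (hφ : φ ∈ C.cartan δ b) :
    C.twistedD δ b s (C.twistedD δ b s φ) = 0 := by
  rw [cartan, Series.mem_annihilated] at hφ
  rw [twistedD_eq, Series.cartanOp_cartanOp (C.twistedDer_twistedDer s)
    (fun j => twistedDer_clifford hs (b j)) fun j k => clifford_clifford hiso (b j) (b k), hφ,
    neg_zero]

theorem isTwoPeriodicComplex_cartan (hiso : C.IsIsotropicAction δ)
    (hs : C.PreservesSplitting δ s) :
    IsTwoPeriodicComplex (formParity n M r) (C.cartan δ b) (C.twistedD δ b s) where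
  graded := graded_of_proj (fun i => Series.map (Forms.parityProj i))
    (fun φ => funext fun m => Forms.parityProj_add (φ m))
    (fun i φ m _ => Forms.parityProj_mem i (φ m))
    fun i _ hφ => Series.map_mem_annihilated b
      (fun τ φ => Forms.parityProj_lie i (C.anchorField (δ τ)) φ) hφ
  odd i φ hφ := by
    refine ⟨?_, twistedD_mem_formParity b i φ hφ.2⟩
    rw [twistedD_eq]
    exact Series.cartanOp_mem_annihilated b (K := fun τ => C.clifford δ s τ)
      (C.twistedDer_twistedDer s) (twistedDer_clifford hs) (clifford_clifford hiso) hφ.1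
  square_zero _ hφ := twistedD_twistedD b hiso hs hφ

theorem isTwoPeriodicComplex_cartanInv (hiso : C.IsIsotropicAction δ)
    (hs : C.PreservesSplitting δ s) (hbr : ∀ τ σ : 𝔤, δ ⁅τ, σ⁆ = C.bracket (δ τ) (δ σ)) :
    IsTwoPeriodicComplex (formParity n M r) (C.cartanInv δ b) (C.twistedD δ b s) where
  graded := graded_of_proj (fun i => Series.map (Forms.parityProj i))
    (fun φ => funext fun m => Forms.parityProj_add (φ m))
    (fun i φ m _ => Forms.parityProj_mem i (φ m))
    fun i _ hφ => Series.map_mem_invariants b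
      (fun τ φ => Forms.parityProj_lie i (C.anchorField (δ τ)) φ) hφ
  odd i φ hφ := by
    refine ⟨?_, twistedD_mem_formParity b i φ hφ.2⟩
    rw [twistedD_eq]
    exact Series.cartanOp_mem_invariants b (K := C.clifford δ s)
      (lie_twistedDer hs) (lie_clifford hs hbr) hφ.1
  -- The square is again `- ∑ u_j L_{X_j}`, which kills invariant series because they satisfy the
  -- Cartan condition.
  square_zero _ hφ := twistedD_twistedD b hiso hs (Series.invariants_le_annihilated b _ hφ)

theorem inSplitting_extD (ρ : Series r C.FormFamily) :
    C.inSplitting s r (C.extD δ b ρ) = C.twistedD δ b s (C.inSplitting s r ρ) := by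
  rw [twistedD_eq]
  exact Series.map_cartanOp (D₀ := C.spinorD) (K := fun j => C.spinorInterior (δ (b j)))
    (D₀' := C.twistedDer s) (K' := fun j => C.clifford δ s (b j)) (f := LinearMap.proj s)
    (fun _ => rfl) (fun _ _ => rfl) ρ

theorem extD_mem_coeffsIn {ρ : Series r C.FormFamily} (hρ : ρ ∈ Series.coeffsIn C.spinors) :
    C.extD δ b ρ ∈ Series.coeffsIn C.spinors :=
  Series.cartanOp_mem_coeffsIn (D₀ := C.spinorD) (K := fun j => C.spinorInterior (δ (b j)))
    (fun _ hv => C.spinorD_mem hv) (fun j _ hv => C.spinorInterior_mem (δ (b j)) hv) hρ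

/-- This holds in the preserved splitting only; elsewhere the 2-form `dξ - ι_X H` need not vanish.
It matches the two conditions that define the complexes. -/
theorem spinorLie_apply_of_preservesSplitting (hs : C.PreservesSplitting δ s) (τ : 𝔤)
    (ρ : C.FormFamily) : C.spinorLie (δ τ) ρ s = Forms.lie (C.anchorField (δ τ)) (ρ s) := by
  rw [spinorLie_apply, hs τ, Forms.of_zero, map_zero, LinearMap.zero_apply, add_zero]

theorem mem_extCartan_iff (hs : C.PreservesSplitting δ s) {ρ : Series r C.FormFamily}
    (hρ : ρ ∈ Series.coeffsIn C.spinors) :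
    ρ ∈ C.extCartan δ b ↔ C.inSplitting s r ρ ∈ C.cartan δ b := by
  rw [extCartan, Submodule.mem_inf, and_iff_right hρ]
  exact Series.mem_annihilated_iff_map b (f := LinearMap.proj s)
    (fun _ hv h => C.spinor_eq_zero s hv h) (fun τ _ hv => C.spinorLie_mem (δ τ) hv)
    (spinorLie_apply_of_preservesSplitting hs) hρ

theorem mem_extCartanInv_iff (hs : C.PreservesSplitting δ s) {ρ : Series r C.FormFamily}
    (hρ : ρ ∈ Series.coeffsIn C.spinors) :
    ρ ∈ C.extCartanInv δ b ↔ C.inSplitting s r ρ ∈ C.cartanInv δ b := by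
  rw [extCartanInv, Submodule.mem_inf, and_iff_right hρ]
  exact Series.mem_invariants_iff_map b (f := LinearMap.proj s)
    (fun _ hv h => C.spinor_eq_zero s hv h) (fun τ _ hv => C.spinorLie_mem (δ τ) hv)
    (spinorLie_apply_of_preservesSplitting hs) hρ

/-- A subcomplex of the series of spinors that is characterized in the splitting `s` is isomorphic
to the corresponding twisted complex of forms. -/
theorem isComplexIso_inSplitting {K : Submodule ℝ (Series r C.FormFamily)}
    {K' : Submodule ℝ (Series r (Forms (SmoothFn n M) (VecField n M)))}
    (hK : K ≤ Series.coeffsIn C.spinors)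
    (hKK' : ∀ ρ ∈ Series.coeffsIn C.spinors, ρ ∈ K ↔ C.inSplitting s r ρ ∈ K')
    (h : IsTwoPeriodicComplex (formParity n M r) K' (C.twistedD δ b s)) :
    IsComplexIso (C.extParity r) K (C.extD δ b) (formParity n M r) K' (C.twistedD δ b s)
      (C.inSplitting s r) := by
  -- Oddness is known for homogeneous elements; the grading extends stability to all of `K'`.
  have hD : ∀ φ ∈ K', C.twistedD δ b s φ ∈ K' := by
    intro φ hφ
    rw [h.graded] at hφ
    obtain ⟨φ₀, h₀, φ₁, h₁, rfl⟩ := Submodule.mem_sup.1 hφ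
    rw [map_add]
    exact K'.add_mem (h.odd 0 φ₀ h₀).1 (h.odd 1 φ₁ h₁).1
  refine IsComplexIso.of_target h ⟨fun ρ hρ => (hKK' ρ (hK hρ)).1 hρ, ?_, fun φ hφ => ?_⟩
    (fun i ρ hρ => ?_) (fun ρ _ => inSplitting_extD b ρ) fun ρ hρ => ?_
  · exact (C.bijOn_inSplitting r s).injOn.mono hK
  · obtain ⟨ρ, hρ, rfl⟩ := (C.bijOn_inSplitting r s).surjOn (Set.mem_univ φ)
    exact ⟨ρ, (hKK' ρ hρ).2 hφ, rfl⟩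
  · exact forall₂_congr fun m hm => C.spinor_mem_familyParity_iff s (hK hρ m hm) i
  · rw [hKK' _ (extD_mem_coeffsIn b (hK hρ)), inSplitting_extD]
    exact hD _ ((hKK' ρ (hK hρ)).1 hρ)

end ExactCourantAlgebroid

/-! ### The comparison theorem -/

theorem mainTheorem3 (n r : ℕ)
    {M : Type*} [TopologicalSpace M] [ChartedSpace (EuclideanSpace ℝ (Fin n)) M]
    [IsManifold (𝓡 n) ∞ M] [T2Space M] [SecondCountableTopology M]
    {F : Type*} [NormedAddCommGroup F] [NormedSpace ℝ F] [FiniteDimensional ℝ F]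
    {E : M → Type*} [TopologicalSpace (Bundle.TotalSpace F E)] [∀ x, AddCommGroup (E x)]
    [∀ x, Module ℝ (E x)] [∀ x, TopologicalSpace (E x)] [FiberBundle F E] [VectorBundle ℝ F E]
    [ContMDiffVectorBundle ∞ F E (𝓡 n)]
    (C : ExactCourantAlgebroid n F E)
    {𝔤 : Type*} [LieRing 𝔤] [LieAlgebra ℝ 𝔤] (b : Module.Basis (Fin r) ℝ 𝔤)
    (δ : 𝔤 →ₗ[ℝ] SmoothSec n F E) (hδ : C.IsExtendedAction δ) (hiso : C.IsIsotropicAction δ)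
    (s : C.IsotropicSplitting) (hs : C.PreservesSplitting δ s) :
    -- `H_G` is an equivariantly closed form of degree three
    ((∀ (m : Fin r →₀ ℕ) (k : ℕ), k + 2 * m.degree ≠ 3 → C.equivH δ b s m k = 0) ∧
      C.equivH δ b s ∈ C.cartan δ b ∧ C.equivD δ b (C.equivH δ b s) = 0) ∧
    -- the extended Cartan complex is isomorphic to the twisted Cartan complex of `M`
    IsComplexIso (C.extParity r) (C.extCartan δ b) (C.extD δ b)
      (ExactCourantAlgebroid.formParity n M r) (C.cartan δ b) (C.twistedD δ b s)
      (C.inSplitting s r) ∧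
    (∀ i : ZMod 2, ∃ e : Cohomology (C.extParity r) (C.extCartan δ b) (C.extD δ b) i ≃ₗ[ℝ]
        Cohomology (ExactCourantAlgebroid.formParity n M r) (C.cartan δ b) (C.twistedD δ b s) i,
      IsInducedBy e (C.inSplitting s r)) ∧
    -- the same for the diagonally invariant formal series, if `δ` is compatible with the brackets
    ((∀ τ σ : 𝔤, δ ⁅τ, σ⁆ = C.bracket (δ τ) (δ σ)) →
      C.equivH δ b s ∈ C.cartanInv δ b ∧
      IsComplexIso (C.extParity r) (C.extCartanInv δ b) (C.extD δ b)
        (ExactCourantAlgebroid.formParity n M r) (C.cartanInv δ b) (C.twistedD δ b s)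
        (C.inSplitting s r) ∧
      ∀ i : ZMod 2, ∃ e : Cohomology (C.extParity r) (C.extCartanInv δ b) (C.extD δ b) i ≃ₗ[ℝ]
          Cohomology (ExactCourantAlgebroid.formParity n M r) (C.cartanInv δ b)
            (C.twistedD δ b s) i,
        IsInducedBy e (C.inSplitting s r)) := by
  have h := ExactCourantAlgebroid.isComplexIso_inSplitting b inf_le_left
    (fun _ hρ => ExactCourantAlgebroid.mem_extCartan_iff b hs hρ)
    (ExactCourantAlgebroid.isTwoPeriodicComplex_cartan b hiso hs)
  refine ⟨⟨C.equivH_apply_eq_zero δ b s, ExactCourantAlgebroid.equivH_mem_cartan b hiso hs,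
    ExactCourantAlgebroid.equivD_equivH b hiso hs⟩, h, h.exists_cohomology_equiv, fun hbr => ?_⟩
  have h' := ExactCourantAlgebroid.isComplexIso_inSplitting b inf_le_left
    (fun _ hρ => ExactCourantAlgebroid.mem_extCartanInv_iff b hs hρ)
    (ExactCourantAlgebroid.isTwoPeriodicComplex_cartanInv b hiso hs hbr)
  exact ⟨ExactCourantAlgebroid.equivH_mem_cartanInv b hs hbr, h', h'.exists_cohomology_equiv⟩
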